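/- Let $G$ be a finite group and let $G_2$ be a Sylow $2$-subgroup of $G$. Suppose that $\mathrm{rk}(G_2)=2$, where the rank $\mathrm{rk}(H)$ of a finite group $H$ is the largest $d$ such that, for some prime $p$, $H$ has a subgroup isomorphic to $(\mathbb{Z}/p)^d$. Let $\Omega_1(Z(G_2))$ be the subgroup generated by the elements of order $2$ of the center $Z(G_2)$. If $\Omega_1(Z(G_2))$ is not strongly closed in $G_2$ with respect to $G$, that is, if it is not the case that $g\,\Omega_1(Z(G_2))\,g^{-1}\cap G_2\subseteq \Omega_1(Z(G_2))$ for every $g\in G$, then $G_2$ is dihedral, semi-dihedral or wreathed, that is, $G_2$ is isomorphic to one of the following groups: - a dihedral group of order $2^{n+1}$ with $n\ge 2$; - a semi-dihedral group $\langle x,y \mid y^2=x^{2^n}=1,\ yxy^{-1}=x^{-1+2^{n-1}}\rangle$ with $n\ge 3$; - a wreathed group $\langle x,y,z \mid x^{2^n}=y^{2^n}=z^2=1,\ xy=yx,\ zxz^{-1}=y\rangle$ with $n\ge 2$. -/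

import Mathlib

/-- `E` is an elementary abelian `p`-subgroup: abelian, and every element satisfies `x ^ p = 1`
(used for `p` prime; the trivial subgroup is the one of rank `0`). -/
def IsElemAbelian {G : Type*} [Group G] (p : ℕ) (E : Subgroup G) : Prop :=
  (∀ x ∈ E, ∀ y ∈ E, x * y = y * x) ∧ ∀ x ∈ E, x ^ p = 1

/-- The `p`-rank of a finite group (`p` prime): the largest `d` such that the group has an
elementary abelian `p`-subgroup of rank `d`, that is, of order `p ^ d`. -/
noncomputable def pRank (p : ℕ) (G : Type*) [Group G] : ℕ :=
  sSup {d : ℕ | ∃ E : Subgroup G, IsElemAbelian p E ∧ Nat.card E = p ^ d}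

/-- The rank of a finite group: the maximum of its `p`-ranks over all primes `p`. -/
noncomputable def elemRank (G : Type*) [Group G] : ℕ :=
  sSup {d : ℕ | ∃ p : ℕ, p.Prime ∧ d = pRank p G}

/-- The subgroup `Ω₁(H)` of `G`, generated by the elements of order `p` of the subgroup `H`. -/
def omegaOne {G : Type*} [Group G] (p : ℕ) (H : Subgroup G) : Subgroup G :=
  Subgroup.closure {x : G | x ∈ H ∧ orderOf x = p}

/-- The center `Z(H)` of a subgroup `H` of `G`, as a subgroup of `G`. -/
def centerOf {G : Type*} [Group G] (H : Subgroup G) : Subgroup G :=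
  (Subgroup.center H).map H.subtype

/-- `H` is strongly closed in `K` with respect to the ambient group `G`:
`H ≤ K`, and `g H g⁻¹ ∩ K ≤ H` for every `g` in `G`. -/
def IsStronglyClosed {G : Type*} [Group G] (H K : Subgroup G) : Prop :=
  H ≤ K ∧ ∀ g : G, H.map (MulAut.conj g).toMonoidHom ⊓ K ≤ H

/-- `P` is a dihedral 2-group, that is, dihedral of order `2 ^ (n + 1)` for some `n ≥ 2`. -/
def IsDihedralTwoGroup (P : Type*) [Group P] : Prop :=
  ∃ n : ℕ, 2 ≤ n ∧ Nonempty (P ≃* DihedralGroup (2 ^ n))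

/-- The relators, in the generators `x` and `y`, of the presentation
`⟨x, y | y ^ 2 = x ^ (2 ^ n) = 1, y x y⁻¹ = x ^ (-1 + 2 ^ (n - 1))⟩` (used for `n ≥ 3`). -/
def semidihedralRels (n : ℕ) : Set (FreeGroup (Fin 2)) :=
  let x := FreeGroup.of (0 : Fin 2)
  let y := FreeGroup.of (1 : Fin 2)
  {y ^ 2, x ^ (2 ^ n), y * x * y⁻¹ * (x ^ ((-1 : ℤ) + 2 ^ (n - 1)))⁻¹}

/-- `P` is a semi-dihedral (quasi-dihedral) 2-group. -/
def IsSemidihedral (P : Type*) [Group P] : Prop :=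
  ∃ n : ℕ, 3 ≤ n ∧ Nonempty (P ≃* PresentedGroup (semidihedralRels n))

/-- The relators, in the generators `x`, `y` and `z`, of the presentation
`⟨x, y, z | x ^ (2 ^ n) = y ^ (2 ^ n) = z ^ 2 = 1, x y = y x, z x z⁻¹ = y⟩`. -/
def wreathedRels (n : ℕ) : Set (FreeGroup (Fin 3)) :=
  let x := FreeGroup.of (0 : Fin 3)
  let y := FreeGroup.of (1 : Fin 3)
  let z := FreeGroup.of (2 : Fin 3)
  {x ^ (2 ^ n), y ^ (2 ^ n), z ^ 2, x * y * (y * x)⁻¹, z * x * z⁻¹ * y⁻¹}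

/-- `P` is a wreathed 2-group. -/
def IsWreathed (P : Type*) [Group P] : Prop :=
  ∃ n : ℕ, 2 ≤ n ∧ Nonempty (P ≃* PresentedGroup (wreathedRels n))

/-! Write S for the Sylow subgroup. If strong closure fails, some involution z in Z(S) has a
G-conjugate t in S that is not central in S. Since S has rank two, two commuting involutions account
for every involution commuting with both (`eq_of_commuting_involutions`). Hence z is the only
central involution of S, and growth of normalizers makes each noncentral involution v conjugate in S
to zv (`exists_conj_eq_mul_of_isPGroup`). Such a conjugation is a transvection of a four-group
fixing z. A G-conjugate of one fixes another involution instead, and the product of the two is a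
3-cycle. Sylow's theorem in C_G(z) and in the centralizer of the four-group then adjusts the data
(`exists_triality`): there are a noncentral v and an element b of 3-power order cycling z, v, zv and
carrying Q = C_S(v) into itself.

The heart is that Q is abelian (`InvolutionAction.commute`). Its involutions form, with 1, a central
four-group V. Conjugation by b gives a fixed-point-free α, and an element of S swapping v and zv
gives a second automorphism with inner square. Let A/V consist of the central elements of Q/V of
order dividing 2. Squaring is an anisotropic quadratic map from A/V to V compatible with both
automorphisms, which forces |A/V| ≤ 4 (`card_le_four_of_anisotropic`). A fixed-point-free injective
endomorphism leaves no room for a nonabelian group with a central subgroup of index at most 4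
(`mul_comm_of_card_le_four_mul`), so A is abelian. A commutator pairing into V can transform under α
in only one way, [αu, g] = α²[u, g] (`pairing_map_eq`). Applying this in two consecutive layers
shows that A is central (`centralizer_eq_top`). Then Q/V satisfies the same hypotheses and is
abelian by induction, so the preimage in Q of the squares of Q/V is central of index 4, and Q is
abelian.

If Q = V, then C_S(v) has order 4, so S has a cyclic subgroup of index 2 and is dihedral or
semidihedral. Otherwise Q is homocyclic with a basis exchanged by an outer element, is normal of
index 2 and has a complement, so S is wreathed. -/

/-! ### Pairings and small central quotients under fixed-point-free maps -/

/-- Heuristically all three arguments are modules over 𝔽₄, with a, b, c acting as ω. A biadditive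
map splits into parts on which the variables contribute ω^ε and ω^δ with ε, δ = ±1. Equivariance
requires ε + δ ≡ 1 mod 3, so ε = δ = -1, and b acts through φ as c⁻¹ = c². The proof carries this
out by hand inside R. -/
theorem pairing_map_eq {X W R : Type*} [Group X] [Finite X] [Group W] [Group R]
    (a : X →* X) (b : W →* W) (c : R →* R) (φ : X → W → R)
    (hfix : ∀ x, a x = x → x = 1)
    (hmul_left : ∀ x y w, φ (x * y) w = φ x w * φ y w)
    (hmul_right : ∀ x v w, φ x (v * w) = φ x v * φ x w)
    (hcomm : ∀ x w r, φ x w * r = r * φ x w)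
    (hequiv : ∀ x w, φ (a x) (b w) = c (φ x w))
    (hker : ∀ x w, φ x (w * b w * b (b w)) = 1)
    (htrace : ∀ x w, φ x w * c (φ x w) * c (c (φ x w)) = 1)
    (hsq : ∀ x w, φ x w * φ x w = 1) (x : X) (w : W) :
    φ x (b w) = c (c (φ x w)) := by
  have hone : ∀ w, φ 1 w = 1 := fun w => by
    have := hmul_left 1 1 w
    rw [mul_one] at this
    exact (mul_eq_left.1 this.symm)
  have htw : ∀ x w, φ x (b (b w)) = φ x w * φ x (b w) := fun x w => by
    have h := hker x w
    rw [hmul_right, hmul_right] at h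
    have h2 := hsq x (b (b w))
    exact (mul_right_cancel (h.trans h2.symm)).symm
  have h3 : ∀ x w, φ x (b (b (b w))) = φ x w := fun x w => by
    rw [htw x (b w), htw x w, hcomm x w, ← mul_assoc, hsq, one_mul]
  have hc3 : ∀ x w, c (c (c (φ x w))) = φ x w := fun x w => by
    have h1 := htrace x w
    have h2 := congrArg c h1
    simp only [map_mul, map_one] at h2
    rw [mul_assoc, hcomm x w] at h1
    exact mul_left_cancel (h2.trans h1.symm)
  have hax3 : ∀ x w, φ (a (a (a x))) w = φ x w := fun x w => by
    rw [← h3 (a (a (a x))) w, hequiv, hequiv, hequiv, hc3]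
  have hrow : ∀ x w, φ x w * φ (a x) w * φ (a (a x)) w = 1 := by
    intro x w
    -- On a finite group a fixed-point-free a makes y ↦ y⁻¹ * a y injective, hence surjective. The
    -- product over three translates then telescopes, because a³ is invisible to φ.
    obtain ⟨y, rfl⟩ : ∃ y, y⁻¹ * a y = x := by
      have hinj : Function.Injective (fun y : X => y⁻¹ * a y) := by
        intro y y' h
        have h' : a (y * y'⁻¹) = y * y'⁻¹ := by
          simp only at h
          rw [map_mul, map_inv, mul_inv_eq_iff_eq_mul, mul_assoc, ← h]
          group
        exact mul_inv_eq_one.1 (hfix _ h')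
      exact Finite.surjective_of_injective hinj x
    have hinv : ∀ y w, φ y⁻¹ w = φ y w := fun y w => by
      have h := hmul_left y⁻¹ y w
      rw [inv_mul_cancel, hone] at h
      exact mul_right_cancel (h.symm.trans (hsq y w).symm)
    simp only [map_mul, map_inv, hmul_left, hinv, hax3]
    set p := φ y w
    set q := φ (a y) w
    set r := φ (a (a y)) w
    have hp : ∀ s, p * s = s * p := hcomm _ _
    have hq : ∀ s, q * s = s * q := hcomm _ _
    have hpp : p * p = 1 := hsq _ _
    have hqq : q * q = 1 := hsq _ _
    have hrr : r * r = 1 := hsq _ _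
    calc p * q * (q * r) * (r * p) = p * (q * q) * (r * r) * p := by group
      _ = 1 := by rw [hqq, hrr]; simp [hpp]
  have h := hrow x (b (b w))
  have e1 : φ (a (a x)) (b (b w)) = c (c (φ x w)) := by rw [hequiv, hequiv]
  have e2 : φ (a x) (b (b w)) = c (φ x (b w)) := by rw [hequiv]
  have e3 := hrow x (b w)
  have e4 : φ (a x) (b w) = c (φ x w) := by rw [hequiv]
  have e5 : φ (a (a x)) (b w) = c (c (φ x (b (b w)))) := by
    rw [← hequiv, ← hequiv, h3]
  rw [e4, e5, htw, map_mul, map_mul] at e3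
  set p := φ x w
  set q := φ x (b w)
  have t1 : c p * c (c p) = p := by
    have := htrace x w
    have h2 := hsq x w
    rw [mul_assoc] at this
    exact mul_left_cancel (this.trans h2.symm)
  have t2 : q * c (c q) = c q := by
    have h1 := htrace x (b w)
    have h2 : c q * c q = 1 := by rw [← map_mul, hsq, map_one]
    have h3 := hcomm x (b w) (c q)
    change q * c q * c (c q) = 1 at h1
    rw [show q * c q = c q * q from h3, mul_assoc] at h1
    exact mul_left_cancel (h1.trans h2.symm)
  have e6 : p * c q = 1 := by
    rw [← t2, ← e3]
    calc p * (q * c (c q)) = q * p * c (c q) := by rw [← mul_assoc, show p * q = q * p from hcomm _ _ _]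
      _ = q * (c p * c (c p)) * c (c q) := by rw [t1]
      _ = _ := by simp only [mul_assoc]
  have e7 : c q = p := mul_left_cancel (e6.trans (hsq x w).symm)
  rw [← e7]
  exact (hc3 x (b w)).symm

/-- If X were nonabelian, X/Z would be a four-group and 1, c would be the only commutators, with c ≠
1. Then a, being injective, would have to fix c. It is not required that a preserve Z. -/
theorem mul_comm_of_card_le_four_mul {X : Type*} [Group X] [Finite X] (a : X →* X)
    (hinj : Function.Injective a) (hfix : ∀ x, a x = x → x = 1) (Z : Subgroup X) (hZ : ∀ z ∈ Z, ∀ x, z * x = x * z)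
    (hcard : Nat.card X ≤ 4 * Nat.card Z) (x y : X) : x * y = y * x := by
  by_contra hxy
  have hidx : Z.index ≤ 4 := by
    have h := Z.card_mul_index
    have hpos : 0 < Nat.card Z := Nat.card_pos
    nlinarith
  have hZC : ∀ {g} x, g ∈ Z → g ∈ Subgroup.centralizer {x} := fun x hg =>
    Subgroup.mem_centralizer_singleton_iff.2 (hZ _ hg x)
  have hself : ∀ x : X, x ∈ Subgroup.centralizer {x} := fun x =>
    Subgroup.mem_centralizer_singleton_iff.2 rfl
  have hyC : y ∉ Subgroup.centralizer {x} := fun h =>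
    hxy (Subgroup.mem_centralizer_singleton_iff.1 h).symm
  have hxC : x ∉ Subgroup.centralizer {y} := fun h =>
    hxy (Subgroup.mem_centralizer_singleton_iff.1 h)
  -- As x and y do not commute, 1, x, y, xy represent four distinct cosets of Z, so they exhaust an
  -- index of at most 4.
  have hcos : ∀ g : X, ∃ z ∈ Z, g = z ∨ g = x * z ∨ g = y * z ∨ g = x * y * z := by
    intro g
    by_contra! hg
    have hnot : ∀ s, (∀ z ∈ Z, g ≠ s * z) → (QuotientGroup.mk s : X ⧸ Z) ≠ QuotientGroup.mk g := by
      intro s hs h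
      exact hs _ (QuotientGroup.eq.1 h) (by group)
    have h1 := hnot 1 (fun z hz => by simpa using (hg z hz).1)
    have h2 := hnot x (fun z hz => (hg z hz).2.1)
    have h3 := hnot y (fun z hz => (hg z hz).2.2.1)
    have h4 := hnot (x * y) (fun z hz => (hg z hz).2.2.2)
    have d1 : (QuotientGroup.mk 1 : X ⧸ Z) ≠ QuotientGroup.mk x := fun h =>
      hxC (hZC y (by simpa using QuotientGroup.eq.1 h))
    have d2 : (QuotientGroup.mk 1 : X ⧸ Z) ≠ QuotientGroup.mk y := fun h =>
      hyC (hZC x (by simpa using QuotientGroup.eq.1 h))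
    have d3 : (QuotientGroup.mk 1 : X ⧸ Z) ≠ QuotientGroup.mk (x * y) := fun h =>
      hyC ((mul_mem_cancel_left (hself x)).1 (hZC x (by simpa using QuotientGroup.eq.1 h)))
    have d4 : (QuotientGroup.mk x : X ⧸ Z) ≠ QuotientGroup.mk y := fun h =>
      hyC ((mul_mem_cancel_left (inv_mem (hself x))).1 (hZC x (QuotientGroup.eq.1 h)))
    have d5 : (QuotientGroup.mk x : X ⧸ Z) ≠ QuotientGroup.mk (x * y) := fun h =>
      hyC (hZC x (by simpa using QuotientGroup.eq.1 h))
    have d6 : (QuotientGroup.mk y : X ⧸ Z) ≠ QuotientGroup.mk (x * y) := fun h =>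
      hxC ((mul_mem_cancel_right (hself y)).1 ((mul_mem_cancel_left (inv_mem (hself y))).1
        (hZC y (QuotientGroup.eq.1 h))))
    classical
    have : Fintype (X ⧸ Z) := Fintype.ofFinite _
    have hc := Finset.card_le_univ ({QuotientGroup.mk 1, QuotientGroup.mk x, QuotientGroup.mk y,
      QuotientGroup.mk (x * y), QuotientGroup.mk g} : Finset (X ⧸ Z))
    rw [← Nat.card_eq_fintype_card, ← Subgroup.index,
      Finset.card_insert_of_notMem (by simp [d1, d2, d3, h1]),
      Finset.card_insert_of_notMem (by simp [d4, d5, h2]),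
      Finset.card_insert_of_notMem (by simp [d6, h3]),
      Finset.card_insert_of_notMem (by simp [h4]), Finset.card_singleton] at hc
    omega
  obtain ⟨c, hcZ, hc⟩ : ∃ c ∈ Z, y * x = x * y * c := by
    obtain ⟨z, hz, h | h | h | h⟩ := hcos (y * x)
    · exact absurd ((mul_mem_cancel_right (hself x)).1 (h ▸ hZC x hz)) hyC
    · exact absurd ((mul_mem_cancel_right (hself x)).1
        (h ▸ mul_mem (hself x) (hZC x hz))) hyC
    · exact absurd (mul_left_cancel h ▸ hZC y hz) hxC
    · exact ⟨z, hz, h⟩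
  have hc1 : c ≠ 1 := fun h => hxy (by rw [hc, h, mul_one])
  have hcz : ∀ g, c * g = g * c := hZ c hcZ
  have hcc : c * c = 1 := by
    have hx2 : ∀ g, x * x * g = g * (x * x) := by
      obtain ⟨z, hz, h | h | h | h⟩ := hcos (x * x)
      · rw [h]; exact hZ z hz
      · exact absurd (mul_left_cancel h ▸ hZC y hz) hxC
      · exact absurd ((mul_mem_cancel_right (hZC x hz)).1
          (h ▸ mul_mem (hself x) (hself x))) hyC
      · rw [mul_assoc] at h
        exact absurd (mul_left_cancel h ▸ mul_mem (hself y) (hZC y hz)) hxC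
    have h1 : y * (x * x) = x * x * y * (c * c) := by
      calc y * (x * x) = (y * x) * x := by group
        _ = x * y * (c * x) := by rw [hc]; group
        _ = x * (y * x) * c := by rw [hcz]; group
        _ = x * x * y * (c * c) := by rw [hc]; group
    rw [hx2 y] at h1
    exact (mul_eq_left.1 h1.symm)
  -- The commutator of g and h is 1 or c. Since c is central with c² = 1, this relation is closed
  -- under products and passes from x, y and Z to the whole group.
  let P : X → X → Prop := fun g h => h * g = g * h ∨ h * g = g * h * c
  have hPsymm : ∀ {g h}, P g h → P h g := by
    rintro g h (e | e)
    · exact Or.inl e.symm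
    · exact Or.inr (by rw [e, mul_assoc, hcc, mul_one])
  have hPmul : ∀ {g g' h}, P g h → P g' h → P (g * g') h := by
    rintro g g' h (e | e) (e' | e')
    · exact Or.inl (by rw [← mul_assoc, e, mul_assoc, e', mul_assoc])
    · exact Or.inr (by rw [← mul_assoc, e, mul_assoc, e']; simp only [mul_assoc])
    · exact Or.inr (by rw [← mul_assoc, e, mul_assoc, hcz, ← mul_assoc, mul_assoc g, e']; simp only [mul_assoc])
    · refine Or.inl ?_
      rw [← mul_assoc, e, mul_assoc, hcz, ← mul_assoc, mul_assoc g, e', mul_assoc, mul_assoc _ c c,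
        hcc, mul_one, mul_assoc]
  have hPZ : ∀ {z} h, z ∈ Z → P z h := fun h hz => Or.inl (hZ _ hz h).symm
  have hPgen : ∀ {h}, P x h → P y h → ∀ g, P g h := by
    intro h hx hy g
    obtain ⟨z, hz, rfl | rfl | rfl | rfl⟩ := hcos g
    · exact hPZ h hz
    · exact hPmul hx (hPZ h hz)
    · exact hPmul hy (hPZ h hz)
    · exact hPmul (hPmul hx hy) (hPZ h hz)
  have hPx : ∀ g, P g x := hPgen (Or.inl rfl) (hPsymm (Or.inr hc))
  have hPy : ∀ g, P g y := hPgen (Or.inr hc) (Or.inl rfl)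
  have hac := congrArg a hc
  simp only [map_mul] at hac
  rcases hPgen (hPsymm (hPx (a y))) (hPsymm (hPy (a y))) (a x) with h | h
  · rw [h] at hac
    have h1 : a c = 1 := mul_eq_left.1 hac.symm
    exact hc1 (hinj (h1.trans (map_one a).symm))
  · rw [h] at hac
    exact hc1 (hfix c (mul_left_cancel hac).symm)

/-! ### Anisotropic quadratic maps into a four-group -/

/-- If a permutation `f` of `3`-power order acts on a finite type, the number of fixed points is
congruent mod `3` to the cardinality. -/
theorem card_fixed_modEq_three {T : Type*} [Finite T] (f : Equiv.Perm T) {k : ℕ}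
    (hf : f ^ 3 ^ k = 1) : Nat.card T ≡ Nat.card {t // f t = t} [MOD 3] := by
  have hp : IsPGroup 3 (Subgroup.zpowers f) := by
    apply IsPGroup.of_card_dvd_pow (n := k)
    rw [Nat.card_zpowers]
    exact orderOf_dvd_of_pow_eq_one hf
  have : Fact (Nat.Prime 3) := ⟨Nat.prime_three⟩
  refine (hp.card_modEq_card_fixedPoints T).trans ?_
  rw [Nat.card_congr (Equiv.subtypeEquivRight (q := fun t => f t = t) ?_)]
  intro t
  constructor
  · intro h
    exact h ⟨f, Subgroup.mem_zpowers f⟩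
  · rintro h ⟨g, hg⟩
    obtain ⟨n, rfl⟩ := Subgroup.mem_zpowers_iff.1 hg
    exact Equiv.Perm.zpow_apply_eq_self_of_apply_eq_self h n

/-- On the fixed space F of τ, the map q takes values in the fixed space of σ, which has at most one
nonzero element. So q is constant on F \ {0}, which bounds F by 4 and U by 16. Counting fibres under
α leaves only |U| = 16 with α³ = 1, and there an isotropic vector u + αv can be written down. -/
theorem card_le_four_of_anisotropic {U V : Type*} [AddCommGroup U] [Finite U] [AddCommGroup V]
    [Finite V] (q : U → V) (b : U → U → V)
    (hq : ∀ x y, q (x + y) = q x + q y + b x y)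
    (hb_left : ∀ x y w, b (x + y) w = b x w + b y w)
    (hb_right : ∀ x y w, b x (y + w) = b x y + b x w)
    (hU : ∀ x : U, x + x = 0) (hV : ∀ v : V, v + v = 0)
    (haniso : ∀ x, q x = 0 → x = 0) (hcardV : Nat.card V = 4)
    (α : U →+ U) (β : V →+ V) (hqα : ∀ x, q (α x) = β (q x))
    (hβ : ∀ v, v + β v + β (β v) = 0) {k : ℕ} (hk : ∀ x, α^[3 ^ k] x = x)
    (τ : U →+ U) (σ : V →+ V) (hqτ : ∀ x, q (τ x) = σ (q x)) (hτ : ∀ x, τ (τ x) = x)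
    (hσ : ∃ v, σ v ≠ v) : Nat.card U ≤ 4 := by
  have hb0 : ∀ x, b x 0 = 0 := fun x => by
    have := hb_right x 0 0
    rw [add_zero] at this
    exact left_eq_add.1 this
  have hq0 : q 0 = 0 := by
    have := hq 0 0
    rw [add_zero, hV, hb0, add_zero] at this
    exact this
  have hbsymm : ∀ x y, b x y = b y x := fun x y => by
    have := hq x y
    rw [add_comm, hq y x, add_comm (q y)] at this
    exact (add_left_cancel this).symm
  have hbself : ∀ x, b x x = 0 := fun x => by
    have := hq x x
    rw [hU, hV, hq0, zero_add] at this
    exact this.symm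
  have hnegU : ∀ x y : U, x + y = 0 → x = y := fun x y h => add_right_cancel (h.trans (hU y).symm)
  have hnegV : ∀ x y : V, x + y = 0 → x = y := fun x y h => add_right_cancel (h.trans (hV y).symm)
  -- the fixed points of `σ`
  have hσfix : ∀ s s', σ s = s → σ s' = s' → s ≠ 0 → s' ≠ 0 → s = s' := by
    intro s s' hs hs' h0 h0'
    by_contra hne
    obtain ⟨v, hv⟩ := hσ
    have : Fintype V := Fintype.ofFinite _
    classical
    have hss : s + s' ≠ 0 := fun h => hne (hnegV _ _ h)
    have hc := Finset.card_le_univ ({0, s, s', s + s', v} : Finset V)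
    have hv0 : v ≠ 0 := fun h => hv (by rw [h, map_zero])
    have hv1 : v ≠ s := fun h => hv (by rw [h, hs])
    have hv2 : v ≠ s' := fun h => hv (by rw [h, hs'])
    have hv3 : v ≠ s + s' := fun h => hv (by rw [h, map_add, hs, hs'])
    rw [← Nat.card_eq_fintype_card, hcardV,
      Finset.card_insert_of_notMem (by simp [h0.symm, h0'.symm, hss.symm, hv0.symm]),
      Finset.card_insert_of_notMem (by simp [hne, h0', hv1.symm]),
      Finset.card_insert_of_notMem (by simp [h0, hv2.symm]),
      Finset.card_insert_of_notMem (by simp [hv3.symm]), Finset.card_singleton] at hc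
    omega
  by_contra! hlarge
  let F : AddSubgroup U := (τ + AddMonoidHom.id U).ker
  have hF : ∀ x, x ∈ F ↔ τ x = x := fun x => by
    rw [AddMonoidHom.mem_ker]
    exact ⟨fun h => hnegU _ _ h, fun h => by simp [h, hU]⟩
  have hqF : ∀ x ∈ F, σ (q x) = q x := fun x hx => by rw [← hqτ, (hF x).1 hx]
  have hqne : ∀ x, x ≠ 0 → q x ≠ 0 := fun x hx h => hx (haniso x h)
  have hqeq : ∀ x ∈ F, ∀ y ∈ F, x ≠ 0 → y ≠ 0 → q x = q y := fun x hx y hy h h' =>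
    hσfix _ _ (hqF x hx) (hqF y hy) (hqne x h) (hqne y h')
  have hbF : ∀ x ∈ F, ∀ y ∈ F, x ≠ 0 → y ≠ 0 → x ≠ y → b x y = q x := by
    intro x hx y hy h h' hne
    have h1 := hq x y
    rw [← hqeq x hx y hy h h', hV, zero_add] at h1
    rw [← h1]
    exact hqeq _ (add_mem hx hy) _ hx (fun h => hne (hnegU _ _ h)) h
  have hFcard : Nat.card F ≤ 4 := by
    by_contra! hF5
    have : Fintype F := Fintype.ofFinite _
    classical
    have hex : ∀ s : Finset F, s.card ≤ 4 → ∃ x, x ∉ s := by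
      intro s hs
      by_contra! h
      have := Finset.card_le_card (Finset.subset_iff.2 fun x _ => h x : Finset.univ ⊆ s)
      rw [Finset.card_univ, ← Nat.card_eq_fintype_card] at this
      omega
    obtain ⟨x, hx⟩ := hex {0} (by simp)
    obtain ⟨y, hy⟩ := hex {0, x} (Finset.card_le_two.trans (by norm_num))
    obtain ⟨w, hw⟩ := hex {0, x, y, x + y} (Finset.card_le_four)
    simp only [Finset.mem_singleton, Finset.mem_insert, not_or, Subtype.ext_iff] at hx hy hw
    obtain ⟨hy0, hyx⟩ := hy
    obtain ⟨hw0, hwx, hwy, hwxy⟩ := hw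
    have e1 := hbF x x.2 w w.2 hx hw0 (Ne.symm hwx)
    have e2 := hbF y y.2 w w.2 hy0 hw0 (Ne.symm hwy)
    have e3 := hbF _ (add_mem x.2 y.2) w w.2 (fun h => hyx (hnegU _ _ h).symm) hw0 (Ne.symm hwxy)
    rw [hb_left, e1, e2, hqeq y y.2 x x.2 hy0 hx, hV] at e3
    exact hqne _ (fun h => hyx (hnegU _ _ h).symm) e3.symm
  -- As (τ + 1)² = 0, the image of τ + 1 lies in its kernel F, so |U| ≤ |F|².
  have hUcard : ∃ r, r ≤ Nat.card F ∧ Nat.card U = Nat.card F * r := by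
    refine ⟨Nat.card (τ + AddMonoidHom.id U).range, ?_, ?_⟩
    · apply AddSubgroup.card_le_of_le
      rintro _ ⟨x, rfl⟩
      rw [hF]
      simp [hτ, add_comm]
    · rw [← AddSubgroup.index_ker, AddSubgroup.card_mul_index]
  -- fixed points of `α`
  have hβfix : ∀ v, β v = v → v = 0 := fun v h => by
    have := hβ v
    rwa [h, h, hV, zero_add] at this
  have hβ3 : ∀ v, β (β (β v)) = v := fun v => by
    have h1 := hβ v
    have h2 := hβ (β v)
    rw [add_assoc, add_comm] at h1
    exact add_left_cancel (h2.trans h1.symm)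
  have hαfix : ∀ x, α x = x → x = 0 := fun x h => haniso x (hβfix _ (by rw [← hqα, h]))
  have hαinj : Function.Injective α := by
    rw [injective_iff_map_eq_zero]
    intro x h
    exact haniso x (by rw [← hβ3 (q x), ← hqα, h, hq0, map_zero, map_zero])
  let f : Equiv.Perm U := Equiv.ofBijective α (Finite.injective_iff_bijective.1 hαinj)
  have hf : f ^ 3 ^ k = 1 := by
    ext x
    rw [← Equiv.Perm.iterate_eq_pow]
    exact hk x
  have hα3 : ∀ x, α (α (α x)) = x := by
    classical
    have : Fintype U := Fintype.ofFinite _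
    have : Fintype V := Fintype.ofFinite _
    obtain ⟨z, hz⟩ : ∃ z : V, z ≠ 0 := by
      obtain ⟨v, hv⟩ := hσ
      exact ⟨v, fun h => hv (by rw [h, map_zero])⟩
    have hβne : ∀ {v}, v ≠ 0 → β v ≠ 0 := fun {v} hv h => hv (by rw [← hβ3 v, h, map_zero, map_zero])
    have hzβ : z ≠ β z := fun h => hz (hβfix z h.symm)
    have hβzβ : β z ≠ β (β z) := fun h => hβne hz (hβfix _ h.symm)
    have hzββ : z ≠ β (β z) := fun h => hβne (hβne hz) (hβfix _ (by rw [hβ3, ← h]))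
    have huniv : (Finset.univ : Finset V) = {0, z, β z, β (β z)} := by
      symm
      apply Finset.eq_univ_of_card
      rw [← Nat.card_eq_fintype_card, hcardV,
        Finset.card_insert_of_notMem (by simp [hz.symm, (hβne hz).symm, (hβne (hβne hz)).symm]),
        Finset.card_insert_of_notMem (by simp [hzβ, hzββ]),
        Finset.card_insert_of_notMem (by simp [hβzβ]), Finset.card_singleton]
    -- By anisotropy the fibre over 0 is a point, and α permutes the fibres over the three nonzero
    -- values cyclically.
    have hcount : ∀ s : Finset U, 0 ∈ s → (∀ x ∈ s, α x ∈ s) →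
        s.card = 1 + 3 * (s.filter (fun u => q u = z)).card := by
      intro s hs0 hs
      have hle : ∀ v, (s.filter (fun u => q u = v)).card ≤ (s.filter (fun u => q u = β v)).card :=
        fun v => Finset.card_le_card_of_injOn α (by
          intro x hx
          simp only [Finset.coe_filter, Set.mem_ofPred_eq] at hx ⊢
          exact ⟨hs x hx.1, by rw [hqα, hx.2]⟩) hαinj.injOn
      have h1 := hle z
      have h2 := hle (β z)
      have h3 := hle (β (β z))
      rw [hβ3] at h3
      have h0 : (s.filter (fun u => q u = 0)).card = 1 := by
        rw [Finset.card_eq_one]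
        refine ⟨0, ?_⟩
        ext x
        simp only [Finset.mem_filter, Finset.mem_singleton]
        exact ⟨fun h => haniso x h.2, fun h => by rw [h]; exact ⟨hs0, hq0⟩⟩
      have := Finset.card_eq_sum_card_fiberwise (f := q) (s := s) (t := Finset.univ)
        (fun _ _ => Finset.mem_coe.2 (Finset.mem_univ _))
      rw [huniv, Finset.sum_insert (by simp [hz.symm, (hβne hz).symm, (hβne (hβne hz)).symm]),
        Finset.sum_insert (by simp [hzβ, hzββ]), Finset.sum_insert (by simp [hβzβ]),
        Finset.sum_singleton, h0] at this
      omega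
    let R : AddSubgroup U := (α.comp (α.comp α) - AddMonoidHom.id U).ker
    have hR : ∀ x, x ∈ R ↔ α (α (α x)) = x := fun x => by
      rw [AddMonoidHom.mem_ker]
      simp [sub_eq_zero]
    have hcU := hcount Finset.univ (Finset.mem_univ _) (fun _ _ => Finset.mem_univ _)
    have hcR := hcount (Finset.univ.filter (fun x => x ∈ R)) (by simp [R.zero_mem]) (fun x hx => by
      simp only [Finset.mem_filter, Finset.mem_univ, true_and, hR] at hx ⊢
      rw [hx])
    have hcardR : Nat.card R = (Finset.univ.filter (fun x => x ∈ R)).card := by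
      rw [Nat.card_eq_fintype_card, Fintype.card_subtype]
    rw [Finset.card_univ, ← Nat.card_eq_fintype_card] at hcU
    rw [← hcardR, Finset.filter_filter] at hcR
    have hmod : (Finset.univ.filter (fun u => q u = z)).card ≡
        (Finset.univ.filter (fun u => u ∈ R ∧ q u = z)).card [MOD 3] := by
      have hinv : ∀ x, q ((f ^ 3) x) = z ↔ q x = z := fun x => by
        change q (α (α (α x))) = z ↔ _
        rw [hqα, hqα, hqα, hβ3]
      have h := card_fixed_modEq_three (k := k)
        ((f ^ 3).subtypePerm (p := fun x => q x = z) hinv) (by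
        ext x
        rw [Equiv.Perm.subtypePerm_pow]
        change ((f ^ 3) ^ 3 ^ k) x.1 = x.1
        rw [← pow_mul, mul_comm, pow_mul, hf, one_pow]
        rfl)
      rw [Nat.card_eq_fintype_card, Fintype.card_subtype] at h
      refine h.trans ?_
      rw [← Fintype.card_subtype, ← Nat.card_eq_fintype_card]
      rw [Nat.card_congr (α := {t : {x // q x = z} // ((f ^ 3).subtypePerm hinv) t = t})
        (β := {u // u ∈ R ∧ q u = z}) {
        toFun := fun t => ⟨t.1.1, (hR _).2 (congrArg Subtype.val t.2), t.1.2⟩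
        invFun := fun u => ⟨⟨u.1, u.2.2⟩, Subtype.ext ((hR _).1 u.2.1)⟩
        left_inv := fun _ => rfl
        right_inv := fun _ => rfl }]
    have hdvd := AddSubgroup.card_addSubgroup_dvd_card R
    have hRU : Nat.card R = Nat.card U := by
      obtain ⟨r, hr, hr'⟩ := hUcard
      generalize (Finset.univ.filter (fun u => q u = z)).card = n at *
      generalize (Finset.univ.filter (fun u => u ∈ R ∧ q u = z)).card = m at *
      generalize Nat.card F = c at *
      -- Among the products c * r > 4 with r ≤ c ≤ 4, only 16 is 1 mod 3. Likewise 1 + 3m divides 16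
      -- with m ≡ 5 mod 3 only for m = 5, so the fixed points of α³ fill U.
      have hn : n = 5 := by
        interval_cases c <;> interval_cases r <;> omega
      subst hn
      have hm : m ≤ 5 := by
        have := Nat.le_of_dvd (by omega) hdvd
        omega
      rw [hcU, hcR] at hdvd ⊢
      unfold Nat.ModEq at hmod
      interval_cases m <;> omega
    have htop : R = ⊤ := AddSubgroup.eq_top_of_card_eq R hRU
    exact fun x => (hR x).1 (htop ▸ AddSubgroup.mem_top x)
  obtain ⟨u, v, hu, hv, hu0, hv0, huv⟩ : ∃ u v, u ∈ F ∧ v ∈ F ∧ u ≠ 0 ∧ v ≠ 0 ∧ u ≠ v := by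
    have : Fintype F := Fintype.ofFinite _
    classical
    have h3 : 2 < Nat.card F := by
      obtain ⟨r, hr, hr'⟩ := hUcard
      nlinarith
    have hex : ∀ s : Finset F, s.card ≤ 2 → ∃ x, x ∉ s := by
      intro s hs
      by_contra! h
      have := Finset.card_le_card (Finset.subset_iff.2 fun x _ => h x : Finset.univ ⊆ s)
      rw [Finset.card_univ, ← Nat.card_eq_fintype_card] at this
      omega
    obtain ⟨x, hx⟩ := hex {0} (by simp)
    obtain ⟨y, hy⟩ := hex {0, x} (Finset.card_le_two)
    simp only [Finset.mem_singleton, Finset.mem_insert, not_or, Subtype.ext_iff] at hx hy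
    exact ⟨x, y, x.2, y.2, hx, hy.1, Ne.symm hy.2⟩
  have hαα : ∀ x, α (α x) = x + α x := fun x => by
    have h : α (x + α x + α (α x)) = x + α x + α (α x) := by
      rw [map_add, map_add, hα3]; abel
    exact (hnegU _ _ (hαfix _ h)).symm
  have hββ : ∀ x, β (β x) = x + β x := fun x => (hnegV _ _ (hβ x)).symm
  have hbα : ∀ x y, b (α x) (α y) = β (b x y) := fun x y => by
    have h := hq (α x) (α y)
    rw [← map_add, hqα, hq, map_add, map_add, hqα, hqα] at h
    exact (add_left_cancel h).symm
  have hbxα : ∀ x, b x (α x) = 0 := fun x => by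
    have h := hq x (α x)
    rw [← hαα, hqα, hqα, hββ] at h
    exact left_eq_add.1 h
  have hbswap : b u (α v) = b v (α u) := by
    have h := hbxα (u + v)
    rw [map_add, hb_left, hb_right, hb_right, hbxα, hbxα, zero_add, add_zero] at h
    exact hnegV _ _ h
  have hbuv : b u (α v) = β (β (b u v)) := by
    have h1 : b (α (α u)) (α v) = β (b (α u) v) := hbα _ _
    rw [hαα, hb_left, hbα, hbsymm (α u) v, ← hbswap] at h1
    have h2 : β (b u (α v) + β (b u v)) = β (β (b u (α v))) := by rw [h1]
    rw [map_add, hββ (b u (α v)), add_comm] at h2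
    exact (add_right_cancel h2).symm
  have hz := hbF u hu v hv hu0 hv0 huv
  -- With z = b u v = q u = q v, the three terms are z, βz and β²z, whose sum vanishes.
  have hfin : q (u + α v) = 0 := by
    rw [hq, hqα, ← hqeq u hu v hv hu0 hv0, hbuv, hz, hβ]
  have huαv := hnegU _ _ (haniso _ hfin)
  have hbz : b u v = 0 := by rw [huαv, hbsymm, hbxα]
  exact hqne u hu0 (hz ▸ hbz)

/-! ### Commutator identities and central layers of a 2-group -/

theorem comm_mul_left {X : Type*} [Group X] {g h u : X}
    (hc : ∀ x, u⁻¹ * h * u * h⁻¹ * x = x * (u⁻¹ * h * u * h⁻¹)) :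
    u⁻¹ * (g * h) * u * (g * h)⁻¹ = (u⁻¹ * g * u * g⁻¹) * (u⁻¹ * h * u * h⁻¹) := by
  calc u⁻¹ * (g * h) * u * (g * h)⁻¹ = u⁻¹ * g * u * ((u⁻¹ * h * u * h⁻¹) * g⁻¹) := by group
    _ = _ := by rw [hc g⁻¹]; group

theorem comm_mul_right {X : Type*} [Group X] {g u w : X}
    (hc : ∀ x, u⁻¹ * g * u * g⁻¹ * x = x * (u⁻¹ * g * u * g⁻¹)) :
    (u * w)⁻¹ * g * (u * w) * g⁻¹ = (u⁻¹ * g * u * g⁻¹) * (w⁻¹ * g * w * g⁻¹) := by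
  calc (u * w)⁻¹ * g * (u * w) * g⁻¹ = w⁻¹ * (u⁻¹ * g * u * g⁻¹) * (g * w * g⁻¹) := by group
    _ = _ := by rw [← hc w⁻¹]; group

/-- The central elements of order dividing `2`. -/
def centralInvolutions (X : Type*) [Group X] : Subgroup X where
  carrier := {x | x * x = 1 ∧ ∀ g, x * g = g * x}
  one_mem' := by simp
  mul_mem' := by
    rintro a b ⟨ha, ha'⟩ ⟨hb, hb'⟩
    refine ⟨?_, fun g => ?_⟩
    · rw [mul_assoc, ← mul_assoc b a b, ← ha' b, mul_assoc, hb, mul_one, ha]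
    · rw [mul_assoc, hb', ← mul_assoc, ha', mul_assoc]
  inv_mem' := by
    rintro a ⟨ha, ha'⟩
    rw [inv_eq_of_mul_eq_one_left ha]
    exact ⟨ha, ha'⟩

theorem mem_centralInvolutions {X : Type*} [Group X] {x : X} :
    x ∈ centralInvolutions X ↔ x * x = 1 ∧ ∀ g, x * g = g * x := Iff.rfl

instance (X : Type*) [Group X] : (centralInvolutions X).Normal where
  conj_mem x hx g := by
    rw [← hx.2, mul_assoc, mul_inv_cancel, mul_one]
    exact hx

/-- The conjugation action on N fixes 1, so it has another fixed point by counting mod 2, and a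
suitable power of that point is an involution. -/
theorem centralInvolutions_inf_ne_bot {X : Type*} [Group X] [Finite X] (hX : IsPGroup 2 X)
    (N : Subgroup X) [hN : N.Normal] (hbot : N ≠ ⊥) :
    ∃ x ∈ N, x ∈ centralInvolutions X ∧ x ≠ 1 := by
  have : Fact (Nat.Prime 2) := ⟨Nat.prime_two⟩
  have hc : ∃ x ∈ N, x ≠ 1 ∧ ∀ g, x * g = g * x := by
    let _ : MulAction X N := {
      smul := fun g x => ⟨g * x * g⁻¹, hN.conj_mem _ x.2 g⟩
      one_smul := fun x => Subtype.ext (by change 1 * x.1 * 1⁻¹ = x; simp)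
      mul_smul := fun g h x => Subtype.ext (by
        change (g * h) * x.1 * (g * h)⁻¹ = g * (h * x.1 * h⁻¹) * g⁻¹; group) }
    have hsmul : ∀ (g : X) (x : N), ((g • x : N) : X) = g * x * g⁻¹ := fun _ _ => rfl
    have hdvd : 2 ∣ Nat.card N := by
      rcases (hX.to_subgroup N).card_eq_or_dvd with h | h
      · exact absurd (Subgroup.card_eq_one.1 h) hbot
      · exact h
    obtain ⟨x, hx, hne⟩ := hX.exists_fixed_point_of_prime_dvd_card_of_fixed_point N hdvd
      (a := 1) (fun g => Subtype.ext (by rw [hsmul]; simp))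
    refine ⟨x, x.2, fun h => hne (Subtype.ext h.symm), fun g => ?_⟩
    have := congrArg Subtype.val (hx g)
    rw [hsmul] at this
    exact (mul_inv_eq_iff_eq_mul.1 this).symm
  obtain ⟨x, hxN, hx1, hxc⟩ := hc
  obtain ⟨n, hn⟩ := IsPGroup.iff_orderOf.1 hX x
  have hn0 : n ≠ 0 := fun h => hx1 (orderOf_eq_one_iff.1 (by rw [hn, h, pow_zero]))
  obtain ⟨m, rfl⟩ := Nat.exists_eq_succ_of_ne_zero hn0
  refine ⟨x ^ 2 ^ m, pow_mem hxN _, ⟨?_, fun g => ?_⟩, fun h => ?_⟩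
  · rw [← pow_add, ← two_mul, ← pow_succ', ← hn, pow_orderOf_eq_one]
  · exact ((show Commute x g from hxc g).pow_left _)
  · have := orderOf_dvd_of_pow_eq_one h
    rw [hn, Nat.pow_dvd_pow_iff_le_right (by norm_num)] at this
    omega

/-- The preimage of the central elements of order dividing `2` of a quotient. -/
def omegaOver {X : Type*} [Group X] (N : Subgroup X) [N.Normal] : Subgroup X :=
  (centralInvolutions (X ⧸ N)).comap (QuotientGroup.mk' N)

instance {X : Type*} [Group X] (N : Subgroup X) [N.Normal] : (omegaOver N).Normal :=
  Subgroup.Normal.comap inferInstance _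

theorem mem_omegaOver {X : Type*} [Group X] {N : Subgroup X} [N.Normal] {x : X} :
    x ∈ omegaOver N ↔ x * x ∈ N ∧ ∀ g, x⁻¹ * g * x * g⁻¹ ∈ N := by
  rw [omegaOver, Subgroup.mem_comap, mem_centralInvolutions, QuotientGroup.mk'_apply,
    ← QuotientGroup.mk_mul, QuotientGroup.eq_one_iff]
  refine and_congr Iff.rfl ⟨fun h g => ?_, fun h g => ?_⟩
  · have := h (QuotientGroup.mk g)
    rw [← QuotientGroup.eq_one_iff]
    simp only [QuotientGroup.mk_mul, QuotientGroup.mk_inv]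
    rw [mul_assoc _ _ (x : X ⧸ N), ← this]
    group
  · induction g using QuotientGroup.induction_on with
    | H g =>
      have := (QuotientGroup.eq_one_iff _).2 (h g)
      simp only [QuotientGroup.mk_mul, QuotientGroup.mk_inv] at this
      rw [mul_inv_eq_one, mul_assoc, inv_mul_eq_iff_eq_mul] at this
      exact this.symm

theorem le_omegaOver {X : Type*} [Group X] (N : Subgroup X) [hN : N.Normal] : N ≤ omegaOver N := by
  intro x hx
  refine mem_omegaOver.2 ⟨mul_mem hx hx, fun g => ?_⟩
  rw [mul_assoc, mul_assoc, ← mul_assoc g]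
  exact mul_mem (inv_mem hx) (hN.conj_mem _ hx g)

theorem map_mem_omegaOver {X : Type*} [Group X] {N : Subgroup X} [N.Normal] {f : X →* X}
    (hf : Function.Surjective f) (hN : ∀ x ∈ N, f x ∈ N) {x : X} (hx : x ∈ omegaOver N) :
    f x ∈ omegaOver N := by
  rw [mem_omegaOver] at hx ⊢
  refine ⟨by rw [← map_mul]; exact hN _ hx.1, fun g => ?_⟩
  obtain ⟨g, rfl⟩ := hf g
  simpa using hN _ (hx.2 g)

theorem exists_mem_omegaOver {X : Type*} [Group X] [Finite X] (hX : IsPGroup 2 X)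
    (N M : Subgroup X) [N.Normal] [M.Normal] (hM : ¬ M ≤ N) : ∃ x ∈ M, x ∈ omegaOver N ∧ x ∉ N := by
  have : (M.map (QuotientGroup.mk' N)).Normal :=
    Subgroup.Normal.map inferInstance _ (QuotientGroup.mk'_surjective N)
  obtain ⟨_, ⟨x, hx, rfl⟩, hx', hx1⟩ := centralInvolutions_inf_ne_bot (hX.to_quotient N)
    (M.map (QuotientGroup.mk' N)) (fun h => hM (by
      rw [Subgroup.map_eq_bot_iff, QuotientGroup.ker_mk'] at h
      exact h))
  exact ⟨x, hx, hx', fun h => hx1 ((QuotientGroup.eq_one_iff _).2 h)⟩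

/-- Squaring induces a quadratic map from X/V to V whose polarization is the commutator. It is
anisotropic because V contains every involution. The map τ has to be an involution only modulo V. -/
theorem card_le_sixteen {X : Type*} [Group X] [Finite X] (α τ : X →* X)
    (hcentral : ∀ v : X, v * v = 1 → ∀ g, v * g = g * v)
    (hcard : Nat.card {v : X // v * v = 1} = 4)
    (hexp : ∀ x : X, x * x * (x * x) = 1)
    (htrace : ∀ v : X, v * v = 1 → v * α v * α (α v) = 1)
    {k : ℕ} (hk : ∀ x, α^[3 ^ k] x = x)
    (hττ : ∀ x, x⁻¹ * τ (τ x) * (x⁻¹ * τ (τ x)) = 1)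
    (hmove : ∃ v, v * v = 1 ∧ τ v ≠ v) : Nat.card X ≤ 16 := by
  let V := centralInvolutions X
  have hVmem : ∀ x : X, x ∈ V ↔ x * x = 1 := fun x => ⟨fun h => h.1, fun h => ⟨h, hcentral x h⟩⟩
  have hVcard : Nat.card V = 4 := by
    rw [← hcard]
    exact Nat.card_congr (Equiv.subtypeEquivRight hVmem)
  have hsqV : ∀ x : X, x * x ∈ V := fun x => (hVmem _).2 (hexp x)
  have hsq : ∀ u : X ⧸ V, u * u = 1 := fun u => by
    induction u using QuotientGroup.induction_on with
    | H x => exact (QuotientGroup.eq_one_iff _).2 (hsqV x)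
  let _ : CommGroup (X ⧸ V) := { (inferInstance : Group (X ⧸ V)) with
    mul_comm := fun a b => by
      have h1 := hsq (a * b)
      have ha := hsq a
      have hb := hsq b
      rw [mul_eq_one_iff_eq_inv, mul_inv_rev, ← eq_inv_of_mul_eq_one_left ha,
        ← eq_inv_of_mul_eq_one_left hb] at h1
      exact h1 }
  let _ : CommGroup V := { (inferInstance : Group V) with
    mul_comm := fun a b => Subtype.ext (a.2.2 b.1) }
  have hmap : ∀ f : X →* X, V ≤ V.comap f := fun f x hx => by
    rw [Subgroup.mem_comap, hVmem, ← map_mul, (hVmem x).1 hx, map_one]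
  let q : X ⧸ V → V := Quotient.lift (fun x => ⟨x * x, hsqV x⟩) (by
    intro x y h
    have h' : x⁻¹ * y ∈ V := QuotientGroup.leftRel_apply.1 h
    obtain ⟨v, hv, rfl⟩ : ∃ v ∈ V, y = x * v := ⟨_, h', by group⟩
    refine Subtype.ext ?_
    change x * x = x * v * (x * v)
    rw [mul_assoc x v, ← mul_assoc v, hv.2 x, mul_assoc x v v, hv.1, mul_one])
  have hqmk : ∀ x : X, ((q (QuotientGroup.mk x) : V) : X) = x * x := fun _ => rfl
  have hcomm : ∀ x y : X, x⁻¹ * y * x * y⁻¹ ∈ V := fun x y => by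
    rw [← QuotientGroup.eq_one_iff]
    simp only [QuotientGroup.mk_mul, QuotientGroup.mk_inv]
    rw [mul_comm (x : X ⧸ V)⁻¹, inv_mul_cancel_right, mul_inv_cancel]
  have hbmk : ∀ x y : X, (q (QuotientGroup.mk x * QuotientGroup.mk y) *
      (q (QuotientGroup.mk x) * q (QuotientGroup.mk y))⁻¹ : V) = ⟨_, hcomm x y⟩ := fun x y => by
    rw [mul_inv_eq_iff_eq_mul]
    refine Subtype.ext ?_
    rw [← QuotientGroup.mk_mul]
    simp only [Subgroup.coe_mul, hqmk]
    have h := (hcomm x y).2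
    calc x * y * (x * y) = x * (x * (x⁻¹ * y * x * y⁻¹)) * (y * y) := by group
      _ = _ := by rw [← h x, ← mul_assoc x, ← h x]; simp only [mul_assoc]
  let B : X ⧸ V → X ⧸ V → V := fun u w => q (u * w) * (q u * q w)⁻¹
  have hqB : ∀ x y, q (x * y) = q x * q y * B x y := fun x y =>
    (mul_inv_cancel_comm_assoc (q x * q y) (q (x * y))).symm
  have hB_left : ∀ x y w, B (x * y) w = B x w * B y w := fun x y w => by
    induction x using QuotientGroup.induction_on with
    | H x =>
    induction y using QuotientGroup.induction_on with
    | H y =>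
    induction w using QuotientGroup.induction_on with
    | H w =>
    simp only [B]
    rw [hbmk, hbmk, ← QuotientGroup.mk_mul, hbmk]
    exact Subtype.ext (comm_mul_right (hcomm x w).2)
  have hB_right : ∀ x y w, B x (y * w) = B x y * B x w := fun x y w => by
    induction x using QuotientGroup.induction_on with
    | H x =>
    induction y using QuotientGroup.induction_on with
    | H y =>
    induction w using QuotientGroup.induction_on with
    | H w =>
    simp only [B]
    rw [hbmk, hbmk, ← QuotientGroup.mk_mul, hbmk]
    exact Subtype.ext (comm_mul_left (hcomm x w).2)
  have haniso : ∀ x, q x = 1 → x = 1 := fun x h => by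
    induction x using QuotientGroup.induction_on with
    | H x => exact (QuotientGroup.eq_one_iff _).2 ((hVmem x).2 (congrArg Subtype.val h))
  have hqmap : ∀ (f : X →* X) (x : X ⧸ V), q (QuotientGroup.map V V f (hmap f) x) =
      (f.comp V.subtype).codRestrict V (fun x => hmap f x.2) (q x) := fun f x => by
    induction x using QuotientGroup.induction_on with
    | H x => exact Subtype.ext (map_mul f x x).symm
  have hiter : ∀ (n : ℕ) (x : X), (QuotientGroup.map V V α (hmap α))^[n] (QuotientGroup.mk x) =
      QuotientGroup.mk (α^[n] x) := fun n => by
    induction n with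
    | zero => exact fun x => rfl
    | succ n ih => exact fun x => by rw [Function.iterate_succ_apply, Function.iterate_succ_apply,
        QuotientGroup.map_mk, ih]
  have hperiod : ∀ x, (QuotientGroup.map V V α (hmap α))^[3 ^ k] x = x := fun x => by
    induction x using QuotientGroup.induction_on with
    | H x => rw [hiter, hk]
  have hτ2 : ∀ x, QuotientGroup.map V V τ (hmap τ) (QuotientGroup.map V V τ (hmap τ) x) = x :=
    fun x => by
    induction x using QuotientGroup.induction_on with
    | H x =>
      rw [QuotientGroup.map_mk, QuotientGroup.map_mk, eq_comm, QuotientGroup.eq, hVmem]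
      exact hττ x
  have key := card_le_four_of_anisotropic (U := Additive (X ⧸ V)) (V := Additive V)
    (fun u => Additive.ofMul (q u.toMul)) (fun u w => Additive.ofMul (B u.toMul w.toMul))
    (fun x y => hqB x.toMul y.toMul)
    (fun x y w => hB_left x.toMul y.toMul w.toMul) (fun x y w => hB_right x.toMul y.toMul w.toMul)
    (fun u => hsq u.toMul) (fun v => Subtype.ext (v.toMul.2.1))
    (fun x h => haniso x.toMul h) hVcard
    (MonoidHom.toAdditive (QuotientGroup.map V V α (hmap α)))
    (MonoidHom.toAdditive ((α.comp V.subtype).codRestrict V (fun x => hmap α x.2)))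
    (fun x => hqmap α x.toMul)
    (fun v => Subtype.ext (htrace _ v.toMul.2.1)) (k := k) (fun x => hperiod x.toMul)
    (MonoidHom.toAdditive (QuotientGroup.map V V τ (hmap τ)))
    (MonoidHom.toAdditive ((τ.comp V.subtype).codRestrict V (fun x => hmap τ x.2)))
    (fun x => hqmap τ x.toMul) (fun x => hτ2 x.toMul)
    (by
      obtain ⟨v, hv, hne⟩ := hmove
      exact ⟨Additive.ofMul ⟨v, (hVmem v).2 hv⟩, fun h => hne (congrArg Subtype.val h)⟩)
  have h := V.card_mul_index
  rw [hVcard] at h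
  have key' : V.index ≤ 4 := key
  omega

/-! ### The first layer above the involutions -/

/-- A `2`-group whose involutions are three central ones, permuted transitively by an automorphism
`α` of `3`-power order and nontrivially by an automorphism `τ` whose square is inner. -/
structure InvolutionAction {X : Type*} [Group X] (α τ : X →* X) : Prop where
  isPGroup : IsPGroup 2 X
  central : ∀ v : X, v * v = 1 → ∀ g, v * g = g * v
  card : Nat.card {v : X // v * v = 1} = 4
  trace : ∀ v : X, v * v = 1 → v * α v * α (α v) = 1
  iterate : ∃ k, ∀ x, α^[3 ^ k] x = x
  moves : ∃ v, v * v = 1 ∧ τ v ≠ v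
  inner : ∃ g, ∀ x, τ (τ x) = g * x * g⁻¹

namespace InvolutionAction

variable {X : Type*} [Group X] {α τ : X →* X} (d : InvolutionAction α τ)

include d

theorem mem_iff (x : X) : x ∈ centralInvolutions X ↔ x * x = 1 :=
  ⟨fun h => h.1, fun h => ⟨h, d.central x h⟩⟩

theorem card_centralInvolutions : Nat.card (centralInvolutions X) = 4 := by
  rw [← d.card]
  exact Nat.card_congr (Equiv.subtypeEquivRight d.mem_iff)

theorem injective : Function.Injective α := by
  obtain ⟨k, hk⟩ := d.iterate
  intro x y h
  have h3 : 3 ^ k = (3 ^ k - 1) + 1 := (Nat.succ_pred_eq_of_pos (by positivity)).symm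
  rw [← hk x, ← hk y, h3, Function.iterate_succ_apply, Function.iterate_succ_apply, h]

theorem surjective [Finite X] : Function.Surjective α := Finite.injective_iff_surjective.1 d.injective

theorem surjective_right : Function.Surjective τ := by
  obtain ⟨g, hg⟩ := d.inner
  exact fun x => ⟨τ (g⁻¹ * x * g), by rw [hg]; group⟩

theorem map_mem (f : X →* X) {x : X} (hx : x ∈ centralInvolutions X) :
    f x ∈ centralInvolutions X := by
  rw [d.mem_iff] at hx ⊢
  rw [← map_mul, hx, map_one]

theorem map3 {v : X} (hv : v ∈ centralInvolutions X) : α (α (α v)) = v := by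
  have h1 := d.trace v hv.1
  have h2 := d.trace (α v) (d.map_mem α hv).1
  rw [mul_assoc, hv.2] at h1
  exact mul_left_cancel (h2.trans h1.symm)

/-- A nontrivial fixed point has a power that is a fixed involution v, and then the trace relation
reads v³ = 1. -/
theorem eq_one_of_fixed [Finite X] {x : X} (hx : α x = x) : x = 1 := by
  have : Fact (Nat.Prime 2) := ⟨Nat.prime_two⟩
  by_contra hx1
  obtain ⟨n, hn⟩ := IsPGroup.iff_orderOf.1 d.isPGroup x
  have hn0 : n ≠ 0 := fun h => hx1 (orderOf_eq_one_iff.1 (by rw [hn, h, pow_zero]))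
  obtain ⟨m, rfl⟩ := Nat.exists_eq_succ_of_ne_zero hn0
  have hv : x ^ 2 ^ m * x ^ 2 ^ m = 1 := by
    rw [← pow_add, ← two_mul, ← pow_succ', ← hn, pow_orderOf_eq_one]
  have ht := d.trace _ hv
  rw [map_pow, map_pow, hx, hx, hv, one_mul] at ht
  have := orderOf_dvd_of_pow_eq_one ht
  rw [hn, Nat.pow_dvd_pow_iff_le_right (by norm_num)] at this
  omega

theorem cases {v w : X} (hv : v ∈ centralInvolutions X) (hw : w ∈ centralInvolutions X)
    (hw1 : w ≠ 1) : v = 1 ∨ v = w ∨ v = α w ∨ v = α (α w) := by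
  by_contra! h
  obtain ⟨h1, h2, h3, h4⟩ := h
  have h0 : ∀ {u}, u ∈ centralInvolutions X → u ≠ 1 → α u ≠ 1 ∧ u ≠ α u := by
    intro u hu hu1
    refine ⟨fun h => hu1 (d.injective (by rw [h, map_one])), fun h => hu1 ?_⟩
    have := d.trace u hu.1
    rwa [← h, ← h, hu.1, one_mul] at this
  have hw2 := h0 hw hw1
  have hw3 := h0 (d.map_mem α hw) hw2.1
  have hw4 := h0 (d.map_mem α (d.map_mem α hw)) hw3.1
  rw [d.map3 hw] at hw4
  classical
  have : Finite (centralInvolutions X) := Nat.finite_of_card_ne_zero (by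
    rw [d.card_centralInvolutions]; norm_num)
  have : Fintype (centralInvolutions X) := Fintype.ofFinite _
  have hc := Finset.card_le_univ ({1, ⟨w, hw⟩, ⟨α w, d.map_mem α hw⟩,
    ⟨α (α w), d.map_mem α (d.map_mem α hw)⟩, ⟨v, hv⟩} : Finset (centralInvolutions X))
  rw [← Nat.card_eq_fintype_card, d.card_centralInvolutions,
    Finset.card_insert_of_notMem (by
      simp [Subtype.ext_iff, hw1.symm, hw2.1.symm, hw3.1.symm, h1.symm]),
    Finset.card_insert_of_notMem (by simp [Subtype.ext_iff, hw2.2, hw4.2.symm, h2.symm]),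
    Finset.card_insert_of_notMem (by simp [Subtype.ext_iff, hw3.2, h3.symm]),
    Finset.card_insert_of_notMem (by simp [Subtype.ext_iff, h4.symm]),
    Finset.card_singleton] at hc
  omega

theorem map_mem_omega [Finite X] {x : X} (hx : x ∈ omegaOver (centralInvolutions X)) :
    α x ∈ omegaOver (centralInvolutions X) :=
  map_mem_omegaOver d.surjective (fun _ => d.map_mem α) hx

/-- `card_le_sixteen` applies inside this subgroup A: elements of A have squares in V, and the inner
automorphism τ² moves them only by elements of V. So V has index at most 4 in A, and α rules out a
nonabelian A. -/
theorem omega_comm [Finite X] {x y : X} (hx : x ∈ omegaOver (centralInvolutions X))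
    (hy : y ∈ omegaOver (centralInvolutions X)) : x * y = y * x := by
  set V := centralInvolutions X
  set A := omegaOver V
  have hVA : V ≤ A := le_omegaOver V
  let f (β : X →* X) (hβ : ∀ x ∈ A, β x ∈ A) : A →* A :=
    (β.comp A.subtype).codRestrict A (fun x => hβ x x.2)
  have hα : ∀ x ∈ A, α x ∈ A := fun x => d.map_mem_omega
  have hτ : ∀ x ∈ A, τ x ∈ A := fun x hx =>
    map_mem_omegaOver d.surjective_right (fun _ => d.map_mem τ) hx
  obtain ⟨k, hk⟩ := d.iterate
  have hVcard : Nat.card (V.subgroupOf A) = 4 := by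
    rw [Nat.card_congr (Subgroup.subgroupOfEquivOfLe hVA).toEquiv, d.card_centralInvolutions]
  have hcard : Nat.card A ≤ 16 := by
    refine card_le_sixteen (f α hα) (f τ hτ) (fun v hv g => ?_) ?_ (fun x => ?_) (fun v hv => ?_)
      (k := k) (fun x => ?_) (fun x => ?_) ?_
    · exact Subtype.ext (d.central v (congrArg Subtype.val hv) g)
    · rw [← hVcard]
      refine Nat.card_congr (Equiv.subtypeEquivRight fun x => ?_)
      rw [Subgroup.mem_subgroupOf, d.mem_iff, Subtype.ext_iff]
      rfl
    · exact Subtype.ext (mem_omegaOver.1 x.2).1.1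
    · exact Subtype.ext (d.trace v (congrArg Subtype.val hv))
    · have : ∀ n, (((f α hα)^[n] x : A) : X) = α^[n] x := fun n => by
        induction n with
        | zero => rfl
        | succ n ih =>
          rw [Function.iterate_succ_apply', Function.iterate_succ_apply', ← ih]
          rfl
      exact Subtype.ext (by rw [this, hk])
    · obtain ⟨g, hg⟩ := d.inner
      refine Subtype.ext ?_
      have : x.1⁻¹ * τ (τ x.1) ∈ V := by
        have h := (mem_omegaOver.1 x.2).2 g
        rw [hg]
        simpa only [mul_assoc] using h
      exact this.1
    · obtain ⟨v, hv, hne⟩ := d.moves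
      exact ⟨⟨v, hVA ((d.mem_iff v).2 hv)⟩, Subtype.ext hv, fun h => hne (congrArg Subtype.val h)⟩
  have := mul_comm_of_card_le_four_mul (f α hα)
    (fun x y h => Subtype.ext (d.injective (congrArg Subtype.val h)))
    (fun x h => Subtype.ext (d.eq_one_of_fixed (congrArg Subtype.val h)))
    (V.subgroupOf A) (fun z hz x => Subtype.ext ((Subgroup.mem_subgroupOf.1 hz).2 x))
    (by rw [hVcard]; exact hcard) ⟨x, hx⟩ ⟨y, hy⟩
  exact congrArg Subtype.val this

theorem mul_self_mul [Finite X] {x y : X} (hx : x ∈ omegaOver (centralInvolutions X))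
    (hy : y ∈ omegaOver (centralInvolutions X)) : x * y * (x * y) = x * x * (y * y) := by
  rw [mul_assoc, ← mul_assoc y, ← d.omega_comm hx hy]
  simp only [mul_assoc]

theorem inv_mul_mem [Finite X] {x y : X} (hx : x ∈ omegaOver (centralInvolutions X))
    (hy : y ∈ omegaOver (centralInvolutions X)) (h : x * x = y * y) :
    x⁻¹ * y ∈ centralInvolutions X := by
  rw [d.mem_iff, d.mul_self_mul (inv_mem hx) hy, ← h, ← mul_inv_rev, inv_mul_cancel]

theorem trace_mem [Finite X] {x : X} (hx : x ∈ omegaOver (centralInvolutions X)) :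
    x * α x * α (α x) ∈ centralInvolutions X := by
  have h1 := d.map_mem_omega hx
  have h2 := d.map_mem_omega h1
  rw [d.mem_iff, d.mul_self_mul (mul_mem hx h1) h2, d.mul_self_mul hx h1, ← map_mul, ← map_mul,
    ← map_mul]
  exact d.trace _ (mem_omegaOver.1 hx).1.1

theorem omega_cases [Finite X] {u a : X} (hu : u ∈ omegaOver (centralInvolutions X))
    (hu' : u ∉ centralInvolutions X) (ha : a ∈ omegaOver (centralInvolutions X)) :
    ∃ v ∈ centralInvolutions X, a = v ∨ a = u * v ∨ a = α u * v ∨ a = α (α u) * v := by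
  have h1 := d.map_mem_omega hu
  have h2 := d.map_mem_omega h1
  rcases d.cases (mem_omegaOver.1 ha).1 (mem_omegaOver.1 hu).1 (fun h => hu' ((d.mem_iff _).2 h))
    with h | h | h | h
  · exact ⟨a, (d.mem_iff _).2 h, Or.inl rfl⟩
  · exact ⟨u⁻¹ * a, d.inv_mul_mem hu ha h.symm, Or.inr (Or.inl (by group))⟩
  · rw [map_mul] at h
    exact ⟨(α u)⁻¹ * a, d.inv_mul_mem h1 ha h.symm, Or.inr (Or.inr (Or.inl (by group)))⟩
  · rw [map_mul, map_mul] at h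
    exact ⟨(α (α u))⁻¹ * a, d.inv_mul_mem h2 ha h.symm, Or.inr (Or.inr (Or.inr (by group)))⟩

theorem exists_mul_self [Finite X] (hne : centralInvolutions X ≠ ⊤) {v : X}
    (hv : v ∈ centralInvolutions X) :
    ∃ u ∈ omegaOver (centralInvolutions X), u * u = v := by
  obtain ⟨u, -, hu, hu'⟩ := exists_mem_omegaOver d.isPGroup (centralInvolutions X) ⊤
    (fun h => hne (top_le_iff.1 h))
  have h1 := d.map_mem_omega hu
  have h2 := d.map_mem_omega h1
  rcases d.cases hv (mem_omegaOver.1 hu).1 (fun h => hu' ((d.mem_iff _).2 h))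
    with h | h | h | h
  · exact ⟨1, one_mem _, by rw [h, mul_one]⟩
  · exact ⟨u, hu, h.symm⟩
  · exact ⟨α u, h1, by rw [h, map_mul]⟩
  · exact ⟨α (α u), h2, by rw [h, map_mul, map_mul]⟩

/-- On the abelian group A = `omegaOver V`, squaring is a homomorphism with kernel V. Its image is V
because α permutes the involutions transitively, so A/V and V have the same order. -/
theorem card_quotient [Finite X] (hne : centralInvolutions X ≠ ⊤) :
    Nat.card (centralInvolutions (X ⧸ centralInvolutions X)) = 4 := by
  set V := centralInvolutions X
  set A := omegaOver V
  let f : A →* X ⧸ V := (QuotientGroup.mk' V).comp A.subtype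
  let s : A →* X := MonoidHom.mk' (fun x => x.1 * x.1) (fun x y => d.mul_self_mul x.2 y.2)
  have hker : f.ker = s.ker := by
    ext x
    rw [MonoidHom.mem_ker, MonoidHom.mem_ker]
    exact (QuotientGroup.eq_one_iff _).trans (d.mem_iff _)
  have hf : f.range = centralInvolutions (X ⧸ V) := by
    rw [MonoidHom.range_comp, Subgroup.range_subtype]
    exact Subgroup.map_comap_eq_self_of_surjective (QuotientGroup.mk'_surjective V) _
  have hs : s.range = V := by
    ext v
    constructor
    · rintro ⟨x, rfl⟩
      exact (mem_omegaOver.1 x.2).1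
    · intro hv
      obtain ⟨u, hu, rfl⟩ := d.exists_mul_self hne hv
      exact ⟨⟨u, hu⟩, rfl⟩
  rw [← hf, ← Subgroup.index_ker, hker, Subgroup.index_ker, hs]
  exact d.card_centralInvolutions

/-- Some u in A has the same square as y. As y commutes with u, u⁻¹y is an involution or 1, hence
lies in V. -/
theorem mem_omega_of_commute [Finite X] (hne : centralInvolutions X ≠ ⊤) {y : X}
    (hy : ∀ a ∈ omegaOver (centralInvolutions X), y * a = a * y)
    (hyy : y * y ∈ centralInvolutions X) : y ∈ omegaOver (centralInvolutions X) := by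
  obtain ⟨u, hu, huy⟩ := d.exists_mul_self hne hyy
  have h : u⁻¹ * y ∈ centralInvolutions X := by
    rw [d.mem_iff]
    calc u⁻¹ * y * (u⁻¹ * y) = u⁻¹ * (y * u⁻¹) * y := by group
      _ = u⁻¹ * (u⁻¹ * y) * y := by rw [hy _ (inv_mem hu)]
      _ = (u * u)⁻¹ * (y * y) := by group
      _ = 1 := by rw [huy]; group
  have := mul_mem hu (le_omegaOver _ h)
  rwa [mul_inv_cancel_left] at this

end InvolutionAction

/-! ### Centrality of the layer above the involutions -/

namespace InvolutionAction

variable {X : Type*} [Group X] {α τ : X →* X} (d : InvolutionAction α τ)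

include d

/-- `pairing_map_eq` for the commutator pairing X × A → V. The norm u · αu · α²u lies in V, hence in
the kernel of the pairing. -/
theorem comm_map_eq [Finite X] (g : X) {u : X} (hu : u ∈ omegaOver (centralInvolutions X)) :
    (α u)⁻¹ * g * α u * g⁻¹ = α (α (u⁻¹ * g * u * g⁻¹)) := by
  set V := centralInvolutions X
  set A := omegaOver V
  have hA : ∀ (g : X) (u : A), u.1⁻¹ * g * u.1 * g⁻¹ ∈ V := fun g u => (mem_omegaOver.1 u.2).2 g
  refine pairing_map_eq α ((α.comp A.subtype).codRestrict A (fun x => d.map_mem_omega x.2)) α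
    (fun g (u : A) => u.1⁻¹ * g * u.1 * g⁻¹) (fun x => d.eq_one_of_fixed)
    (fun x y w => comm_mul_left (hA y w).2) (fun x v w => comm_mul_right (hA x v).2)
    (fun x w => (hA x w).2) (fun x w => ?_) (fun x w => ?_) (fun x w => d.trace _ (hA x w).1)
    (fun x w => (hA x w).1) g ⟨u, hu⟩
  · simp
  · have h := (d.trace_mem w.2).2
    change (w.1 * α w.1 * α (α w.1))⁻¹ * x * (w.1 * α w.1 * α (α w.1)) * x⁻¹ = 1
    rw [mul_assoc _ x, ← h x]
    group

/-- If x commutes with some u in A outside V, it also commutes with αu and α²u by `comm_map_eq`.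
Modulo V these are all nontrivial elements of A, so x would centralize A. -/
theorem mem_of_comm_eq_one [Finite X] {x : X}
    (hx : x ∉ Subgroup.centralizer (omegaOver (centralInvolutions X) : Set X)) {u : X}
    (hu : u ∈ omegaOver (centralInvolutions X)) (h : u⁻¹ * x * u * x⁻¹ = 1) :
    u ∈ centralInvolutions X := by
  by_contra hu'
  have hcomm : ∀ {w}, w⁻¹ * x * w * x⁻¹ = 1 → w * x = x * w := fun {w} h => by
    rw [mul_inv_eq_one, mul_assoc, inv_mul_eq_iff_eq_mul] at h
    exact h.symm
  have h1 : (α u)⁻¹ * x * α u * x⁻¹ = 1 := by rw [d.comm_map_eq x hu, h, map_one, map_one]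
  have h2 : (α (α u))⁻¹ * x * α (α u) * x⁻¹ = 1 := by
    rw [d.comm_map_eq x (d.map_mem_omega hu), h1, map_one, map_one]
  apply hx
  rw [Subgroup.mem_centralizer_iff]
  intro a ha
  have hmul : ∀ {w v}, w * x = x * w → v ∈ centralInvolutions X → w * v * x = x * (w * v) :=
    fun {w v} hw hv => by rw [mul_assoc, hv.2, ← mul_assoc, hw, mul_assoc]
  obtain ⟨v, hv, rfl | rfl | rfl | rfl⟩ := d.omega_cases hu hu' ha
  · exact hv.2 x
  · exact hmul (hcomm h) hv
  · exact hmul (hcomm h1) hv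
  · exact hmul (hcomm h2) hv

/-- Otherwise every square lies in V: for x outside C(A), x² centralizes A, hence lies in A, and it
commutes with x. Then X/V has exponent 2, so X = A is abelian. -/
theorem not_centralizer_le [Finite X]
    (hC : Subgroup.centralizer (omegaOver (centralInvolutions X) : Set X) ≠ ⊤) :
    ¬ Subgroup.centralizer (omegaOver (centralInvolutions X) : Set X) ≤
      omegaOver (centralInvolutions X) := by
  intro hle
  set V := centralInvolutions X
  set A := omegaOver V
  have hsq : ∀ x : X, x * x ∈ V := by
    intro x
    by_cases hx : x ∈ Subgroup.centralizer (A : Set X)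
    · exact (mem_omegaOver.1 (hle hx)).1
    · have hxx : x * x ∈ Subgroup.centralizer (A : Set X) := by
        rw [Subgroup.mem_centralizer_iff]
        intro u hu
        have h := comm_mul_left (g := x) ((mem_omegaOver.1 hu).2 x).2
        rw [((mem_omegaOver.1 hu).2 x).1, mul_inv_eq_one, mul_assoc, inv_mul_eq_iff_eq_mul] at h
        exact h.symm
      exact d.mem_of_comm_eq_one hx (hle hxx) (by group)
  apply hC
  have htop : ∀ x, x ∈ A := by
    intro x
    refine mem_omegaOver.2 ⟨hsq x, fun g => ?_⟩
    have h : x⁻¹ * g * x * g⁻¹ = (x⁻¹ * x⁻¹) * (x * g * (x * g)) * (g⁻¹ * g⁻¹) := by group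
    rw [h]
    exact mul_mem (mul_mem (hsq _) (hsq _)) (hsq _)
  rw [eq_top_iff]
  intro x _
  exact Subgroup.mem_centralizer_iff.2 fun u hu => d.omega_comm hu (htop x)

theorem map_mem_centralizer [Finite X] {c : X}
    (hc : c ∈ Subgroup.centralizer (omegaOver (centralInvolutions X) : Set X)) :
    α c ∈ Subgroup.centralizer (omegaOver (centralInvolutions X) : Set X) := by
  set A := omegaOver (centralInvolutions X)
  have hsurj : Function.Surjective
      ((α.comp A.subtype).codRestrict A (fun x => d.map_mem_omega x.2)) :=
    Finite.injective_iff_surjective.1 fun x y h =>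
      Subtype.ext (d.injective (congrArg Subtype.val h))
  rw [Subgroup.mem_centralizer_iff]
  intro a ha
  obtain ⟨⟨u, hu⟩, h⟩ := hsurj ⟨a, ha⟩
  have h' : α u = a := congrArg Subtype.val h
  rw [← h', ← map_mul, ← map_mul, Subgroup.mem_centralizer_iff.1 hc u hu]

theorem comm_mem [Finite X] {c y : X}
    (hc : c ∈ Subgroup.centralizer (omegaOver (centralInvolutions X) : Set X))
    (hy : y ∈ omegaOver (omegaOver (centralInvolutions X)))
    (hyC : y ∈ Subgroup.centralizer (omegaOver (centralInvolutions X) : Set X)) :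
    y⁻¹ * c * y * c⁻¹ ∈ centralInvolutions X := by
  have hr := (mem_omegaOver.1 hy).2 c
  have h1 := Subgroup.mem_centralizer_iff.1 hyC _ hr
  have h2 := Subgroup.mem_centralizer_iff.1 hc _ (mem_omegaOver.1 hy).1
  set r := y⁻¹ * c * y * c⁻¹ with hrdef
  have h3 : y * r = c * y * c⁻¹ := by rw [hrdef]; group
  rw [d.mem_iff]
  have h4 : y * y * (r * r) = y * y := by
    calc y * y * (r * r) = y * (y * r) * r := by group
      _ = y * (r * y) * r := by rw [h1]
      _ = (y * r) * (y * r) := by group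
      _ = c * (y * y) * c⁻¹ := by rw [h3]; group
      _ = y * y := by rw [← h2]; group
  exact mul_eq_left.1 h4

/-- If not, choose y in C = C(A) in the layer above A but outside A, and x outside C. Since x² is in
C, [y, x²] transforms by the rule for the pairing on C. It also equals [y², x] · [e, x] with e = [y,
x] in A, and replacing y by αy changes the second factor differently. The comparison makes [e, x] an
α-fixed point, hence trivial, and this drags y into A. -/
theorem centralizer_eq_top [Finite X] (hne : centralInvolutions X ≠ ⊤) :
    Subgroup.centralizer (omegaOver (centralInvolutions X) : Set X) = ⊤ := by
  by_contra hC
  have hCA := d.not_centralizer_le hC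
  obtain ⟨y, hyC, hy, hyA⟩ := exists_mem_omegaOver d.isPGroup _ _ hCA
  obtain ⟨x, hx⟩ : ∃ x, x ∉ Subgroup.centralizer (omegaOver (centralInvolutions X) : Set X) := by
    by_contra! h
    exact hC (eq_top_iff.2 fun x _ => h x)
  have hmemV := d.mem_iff
  have hcommE := fun {c y : X} => d.comm_mem (c := c) (y := y)
  have hαC := fun {c : X} => d.map_mem_centralizer (c := c)
  have hpsi := d.comm_map_eq
  have hmemA := fun {y : X} => d.mem_omega_of_commute hne (y := y)
  have hcardV := d.card_centralInvolutions
  have hcardW := d.card_quotient hne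
  set V := centralInvolutions X with hV
  set A := omegaOver V with hA
  set C := Subgroup.centralizer (A : Set X) with hCdef
  have hCmem : ∀ {c a}, c ∈ C → a ∈ A → a * c = c * a := fun hc ha =>
    Subgroup.mem_centralizer_iff.1 hc _ ha
  have hAC : A ≤ C := fun a ha => Subgroup.mem_centralizer_iff.2 fun u hu => d.omega_comm hu ha
  let E : Subgroup X := omegaOver A ⊓ C
  have hAE : A ≤ E := le_inf (le_omegaOver A) hAC
  have hαE : ∀ y ∈ E, α y ∈ E := fun y hy =>
    ⟨map_mem_omegaOver d.surjective (fun _ => d.map_mem_omega) hy.1, hαC hy.2⟩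
  let αE : E →* E := (α.comp E.subtype).codRestrict E (fun x => hαE x x.2)
  let αC : C →* C := (α.comp C.subtype).codRestrict C (fun x => hαC x.2)
  have hEcomm : ∀ y ∈ E, ∀ y' ∈ E, y * y' = y' * y := by
    -- Squaring is multiplicative on E modulo V since commutators within E lie in V. Its kernel lies
    -- in A and its image has at most 4 elements, so the central subgroup A has index at most 4 in
    -- E.
    let f : E →* X ⧸ V := MonoidHom.mk' (fun y => QuotientGroup.mk (y.1 * y.1)) (fun y y' => by
      have h := (QuotientGroup.eq_one_iff _).2 (hcommE y.2.2 y'.2.1 y'.2.2)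
      simp only [QuotientGroup.mk_mul, QuotientGroup.mk_inv] at h
      rw [mul_inv_eq_one, mul_assoc, inv_mul_eq_iff_eq_mul] at h
      simp only [QuotientGroup.mk_mul, Subgroup.coe_mul]
      simp only [mul_assoc]
      rw [← mul_assoc (y'.1 : X ⧸ V) y.1, ← h]
      simp only [mul_assoc]
      rfl)
    have hker : f.ker ≤ A.subgroupOf E := fun y hy => by
      rw [MonoidHom.mem_ker] at hy
      exact hmemA (fun a ha => (hCmem y.2.2 ha).symm) ((QuotientGroup.eq_one_iff _).1 hy)
    have hrange : f.range ≤ centralInvolutions (X ⧸ V) := by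
      rintro _ ⟨y, rfl⟩
      exact (mem_omegaOver.1 y.2.1).1
    have hidx : (A.subgroupOf E).index ≤ 4 := by
      refine (Nat.le_of_dvd ?_ (Subgroup.index_dvd_of_le hker)).trans ?_
      · exact Nat.pos_of_ne_zero Subgroup.index_ne_zero_of_finite
      · rw [Subgroup.index_ker, ← hcardW]
        exact Subgroup.card_le_of_le hrange
    intro y hy y' hy'
    have := mul_comm_of_card_le_four_mul αE
      (fun x y h => Subtype.ext (d.injective (congrArg Subtype.val h)))
      (fun x h => Subtype.ext (d.eq_one_of_fixed (congrArg Subtype.val h)))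
      (A.subgroupOf E) (fun z hz x => Subtype.ext (hCmem x.2.2 hz))
      (by rw [← (A.subgroupOf E).card_mul_index, mul_comm]; gcongr) ⟨y, hy⟩ ⟨y', hy'⟩
    exact congrArg Subtype.val this
  have htrE : ∀ y ∈ E, y * α y * α (α y) ∈ A := by
    intro y hy
    have h1 := hαE y hy
    have h2 := hαE _ h1
    refine hmemA (fun a ha => (hCmem (mul_mem (mul_mem hy h1) h2).2 ha).symm) ?_
    have h := d.trace_mem (mem_omegaOver.1 hy.1).1
    rw [map_mul, map_mul] at h
    convert h using 1
    have e1 := hEcomm y hy _ h1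
    have e2 := hEcomm _ (mul_mem hy h1) _ h2
    calc y * α y * α (α y) * (y * α y * α (α y))
        = y * α y * (α (α y) * (y * α y)) * α (α y) := by group
      _ = y * (α y * y) * α y * (α (α y) * α (α y)) := by rw [← e2]; group
      _ = _ := by rw [← e1]; group
  have hrho : ∀ c ∈ C, ∀ y ∈ E, (α y)⁻¹ * c * α y * c⁻¹ = α (α (y⁻¹ * c * y * c⁻¹)) := by
    intro c hc y hy
    have hmem : ∀ (c : C) (y : E), y.1⁻¹ * c.1 * y.1 * c.1⁻¹ ∈ V := fun c y =>
      hcommE c.2 y.2.1 y.2.2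
    refine pairing_map_eq αC αE α
      (fun (c : C) (y : E) => y.1⁻¹ * c.1 * y.1 * c.1⁻¹)
      (fun x h => Subtype.ext (d.eq_one_of_fixed (congrArg Subtype.val h)))
      (fun x y w => comm_mul_left (hmem y w).2) (fun x v w => comm_mul_right (hmem x v).2)
      (fun x w => (hmem x w).2) (fun x w => ?_) (fun x w => ?_) (fun x w => d.trace _ (hmem x w).1)
      (fun x w => (hmem x w).1) ⟨c, hc⟩ ⟨y, hy⟩
    · change (α w.1)⁻¹ * α x.1 * α w.1 * (α x.1)⁻¹ = _
      simp
    · have h := hCmem x.2 (htrE w w.2)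
      change (w.1 * α w.1 * α (α w.1))⁻¹ * x.1 * (w.1 * α w.1 * α (α w.1)) * x.1⁻¹ = 1
      rw [mul_assoc _ x.1, ← h]
      group
  have hxx : x * x ∈ C := by
    refine Subgroup.mem_centralizer_iff.2 fun u hu => ?_
    have h := comm_mul_left (g := x) ((mem_omegaOver.1 hu).2 x).2
    rw [((mem_omegaOver.1 hu).2 x).1, mul_inv_eq_one, mul_assoc, inv_mul_eq_iff_eq_mul] at h
    exact h.symm
  have hee : ∀ y ∈ E, (y * y)⁻¹ * x * (y * y) * x⁻¹ =
      (y⁻¹ * x * y * x⁻¹) * (y⁻¹ * x * y * x⁻¹) := by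
    intro y hy
    have h := hCmem hy.2 ((mem_omegaOver.1 hy.1).2 x)
    calc (y * y)⁻¹ * x * (y * y) * x⁻¹
        = y⁻¹ * ((y⁻¹ * x * y * x⁻¹) * y) * (y⁻¹ * x * y * x⁻¹) := by group
      _ = _ := by rw [h]; group
  have hsum : ∀ y ∈ E, y⁻¹ * (x * x) * y * (x * x)⁻¹ =
      ((y * y)⁻¹ * x * (y * y) * x⁻¹) *
        ((y⁻¹ * x * y * x⁻¹)⁻¹ * x * (y⁻¹ * x * y * x⁻¹) * x⁻¹) := by
    intro y hy
    rw [hee y hy]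
    group
  have hyE : y ∈ E := ⟨hy, hyC⟩
  have hyE' := hαE y hyE
  have heA := (mem_omegaOver.1 hy).2 x
  have heA' := (mem_omegaOver.1 hyE'.1).2 x
  have h1 := hsum y hyE
  have h2 := hsum (α y) hyE'
  have h3 := hee y hyE
  have h4 := hee (α y) hyE'
  rw [hrho _ hxx y hyE, h1] at h2
  have h5 := hpsi x (mem_omegaOver.1 hy).1
  rw [map_mul] at h5
  set e := y⁻¹ * x * y * x⁻¹
  set e' := (α y)⁻¹ * x * α y * x⁻¹
  have hαe := d.map_mem_omega heA
  have hααe := d.map_mem_omega hαe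
  -- Both elements lie in A and have the same square, α²[y², x], so they differ by an element of V,
  -- which is invisible to commutators.
  have h6 : (α (α e))⁻¹ * e' ∈ V := by
    refine d.inv_mul_mem hααe heA' ?_
    rw [← h4, h5, h3]
    simp only [map_mul]
  obtain ⟨v, hv, hev⟩ : ∃ v ∈ V, e' = α (α e) * v := ⟨_, h6, by group⟩
  have h7 : e'⁻¹ * x * e' * x⁻¹ = (α (α e))⁻¹ * x * (α (α e)) * x⁻¹ := by
    rw [hev, comm_mul_right ((mem_omegaOver.1 hααe).2 x).2, mul_eq_left, mul_assoc _ x, ← hv.2]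
    group
  have hψV := (mem_omegaOver.1 heA).2 x
  rw [h7, hpsi x hαe, hpsi x heA, d.map3 (d.map_mem α hψV), h5, map_mul, map_mul] at h2
  -- What remains says that α² and α agree on [e, x]. Injectivity of α makes [e, x] a fixed point.
  have h8 := mul_left_cancel h2
  have h9 := d.eq_one_of_fixed (d.injective h8)
  have h10 := d.mem_of_comm_eq_one hx heA h9
  rw [h10.1] at h3
  have h11 := d.mem_of_comm_eq_one hx (mem_omegaOver.1 hy).1 h3
  exact hyA (hmemA (fun a ha => (hCmem hyC ha).symm) h11)

end InvolutionAction

/-! ### Passage to the quotient and commutativity -/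

namespace InvolutionAction

theorem iterate_map {X : Type*} [Group X] {α : X →* X} (N : Subgroup X) [N.Normal]
    (h : N ≤ N.comap α) (n : ℕ) (x : X) :
    (QuotientGroup.map N N α h)^[n] (QuotientGroup.mk x) = QuotientGroup.mk (α^[n] x) := by
  induction n generalizing x with
  | zero => rfl
  | succ n ih =>
    rw [Function.iterate_succ_apply, Function.iterate_succ_apply, QuotientGroup.map_mk, ih]

theorem le_comap {X : Type*} [Group X] {α τ : X →* X} (d : InvolutionAction α τ) (f : X →* X) :
    centralInvolutions X ≤ (centralInvolutions X).comap f := fun _ => d.map_mem f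

/-- Once A is central, an element with square in V lies in A, so the involutions of X/V are those of
A/V. Squaring identifies A/V with V compatibly with α and τ, so their actions carry over. -/
theorem quotient {X : Type*} [Group X] [Finite X] {α τ : X →* X} (d : InvolutionAction α τ)
    (hne : centralInvolutions X ≠ ⊤) :
    InvolutionAction
      (QuotientGroup.map (centralInvolutions X) (centralInvolutions X) α (d.le_comap α))
      (QuotientGroup.map (centralInvolutions X) (centralInvolutions X) τ (d.le_comap τ)) := by
  have hC := d.centralizer_eq_top hne
  have hmem : ∀ x : X, x * x ∈ centralInvolutions X → x ∈ omegaOver (centralInvolutions X) :=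
    fun x hx => d.mem_omega_of_commute hne (fun a ha =>
      (Subgroup.mem_centralizer_iff.1 (hC ▸ Subgroup.mem_top x) a ha).symm) hx
  have hmem' : ∀ x : X, (QuotientGroup.mk x : X ⧸ centralInvolutions X) * QuotientGroup.mk x = 1 →
      x ∈ omegaOver (centralInvolutions X) := fun x hx =>
    hmem x ((QuotientGroup.eq_one_iff _).1 hx)
  have hcentral : ∀ v : X ⧸ centralInvolutions X, v * v = 1 → ∀ g, v * g = g * v := by
    intro v hv
    induction v using QuotientGroup.induction_on with
    | H x =>
      have h : (QuotientGroup.mk x : X ⧸ centralInvolutions X) ∈ centralInvolutions _ := hmem' x hv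
      exact h.2
  refine ⟨d.isPGroup.to_quotient _, hcentral, ?_, ?_, ?_, ?_, ?_⟩
  · rw [← d.card_quotient hne]
    exact Nat.card_congr (Equiv.subtypeEquivRight fun v => ⟨fun h => ⟨h, hcentral v h⟩, fun h => h.1⟩)
  · intro v hv
    induction v using QuotientGroup.induction_on with
    | H x => exact (QuotientGroup.eq_one_iff _).2 (d.trace_mem (hmem' x hv))
  · obtain ⟨k, hk⟩ := d.iterate
    refine ⟨k, fun v => ?_⟩
    induction v using QuotientGroup.induction_on with
    | H x => rw [iterate_map, hk]
  · obtain ⟨v, hv, hτ⟩ := d.moves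
    obtain ⟨u, hu, rfl⟩ := d.exists_mul_self hne ((d.mem_iff v).2 hv)
    refine ⟨QuotientGroup.mk u, (QuotientGroup.eq_one_iff _).2 (mem_omegaOver.1 hu).1, fun h => ?_⟩
    rw [QuotientGroup.map_mk, eq_comm, QuotientGroup.eq] at h
    have hτu : τ u ∈ omegaOver (centralInvolutions X) :=
      map_mem_omegaOver d.surjective_right (fun _ => d.map_mem τ) hu
    have h1 := h.1
    rw [d.mul_self_mul (inv_mem hu) hτu, ← mul_inv_rev, inv_mul_eq_one] at h1
    exact hτ (by rw [map_mul, h1])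
  · obtain ⟨g, hg⟩ := d.inner
    refine ⟨QuotientGroup.mk g, fun v => ?_⟩
    induction v using QuotientGroup.induction_on with
    | H x => rw [QuotientGroup.map_mk, QuotientGroup.map_mk, hg]; rfl

theorem commute {X : Type*} [Group X] [Finite X] {α τ : X →* X} (d : InvolutionAction α τ)
    (x y : X) : x * y = y * x := by
  induction hn : Nat.card X using Nat.strong_induction_on generalizing X with
  | _ n ih =>
  by_cases hne : centralInvolutions X = ⊤
  · exact (hne ▸ Subgroup.mem_top x : x ∈ centralInvolutions X).2 y
  have hV4 := d.card_centralInvolutions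
  have hlt : Nat.card (X ⧸ centralInvolutions X) < n := by
    have h := (centralInvolutions X).card_mul_index
    rw [hV4, Subgroup.index] at h
    have : 0 < Nat.card (X ⧸ centralInvolutions X) := Nat.card_pos
    omega
  have hcomm := fun a b => ih _ hlt (d.quotient hne) a b rfl
  have hW := d.card_quotient hne
  set V := centralInvolutions X
  let s : X ⧸ V →* X ⧸ V := MonoidHom.mk' (fun u => u * u) (fun u w => by
    rw [mul_assoc, ← mul_assoc w, hcomm w u]; simp only [mul_assoc])
  -- `P` is the preimage of the squares of the abelian group X/V. It is central because commutators
  -- lie in V and square to 1. Its index equals the number of solutions of u² = 1 in X/V, which is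
  -- 4.
  let P := s.range.comap (QuotientGroup.mk' V)
  have hker : s.ker = centralInvolutions (X ⧸ V) := by
    ext u
    exact ⟨fun h => ⟨h, hcomm u⟩, fun h => h.1⟩
  have hcV : ∀ x g : X, x⁻¹ * g * x * g⁻¹ ∈ V := fun x g => by
    rw [← QuotientGroup.eq_one_iff]
    simp only [QuotientGroup.mk_mul, QuotientGroup.mk_inv]
    rw [mul_assoc _ (g : X ⧸ V), hcomm (g : X ⧸ V) x, inv_mul_cancel_left,
      mul_inv_cancel]
  refine mul_comm_of_card_le_four_mul α d.injective (fun x => d.eq_one_of_fixed) P ?_ ?_ x y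
  · rintro p ⟨u, hu⟩ g
    induction u using QuotientGroup.induction_on with
    | H x =>
      have hv : (x * x)⁻¹ * p ∈ V := QuotientGroup.eq.1 hu
      have h1 := comm_mul_right (w := x) (hcV x g).2
      rw [(hcV x g).1, mul_inv_eq_one, mul_assoc, inv_mul_eq_iff_eq_mul] at h1
      calc p * g = x * x * ((x * x)⁻¹ * p * g) := by group
        _ = (x * x) * g * ((x * x)⁻¹ * p) := by rw [hv.2]; group
        _ = _ := by rw [← h1]; group
  · have h1 : P.index = s.range.index :=
      Subgroup.index_comap_of_surjective _ (QuotientGroup.mk'_surjective V)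
    have h2 := s.range.card_mul_index
    have h3 := s.ker.card_mul_index
    rw [Subgroup.index_ker, hker, hW] at h3
    have h4 : 0 < Nat.card s.range := Nat.card_pos
    have h5 : s.range.index = 4 := by
      rw [← h3, mul_comm 4] at h2
      exact Nat.eq_of_mul_eq_mul_left h4 h2
    rw [← P.card_mul_index, h1, h5, mul_comm]

end InvolutionAction

/-! ### Recognition of the dihedral, semidihedral and wreathed groups -/

theorem zpow_eq_zpow_of_cast_eq {X : Type*} [Group X] {c : X} {m : ℕ} (hc : c ^ m = 1) {a b : ℤ}
    (h : (a : ZMod m) = b) : c ^ a = c ^ b := by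
  obtain ⟨k, hk⟩ := (ZMod.intCast_eq_intCast_iff_dvd_sub a b m).1 h
  rw [show b = a + m * k by omega, zpow_add, zpow_mul, zpow_natCast, hc, one_zpow, mul_one]

theorem Subgroup.eq_top_of_index_two_le {X : Type*} [Group X] {K H : Subgroup X}
    (hK : K.index = 2) (hKH : K ≤ H) {t : X} (ht : t ∉ K) (htH : t ∈ H) : H = ⊤ := by
  rw [eq_top_iff]
  intro g _
  by_cases hg : g ∈ K
  · exact hKH hg
  · have : t * g ∈ K := (Subgroup.mul_mem_iff_of_index_two hK).2 (by simp [ht, hg])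
    exact (mul_mem_cancel_left htH).1 (hKH this)

theorem nonempty_mulEquiv_dihedralGroup {X : Type*} [Group X] {c t : X} {m : ℕ} [NeZero m]
    (hc : orderOf c = m) (htc : t ∉ Subgroup.zpowers c) (ht : t * t = 1) (hconj : t * c * t⁻¹ = c⁻¹)
    (hcard : Nat.card X = 2 * m) : Nonempty (X ≃* DihedralGroup m) := by
  have hcm : c ^ m = 1 := hc ▸ pow_orderOf_eq_one c
  have hz : ∀ {a b : ℤ}, (a : ZMod m) = b → c ^ a = c ^ b := fun h => zpow_eq_zpow_of_cast_eq hcm h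
  have hct : ∀ a : ℤ, c ^ a * t = t * c ^ (-a) := fun a => by
    have h : t * c ^ (-a) * t⁻¹ = c ^ a := by rw [← conj_zpow, hconj, inv_zpow, zpow_neg, inv_inv]
    rw [← h, inv_mul_cancel_right]
  let f : DihedralGroup m → X := fun g => match g with
    | DihedralGroup.r i => c ^ (i.cast : ℤ)
    | DihedralGroup.sr i => t * c ^ (i.cast : ℤ)
  have hadd : ∀ i j : ZMod m, c ^ ((i + j).cast : ℤ) = c ^ (i.cast : ℤ) * c ^ (j.cast : ℤ) :=
    fun i j => by rw [← zpow_add]; exact hz (by simp)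
  have hsub : ∀ i j : ZMod m, c ^ ((j - i).cast : ℤ) = c ^ (-(i.cast : ℤ)) * c ^ (j.cast : ℤ) :=
    fun i j => by rw [← zpow_add]; exact hz (by push_cast; ring)
  let F : DihedralGroup m →* X := MonoidHom.mk' f (by
    rintro (i | i) (j | j)
    · exact hadd i j
    · change t * c ^ ((j - i).cast : ℤ) = c ^ (i.cast : ℤ) * (t * c ^ (j.cast : ℤ))
      rw [hsub, ← mul_assoc _ t, hct, mul_assoc]
    · change t * c ^ ((i + j).cast : ℤ) = t * c ^ (i.cast : ℤ) * (c ^ (j.cast : ℤ))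
      rw [hadd, mul_assoc]
    · change c ^ ((j - i).cast : ℤ) = t * c ^ (i.cast : ℤ) * (t * c ^ (j.cast : ℤ))
      rw [hsub, mul_assoc, ← mul_assoc _ t, hct, ← mul_assoc, ← mul_assoc, ht, one_mul])
  have hinj : Function.Injective F := by
    rw [injective_iff_map_eq_one]
    rintro (i | i) h
    · have h' : c ^ (i.cast : ℤ) = 1 := h
      have hd := orderOf_dvd_iff_zpow_eq_one.2 h'
      rw [hc, ← ZMod.intCast_zmod_eq_zero_iff_dvd] at hd
      rw [ZMod.intCast_cast, ZMod.cast_id] at hd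
      rw [hd, DihedralGroup.r_zero]
    · exact absurd (eq_inv_of_mul_eq_one_left (h : t * c ^ (i.cast : ℤ) = 1) ▸
        inv_mem (Subgroup.zpow_mem_zpowers c _)) htc
  have : Finite X := Nat.finite_of_card_ne_zero (by
    rw [hcard]; exact mul_ne_zero two_ne_zero (NeZero.ne m))
  exact ⟨(MulEquiv.ofBijective F ((Nat.bijective_iff_injective_and_card F).2
    ⟨hinj, by rw [DihedralGroup.nat_card, hcard]⟩)).symm⟩

/-- The relations give a surjection from the presented group onto X. Covering the presented group by
a set of normal forms no larger than X makes it bijective. -/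
theorem nonempty_mulEquiv_presentedGroup {ι X T : Type*} [Group X] [Finite X] [Finite T]
    {rels : Set (FreeGroup ι)} {f : ι → X} (hf : ∀ r ∈ rels, FreeGroup.lift f r = 1)
    (hsurj : ∀ H : Subgroup X, (∀ i, f i ∈ H) → H = ⊤) (g : T → PresentedGroup rels)
    (hg : Function.Surjective g) (hcard : Nat.card T ≤ Nat.card X) :
    Nonempty (X ≃* PresentedGroup rels) := by
  have : Finite (PresentedGroup rels) := Finite.of_surjective g hg
  let F := PresentedGroup.toGroup hf
  have hF : Function.Surjective F := by
    rw [← MonoidHom.range_eq_top]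
    exact hsurj _ fun i => ⟨PresentedGroup.of i, PresentedGroup.toGroup.of hf⟩
  exact ⟨(MulEquiv.ofBijective F (hF.bijective_of_nat_card_le
    ((Nat.card_le_card_of_surjective g hg).trans hcard))).symm⟩

theorem nonempty_mulEquiv_semidihedral {X : Type*} [Group X] [Finite X] {c t : X} {n : ℕ}
    (hc : c ^ 2 ^ n = 1) (hidx : (Subgroup.zpowers c).index = 2)
    (htc : t ∉ Subgroup.zpowers c) (ht : t ^ 2 = 1)
    (hconj : t * c * t⁻¹ = c ^ ((-1 : ℤ) + 2 ^ (n - 1))) (hcard : Nat.card X = 2 * 2 ^ n) :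
    Nonempty (X ≃* PresentedGroup (semidihedralRels n)) := by
  let x : PresentedGroup (semidihedralRels n) := PresentedGroup.of 0
  let y : PresentedGroup (semidihedralRels n) := PresentedGroup.of 1
  have hy : y * y = 1 := by
    rw [← pow_two]
    exact PresentedGroup.one_of_mem (rels := semidihedralRels n) (Or.inl rfl)
  have hx : x ^ 2 ^ n = 1 :=
    PresentedGroup.one_of_mem (rels := semidihedralRels n) (Or.inr (Or.inl rfl))
  set k : ℤ := (-1 : ℤ) + 2 ^ (n - 1) with hk
  have hyx : y * x * y⁻¹ = x ^ k := by
    rw [← mul_inv_eq_one]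
    exact PresentedGroup.one_of_mem (rels := semidihedralRels n) (Or.inr (Or.inr rfl))
  have hyxz : ∀ i : ℤ, y * x ^ i = x ^ (k * i) * y := fun i => by
    rw [← mul_inv_eq_iff_eq_mul, ← conj_zpow, hyx, zpow_mul]
  have hyinv : y⁻¹ = y := inv_eq_of_mul_eq_one_left hy
  let H : Subgroup (PresentedGroup (semidihedralRels n)) := {
    carrier := {g | ∃ i : ℤ, g = x ^ i ∨ g = x ^ i * y}
    one_mem' := ⟨0, Or.inl (zpow_zero x).symm⟩
    mul_mem' := by
      rintro _ _ ⟨i, rfl | rfl⟩ ⟨j, rfl | rfl⟩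
      · exact ⟨i + j, Or.inl (zpow_add x i j).symm⟩
      · exact ⟨i + j, Or.inr (by rw [zpow_add, mul_assoc])⟩
      · exact ⟨i + k * j, Or.inr (by rw [mul_assoc, hyxz, zpow_add, mul_assoc])⟩
      · exact ⟨i + k * j, Or.inl (by
          rw [mul_assoc, ← mul_assoc y, hyxz, mul_assoc _ y y, hy, mul_one, zpow_add])⟩
    inv_mem' := by
      rintro _ ⟨i, rfl | rfl⟩
      · exact ⟨-i, Or.inl (zpow_neg x i).symm⟩
      · exact ⟨k * -i, Or.inr (by rw [mul_inv_rev, ← zpow_neg, hyinv, hyxz])⟩ }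
  have hH : ∀ g, g ∈ H := PresentedGroup.generated_by _ H (by
    intro j
    fin_cases j
    · exact ⟨1, Or.inl (zpow_one x).symm⟩
    · exact ⟨0, Or.inr (by simp [y])⟩)
  have : NeZero (2 ^ n) := ⟨by positivity⟩
  refine nonempty_mulEquiv_presentedGroup (T := ZMod (2 ^ n) × Bool) (f := ![c, t]) ?_ ?_
    (fun p => x ^ (p.1.cast : ℤ) * if p.2 then y else 1) ?_ ?_
  · rintro r (rfl | rfl | rfl)
    · simpa using ht
    · simpa using hc
    · simpa [mul_inv_eq_one] using hconj
  · intro K hK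
    exact Subgroup.eq_top_of_index_two_le hidx (Subgroup.zpowers_le.2 (hK 0)) htc (hK 1)
  · intro g
    obtain ⟨i, rfl | rfl⟩ := hH g
    · exact ⟨((i : ZMod (2 ^ n)), false), by
        simpa using zpow_eq_zpow_of_cast_eq hx (by simp)⟩
    · exact ⟨((i : ZMod (2 ^ n)), true), by
        simpa using zpow_eq_zpow_of_cast_eq hx (by simp)⟩
  · rw [Nat.card_prod, Nat.card_zmod, Nat.card_eq_fintype_card, Fintype.card_bool, hcard, mul_comm]

theorem nonempty_mulEquiv_wreathed {X : Type*} [Group X] [Finite X] {a b t : X} {n : ℕ}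
    (ha : a ^ 2 ^ n = 1) (hb : b ^ 2 ^ n = 1) (ht : t ^ 2 = 1) (hab : a * b = b * a)
    (hconj : t * a * t⁻¹ = b) {K : Subgroup X} (hK : ∀ H : Subgroup X, a ∈ H → b ∈ H → K ≤ H)
    (hidx : K.index = 2) (htK : t ∉ K) (hcard : Nat.card X = 2 * (2 ^ n * 2 ^ n)) :
    Nonempty (X ≃* PresentedGroup (wreathedRels n)) := by
  let x : PresentedGroup (wreathedRels n) := PresentedGroup.of 0
  let y : PresentedGroup (wreathedRels n) := PresentedGroup.of 1
  let z : PresentedGroup (wreathedRels n) := PresentedGroup.of 2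
  have hx : x ^ 2 ^ n = 1 := PresentedGroup.one_of_mem (rels := wreathedRels n) (Or.inl rfl)
  have hy : y ^ 2 ^ n = 1 :=
    PresentedGroup.one_of_mem (rels := wreathedRels n) (Or.inr (Or.inl rfl))
  have hz : z * z = 1 := by
    rw [← pow_two]
    exact PresentedGroup.one_of_mem (rels := wreathedRels n) (Or.inr (Or.inr (Or.inl rfl)))
  have hxy : Commute x y := by
    have := PresentedGroup.one_of_mem (rels := wreathedRels n)
      (Or.inr (Or.inr (Or.inr (Or.inl rfl))))
    exact mul_inv_eq_one.1 this
  have hzx : z * x * z⁻¹ = y := by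
    rw [← mul_inv_eq_one]
    exact PresentedGroup.one_of_mem (rels := wreathedRels n)
      (Or.inr (Or.inr (Or.inr (Or.inr rfl))))
  have hzinv : z⁻¹ = z := inv_eq_of_mul_eq_one_left hz
  have hzy : z * y * z⁻¹ = x := by
    rw [← hzx, hzinv]
    simp only [← mul_assoc]
    rw [hz, one_mul, mul_assoc, hz, mul_one]
  have hzxy : ∀ i j : ℤ, z * (x ^ i * y ^ j) = x ^ j * y ^ i * z := fun i j => by
    rw [← mul_inv_eq_iff_eq_mul]
    calc z * (x ^ i * y ^ j) * z⁻¹ = (z * x ^ i * z⁻¹) * (z * y ^ j * z⁻¹) := by group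
      _ = y ^ i * x ^ j := by rw [← conj_zpow, ← conj_zpow, hzx, hzy]
      _ = _ := (hxy.zpow_zpow j i).symm
  have hmul : ∀ i j k l : ℤ, (x ^ i * y ^ j) * (x ^ k * y ^ l) = x ^ (i + k) * y ^ (j + l) :=
    fun i j k l => by
      rw [zpow_add, zpow_add, mul_assoc, ← mul_assoc (y ^ j), ← (hxy.zpow_zpow k j).eq]
      simp only [mul_assoc]
  have hinv : ∀ i j : ℤ, (x ^ i * y ^ j)⁻¹ = x ^ (-i) * y ^ (-j) := fun i j => by
    rw [mul_inv_rev, ← zpow_neg, ← zpow_neg, (hxy.zpow_zpow (-i) (-j)).eq]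
  let H : Subgroup (PresentedGroup (wreathedRels n)) := {
    carrier := {g | ∃ i j : ℤ, g = x ^ i * y ^ j ∨ g = x ^ i * y ^ j * z}
    one_mem' := ⟨0, 0, Or.inl (by simp)⟩
    mul_mem' := by
      rintro _ _ ⟨i, j, rfl | rfl⟩ ⟨k, l, rfl | rfl⟩
      · exact ⟨_, _, Or.inl (hmul i j k l)⟩
      · exact ⟨_, _, Or.inr (by rw [← mul_assoc, hmul i j k l])⟩
      · exact ⟨_, _, Or.inr (by rw [mul_assoc, hzxy, ← mul_assoc, hmul])⟩
      · exact ⟨_, _, Or.inl (by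
          rw [mul_assoc, ← mul_assoc z, hzxy, mul_assoc _ z z, hz, mul_one, hmul])⟩
    inv_mem' := by
      rintro _ ⟨i, j, rfl | rfl⟩
      · exact ⟨_, _, Or.inl (hinv i j)⟩
      · exact ⟨_, _, Or.inr (by rw [mul_inv_rev, hinv, hzinv, hzxy])⟩ }
  have hH : ∀ g, g ∈ H := PresentedGroup.generated_by _ H (by
    intro j
    fin_cases j
    · exact ⟨1, 0, Or.inl (by simp [x])⟩
    · exact ⟨0, 1, Or.inl (by simp [y])⟩
    · exact ⟨0, 0, Or.inr (by simp [z])⟩)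
  have : NeZero (2 ^ n) := ⟨by positivity⟩
  refine nonempty_mulEquiv_presentedGroup (T := (ZMod (2 ^ n) × ZMod (2 ^ n)) × Bool)
    (f := ![a, b, t]) ?_ ?_
    (fun p => x ^ (p.1.1.cast : ℤ) * y ^ (p.1.2.cast : ℤ) * if p.2 then z else 1) ?_ ?_
  · rintro r (rfl | rfl | rfl | rfl | rfl)
    · simpa using ha
    · simpa using hb
    · simpa using ht
    · simpa [mul_inv_eq_one] using mul_inv_eq_one.2 hab
    · simpa [mul_inv_eq_one] using hconj
  · intro L hL
    exact Subgroup.eq_top_of_index_two_le hidx (hK L (hL 0) (hL 1)) htK (hL 2)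
  · intro g
    have hx' : ∀ i : ℤ, x ^ (((i : ZMod (2 ^ n)).cast : ℤ)) = x ^ i := fun i =>
      zpow_eq_zpow_of_cast_eq hx (by simp)
    have hy' : ∀ i : ℤ, y ^ (((i : ZMod (2 ^ n)).cast : ℤ)) = y ^ i := fun i =>
      zpow_eq_zpow_of_cast_eq hy (by simp)
    obtain ⟨i, j, rfl | rfl⟩ := hH g
    · exact ⟨(((i : ZMod (2 ^ n)), (j : ZMod (2 ^ n))), false), by simp [hx', hy']⟩
    · exact ⟨(((i : ZMod (2 ^ n)), (j : ZMod (2 ^ n))), true), by simp [hx', hy']⟩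
  · rw [Nat.card_prod, Nat.card_prod, Nat.card_zmod, Nat.card_eq_fintype_card, Fintype.card_bool,
      hcard, mul_comm]

/-! ### 2-groups with an involution whose centralizer has order at most four -/

theorem exists_index_zpowers_of_card_le_eight {X : Type*} [Group X] [Finite X] (hX : IsPGroup 2 X)
    {s t : X} (hst : s * t ≠ t * s) (hcard : Nat.card X ≤ 8) :
    ∃ c : X, (Subgroup.zpowers c).index = 2 := by
  have : Fact (Nat.Prime 2) := ⟨Nat.prime_two⟩
  obtain ⟨c, hc⟩ : ∃ c : X, c * c ≠ 1 := by
    by_contra! h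
    have h1 := h (s * t)
    rw [mul_eq_one_iff_eq_inv, mul_inv_rev, inv_eq_of_mul_eq_one_left (h s),
      inv_eq_of_mul_eq_one_left (h t)] at h1
    exact hst h1
  refine ⟨c, ?_⟩
  have h1 := (Subgroup.zpowers c).card_mul_index
  rw [Nat.card_zpowers] at h1
  obtain ⟨n, hn⟩ := IsPGroup.iff_orderOf.1 hX c
  have hn2 : 2 ≤ n := by
    by_contra! h
    have : orderOf c ∣ 2 := by rw [hn]; exact (Nat.pow_dvd_pow 2 (by omega : n ≤ 1))
    exact hc (by rw [← pow_two]; exact orderOf_dvd_iff_pow_eq_one.1 this)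
  have hge : 4 ≤ orderOf c := by
    rw [hn]
    exact (Nat.pow_le_pow_right (n := 2) (by norm_num) hn2 : 2 ^ 2 ≤ 2 ^ n)
  have hne : (Subgroup.zpowers c).index ≠ 1 := by
    intro h
    rw [Subgroup.index_eq_one] at h
    obtain ⟨i, hi⟩ := Subgroup.mem_zpowers_iff.1 (h ▸ Subgroup.mem_top s)
    obtain ⟨j, hj⟩ := Subgroup.mem_zpowers_iff.1 (h ▸ Subgroup.mem_top t)
    exact hst (by rw [← hi, ← hj, ← zpow_add, ← zpow_add, add_comm])
  have hpos : 0 < (Subgroup.zpowers c).index := Nat.pos_of_ne_zero Subgroup.index_ne_zero_of_finite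
  have hle : 4 * (Subgroup.zpowers c).index ≤ 8 :=
    (Nat.mul_le_mul_right _ hge).trans (h1.le.trans hcard)
  omega

theorem card_le_two_of_le_centralizer {X : Type*} [Group X] [Finite X] {t : X}
    (hcent : Nat.card (Subgroup.centralizer {t}) ≤ 4) {L : Subgroup X}
    (hL : L ≤ Subgroup.centralizer {t}) (htL : t ∉ L) : Nat.card L ≤ 2 := by
  have hdvd := Subgroup.card_dvd_of_le hL
  have hne : Nat.card L ≠ Nat.card (Subgroup.centralizer {t}) := fun h =>
    htL (Subgroup.eq_of_le_of_card_ge hL h.ge ▸ Subgroup.mem_centralizer_singleton_iff.2 rfl)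
  obtain ⟨q, hq⟩ := hdvd
  have hpos : 0 < Nat.card (Subgroup.centralizer {t}) := Nat.card_pos
  rw [hq] at hcent hne hpos
  have hq2 : 2 ≤ q := by
    by_contra! h
    interval_cases q <;> simp_all
  nlinarith

/-- Induction on X/Z(X). When t is not central, Z(X) has order 2, and the centralizer bound survives
in the quotient. The cyclic subgroup of index 2 found there has an abelian preimage M, and the
action of t on M forces the center into the cyclic part, so M itself is cyclic. -/
theorem exists_index_zpowers_eq_two {X : Type*} [Group X] [Finite X] [Nontrivial X]
    (hX : IsPGroup 2 X) (t : X) (ht : t * t = 1)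
    (hcent : Nat.card (Subgroup.centralizer {t}) ≤ 4) :
    ∃ c : X, (Subgroup.zpowers c).index = 2 := by
  induction hn : Nat.card X using Nat.strong_induction_on generalizing X with
  | _ n ih =>
  have : Fact (Nat.Prime 2) := ⟨Nat.prime_two⟩
  by_cases htz : t ∈ Subgroup.center X
  · have hle : Nat.card X ≤ 4 := by
      have : Subgroup.centralizer {t} = ⊤ :=
        Subgroup.centralizer_eq_top_iff_subset.2 (by simpa using htz)
      rwa [this, Subgroup.card_top] at hcent
    obtain ⟨m, hm, hm'⟩ := (hX.nontrivial_iff_card).1 inferInstance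
    have hm2 : m ≤ 2 := by
      by_contra! h
      have : 2 ^ 3 ≤ 2 ^ m := Nat.pow_le_pow_right (by norm_num) h
      omega
    interval_cases m
    · exact ⟨1, by rw [Subgroup.zpowers_one_eq_bot, Subgroup.index_bot, hm']; rfl⟩
    · obtain ⟨c, hc⟩ := exists_prime_orderOf_dvd_card' 2 (G := X) (by rw [hm']; norm_num)
      have h1 := (Subgroup.zpowers c).card_mul_index
      rw [Nat.card_zpowers, hc, hm'] at h1
      exact ⟨c, by omega⟩
  obtain ⟨s, hst⟩ : ∃ s, s * t ≠ t * s := by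
    by_contra! h
    exact htz (Subgroup.mem_center_iff.2 h)
  have hCmem : ∀ {g : X}, g ∈ Subgroup.centralizer {t} ↔ g * t = t * g :=
    Subgroup.mem_centralizer_singleton_iff
  have hZC : Subgroup.center X ≤ Subgroup.centralizer {t} := Subgroup.center_le_centralizer _
  have hproper : ∀ L : Subgroup X, L ≤ Subgroup.centralizer {t} → t ∉ L → Nat.card L ≤ 2 :=
    fun L hL htL => card_le_two_of_le_centralizer hcent hL htL
  have hZ2 : Nat.card (Subgroup.center X) = 2 := by
    have h1 := hproper _ hZC htz
    have h2 := (Subgroup.center X).one_lt_card_iff_ne_bot.2 (hX.bot_lt_center.ne')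
    omega
  by_cases h8 : Nat.card X ≤ 8
  · exact exists_index_zpowers_of_card_le_eight hX hst h8
  have hquot : ∃ c : X ⧸ Subgroup.center X, (Subgroup.zpowers c).index = 2 := by
    have hlt : Nat.card (X ⧸ Subgroup.center X) < n := by
      have h := (Subgroup.center X).card_mul_index
      rw [hZ2, Subgroup.index] at h
      have : 0 < Nat.card (X ⧸ Subgroup.center X) := Nat.card_pos
      omega
    have hnt : Nontrivial (X ⧸ Subgroup.center X) :=
      ⟨QuotientGroup.mk t, 1, fun h => htz ((QuotientGroup.eq_one_iff _).1 h)⟩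
    refine ih _ hlt (hX.to_quotient _) (QuotientGroup.mk t)
      (by rw [← QuotientGroup.mk_mul, ht]; rfl) ?_ rfl
    set N := (Subgroup.centralizer {(QuotientGroup.mk t : X ⧸ Subgroup.center X)}).comap
      (QuotientGroup.mk' (Subgroup.center X)) with hN
    have hNmem : ∀ g ∈ N, g⁻¹ * t⁻¹ * g * t ∈ Subgroup.center X := by
      intro g hg
      have h := Subgroup.mem_centralizer_singleton_iff.1 hg
      have h' : (QuotientGroup.mk (t * g) : X ⧸ Subgroup.center X) = QuotientGroup.mk (g * t) :=
        h.symm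
      have h2 := QuotientGroup.eq.1 h'
      rw [mul_inv_rev, ← mul_assoc] at h2
      exact h2
    -- On the preimage N of the centralizer of tZ, g ↦ [g, t] is a homomorphism into the center, of
    -- order 2. Its kernel embeds in C(t), so |N| ≤ 8.
    let F : N →* X := MonoidHom.mk' (fun g => g.1⁻¹ * t⁻¹ * g.1 * t) (fun g h => by
      have hc := hNmem g g.2
      have := Subgroup.mem_center_iff.1 hc h.1⁻¹
      change (g.1 * h.1)⁻¹ * t⁻¹ * (g.1 * h.1) * t = _
      calc (g.1 * h.1)⁻¹ * t⁻¹ * (g.1 * h.1) * t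
          = h.1⁻¹ * (g.1⁻¹ * t⁻¹ * g.1 * t) * (t⁻¹ * h.1 * t) := by group
        _ = _ := by rw [this]; group)
    have hrange : Nat.card F.range ≤ 2 := by
      rw [← hZ2]
      apply Subgroup.card_le_of_le
      rintro _ ⟨g, rfl⟩
      exact hNmem g g.2
    have hker : Nat.card F.ker ≤ 4 := by
      refine le_trans ?_ hcent
      refine Nat.card_le_card_of_injective
        (fun g : F.ker => (⟨g.1.1, ?_⟩ : Subgroup.centralizer {t})) ?_
      · have h : g.1.1⁻¹ * t⁻¹ * g.1.1 * t = 1 := g.2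
        rw [hCmem]
        rw [mul_eq_one_iff_eq_inv, mul_assoc, inv_mul_eq_iff_eq_mul, inv_mul_eq_iff_eq_mul] at h
        rwa [← mul_assoc, eq_mul_inv_iff_mul_eq] at h
      · intro g h hgh
        exact Subtype.ext (Subtype.ext (Subtype.mk.inj hgh))
    have hNcard : Nat.card N ≤ 8 := by
      have h := F.ker.card_mul_index
      rw [Subgroup.index_ker] at h
      nlinarith
    have hcomap : Nat.card N = Nat.card (Subgroup.center X) *
        Nat.card (Subgroup.centralizer {(QuotientGroup.mk t : X ⧸ Subgroup.center X)}) := by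
      let f := (QuotientGroup.mk' (Subgroup.center X)).comp N.subtype
      have h1 := f.ker.card_mul_index
      have h2 : N.map (QuotientGroup.mk' (Subgroup.center X)) = _ :=
        Subgroup.map_comap_eq_self_of_surjective (QuotientGroup.mk'_surjective _) _
      rw [Subgroup.index_ker, MonoidHom.range_comp, Subgroup.range_subtype, h2] at h1
      rw [← h1]
      congr 1
      have hle : Subgroup.center X ≤ N := fun x hx => by
        rw [hN, Subgroup.mem_comap, QuotientGroup.mk'_apply, (QuotientGroup.eq_one_iff x).2 hx]
        exact one_mem _
      have hf : f.ker = (Subgroup.center X).subgroupOf N := by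
        ext x
        exact QuotientGroup.eq_one_iff _
      rw [hf, Nat.card_congr (Subgroup.subgroupOfEquivOfLe hle).toEquiv]
    rw [hZ2] at hcomap
    omega
  obtain ⟨c', hc'⟩ := hquot
  obtain ⟨c, rfl⟩ := QuotientGroup.mk_surjective c'
  set M := (Subgroup.zpowers (QuotientGroup.mk c : X ⧸ Subgroup.center X)).comap
    (QuotientGroup.mk' (Subgroup.center X)) with hM
  have hMidx : M.index = 2 := by
    rw [hM, Subgroup.index_comap_of_surjective _ (QuotientGroup.mk'_surjective _), hc']
  have hMmem : ∀ {g}, g ∈ M → ∃ (i : ℤ), ∃ z ∈ Subgroup.center X, g = c ^ i * z := by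
    rintro g ⟨i, hi⟩
    exact ⟨i, _, QuotientGroup.eq.1 hi, by group⟩
  have hcM : c ∈ M := Subgroup.mem_zpowers (QuotientGroup.mk c : X ⧸ Subgroup.center X)
  have hZM : Subgroup.center X ≤ M := fun x hx => by
    rw [hM, Subgroup.mem_comap, QuotientGroup.mk'_apply, (QuotientGroup.eq_one_iff x).2 hx]
    exact one_mem _
  have hMcomm : ∀ {g}, g ∈ M → c * g = g * c := by
    intro g hg
    obtain ⟨i, z, hz, rfl⟩ := hMmem hg
    rw [mul_assoc, ← Subgroup.mem_center_iff.1 hz c, ← mul_assoc, ← mul_assoc, ← zpow_one_add,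
      ← zpow_add_one, add_comm]
  by_cases hZc : Subgroup.center X ≤ Subgroup.zpowers c
  · refine ⟨c, ?_⟩
    rw [← hMidx]
    congr 1
    apply le_antisymm (Subgroup.zpowers_le.2 hcM)
    intro g hg
    obtain ⟨i, z, hz, rfl⟩ := hMmem hg
    exact mul_mem (Subgroup.zpow_mem_zpowers c i) (hZc hz)
  have hMcard : 4 < Nat.card M := by
    have := M.card_mul_index
    rw [hMidx] at this
    omega
  exfalso
  have htM : t ∉ M := by
    intro htM
    have hle : M ≤ Subgroup.centralizer {t} := by
      have h1 : Subgroup.zpowers c ≤ Subgroup.centralizer {t} :=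
        Subgroup.zpowers_le.2 (hCmem.2 (hMcomm htM))
      intro g hg
      obtain ⟨i, z, hz, rfl⟩ := hMmem hg
      exact mul_mem (h1 (Subgroup.zpow_mem_zpowers c i)) (hZC hz)
    have := Subgroup.card_le_of_le hle
    omega
  have hMC : M ⊓ Subgroup.centralizer {t} = Subgroup.center X := by
    symm
    apply Subgroup.eq_of_le_of_card_ge (le_inf hZM hZC)
    rw [hZ2]
    exact hproper _ inf_le_right (fun h => htM h.1)
  have hMn : M.Normal := Subgroup.normal_of_index_eq_two hMidx
  have htinv : t⁻¹ = t := inv_eq_of_mul_eq_one_left ht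
  have htc := hMn.conj_mem c hcM t
  have hw : c * (t * c * t⁻¹) ∈ Subgroup.center X := by
    rw [← hMC]
    refine ⟨mul_mem hcM htc, hCmem.2 ?_⟩
    calc c * (t * c * t⁻¹) * t = c * t * c := by group
      _ = (t * t) * c * t⁻¹ * c := by rw [ht, one_mul, htinv]
      _ = t * ((t * c * t⁻¹) * c) := by group
      _ = _ := by rw [hMcomm htc]
  have hwz : c * (t * c * t⁻¹) * (c * (t * c * t⁻¹)) = 1 := by
    have : (⟨_, hw⟩ : Subgroup.center X) ^ Nat.card (Subgroup.center X) = 1 := pow_card_eq_one'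
    rw [hZ2, pow_two] at this
    exact congrArg Subtype.val this
  have hc2 : t * (c * c) * t⁻¹ = (c * c)⁻¹ := by
    rw [eq_inv_iff_mul_eq_one]
    rw [← hwz]
    have h1 := hMcomm htc
    calc t * (c * c) * t⁻¹ * (c * c) = (t * c * t⁻¹) * ((t * c * t⁻¹) * c) * c := by group
      _ = (t * c * t⁻¹) * (c * (t * c * t⁻¹)) * c := by rw [h1]
      _ = ((t * c * t⁻¹) * c) * ((t * c * t⁻¹) * c) := by group
      _ = _ := by rw [← h1]
  by_cases hcc : c * c = 1
  · have hle : Nat.card (Subgroup.zpowers (QuotientGroup.mk c : X ⧸ Subgroup.center X)) ≤ 2 := by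
      rw [Nat.card_zpowers]
      apply Nat.le_of_dvd (by norm_num)
      apply orderOf_dvd_of_pow_eq_one
      rw [pow_two, ← QuotientGroup.mk_mul, hcc]
      rfl
    have h1 := (Subgroup.zpowers (QuotientGroup.mk c : X ⧸ Subgroup.center X)).card_mul_index
    have h2 := (Subgroup.center X).card_mul_index
    rw [hZ2, Subgroup.index, ← h1, hc'] at h2
    omega
  -- As t inverts c², it fixes the involution of ⟨c²⟩. That involution therefore lies in M ∩ C(t),
  -- the center, and generates it.
  · obtain ⟨d, hd⟩ := exists_prime_orderOf_dvd_card' 2 (G := Subgroup.zpowers (c * c)) (by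
      rcases (hX.to_subgroup (Subgroup.zpowers (c * c))).card_eq_or_dvd with h | h
      · rw [Subgroup.card_eq_one, Subgroup.zpowers_eq_bot] at h
        exact absurd h hcc
      · exact h)
    obtain ⟨⟨_, i, rfl⟩, hd⟩ : ∃ d : Subgroup.zpowers (c * c), orderOf d = 2 := ⟨d, hd⟩
    have hd' : orderOf ((c * c) ^ i) = 2 := by rw [← Subgroup.orderOf_coe] at hd; exact hd
    have hdd : (c * c) ^ i * (c * c) ^ i = 1 := by
      rw [← pow_two, ← hd', pow_orderOf_eq_one]
    have hdc : t * (c * c) ^ i * t⁻¹ = (c * c) ^ i := by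
      rw [← conj_zpow, hc2, inv_zpow, inv_eq_of_mul_eq_one_left hdd]
    have hdZ : (c * c) ^ i ∈ Subgroup.center X := by
      rw [← hMC]
      refine ⟨zpow_mem (mul_mem hcM hcM) i, hCmem.2 ?_⟩
      rw [mul_inv_eq_iff_eq_mul] at hdc
      exact hdc.symm
    have heq : Subgroup.zpowers ((c * c) ^ i) = Subgroup.center X :=
      Subgroup.eq_of_le_of_card_ge (Subgroup.zpowers_le.2 hdZ) (by
        rw [hZ2, Nat.card_zpowers, hd'])
    apply hZc
    rw [← heq, Subgroup.zpowers_le]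
    exact zpow_mem (mul_mem (Subgroup.mem_zpowers c) (Subgroup.mem_zpowers c)) i

/-- For a generator c of the cyclic subgroup of index 2, c · tct⁻¹ lies in ⟨c⟩ and is fixed by t. As
⟨c⟩ ∩ C(t) has order at most 2, that product is 1 or the involution of ⟨c⟩; these are the two cases.
-/
theorem dihedral_or_semidihedral {X : Type*} [Group X] [Finite X] (hX : IsPGroup 2 X) (t : X)
    (ht : t * t = 1) (htz : t ∉ Subgroup.center X)
    (hcent : Nat.card (Subgroup.centralizer {t}) ≤ 4) :
    IsDihedralTwoGroup X ∨ IsSemidihedral X := by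
  have : Fact (Nat.Prime 2) := ⟨Nat.prime_two⟩
  obtain ⟨s, hst⟩ : ∃ s, s * t ≠ t * s := by
    by_contra! h
    exact htz (Subgroup.mem_center_iff.2 h)
  have : Nontrivial X := ⟨s * t, t * s, hst⟩
  obtain ⟨c, hidx⟩ := exists_index_zpowers_eq_two hX t ht hcent
  obtain ⟨n, hn⟩ := IsPGroup.iff_orderOf.1 hX c
  have hcard : Nat.card X = 2 * 2 ^ n := by
    rw [← (Subgroup.zpowers c).card_mul_index, hidx, Nat.card_zpowers, hn, mul_comm]
  have hn2 : 2 ≤ n := by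
    by_contra! h
    have h1 := (Subgroup.centralizer {t}).card_mul_index
    have h2 : Nat.card (Subgroup.center X) < Nat.card (Subgroup.centralizer {t}) := by
      apply lt_of_le_of_ne (Subgroup.card_le_of_le (Subgroup.center_le_centralizer _))
      exact fun h => htz (Subgroup.eq_of_le_of_card_ge (Subgroup.center_le_centralizer _) h.ge ▸
        Subgroup.mem_centralizer_singleton_iff.2 rfl)
    have h3 := (Subgroup.center X).one_lt_card_iff_ne_bot.2 (hX.bot_lt_center.ne')
    have h4 : (Subgroup.centralizer {t}).index ≠ 1 := fun h => by
      rw [Subgroup.index_eq_one] at h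
      exact hst (Subgroup.mem_centralizer_singleton_iff.1 (h ▸ Subgroup.mem_top s))
    have h5 : Nat.card X ≤ 4 := by
      rw [hcard, ← pow_succ']
      exact Nat.pow_le_pow_right (n := 2) (by norm_num) (by omega : n + 1 ≤ 2)
    have h6 : 0 < (Subgroup.centralizer {t}).index :=
      Nat.pos_of_ne_zero Subgroup.index_ne_zero_of_finite
    nlinarith [(by omega : 2 ≤ (Subgroup.centralizer {t}).index)]
  obtain ⟨m, rfl⟩ : ∃ m, n = m + 1 := ⟨n - 1, by omega⟩
  have hinv : ∀ x ∈ Subgroup.zpowers c, x * x = 1 → x = 1 ∨ x = c ^ 2 ^ m := by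
    rintro _ ⟨i, rfl⟩ h
    simp only at h
    rw [← zpow_add, ← orderOf_dvd_iff_zpow_eq_one, hn] at h
    have h2 : (2 ^ m : ℤ) ∣ i := by
      rw [← two_mul] at h
      push_cast at h
      rw [pow_succ'] at h
      exact (mul_dvd_mul_iff_left two_ne_zero).1 h
    obtain ⟨j, rfl⟩ := h2
    have hc1 : c ^ (2 ^ (m + 1) : ℤ) = 1 := by
      have := pow_orderOf_eq_one c
      rw [hn] at this
      exact_mod_cast this
    rcases Int.even_or_odd' j with ⟨l, rfl | rfl⟩
    · left
      rw [show (2 ^ m * (2 * l) : ℤ) = 2 ^ (m + 1) * l by ring]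
      simp only [zpow_mul, hc1, one_zpow]
    · right
      rw [show (2 ^ m * (2 * l + 1) : ℤ) = 2 ^ (m + 1) * l + 2 ^ m by ring]
      simp only [zpow_add, zpow_mul, hc1, one_zpow, one_mul]
      exact_mod_cast rfl
  have hK : (Subgroup.zpowers c).Normal := Subgroup.normal_of_index_eq_two hidx
  have ht1 : t ≠ 1 := fun h => htz (h ▸ one_mem _)
  -- The only involution of the normal cyclic subgroup ⟨c⟩ is central, whereas t is not.
  have htK : t ∉ Subgroup.zpowers c := by
    intro h
    have h2 : s * t * s⁻¹ * (s * t * s⁻¹) = 1 := by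
      rw [show s * t * s⁻¹ * (s * t * s⁻¹) = s * (t * t) * s⁻¹ by group, ht]; group
    rcases hinv t h ht with h1 | h1
    · exact ht1 h1
    rcases hinv _ (hK.conj_mem t h s) h2 with h3 | h3
    · rw [mul_inv_eq_one, mul_eq_left] at h3
      exact ht1 h3
    · rw [← h1, mul_inv_eq_iff_eq_mul] at h3
      exact hst h3
  have htinv : t⁻¹ = t := inv_eq_of_mul_eq_one_left ht
  have htc := hK.conj_mem c (Subgroup.mem_zpowers c) t
  have hcomm : c * (t * c * t⁻¹) = (t * c * t⁻¹) * c := by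
    obtain ⟨i, hi⟩ := htc
    simp only at hi
    rw [← hi, ← zpow_one_add, ← zpow_add_one, add_comm]
  have hw : c * (t * c * t⁻¹) ∈ Subgroup.zpowers c ⊓ Subgroup.centralizer {t} := by
    refine ⟨mul_mem (Subgroup.mem_zpowers c) htc, Subgroup.mem_centralizer_singleton_iff.2 ?_⟩
    calc c * (t * c * t⁻¹) * t = c * t * c := by group
      _ = (t * t) * c * t⁻¹ * c := by rw [ht, one_mul, htinv]
      _ = t * ((t * c * t⁻¹) * c) := by group
      _ = _ := by rw [hcomm]
  have hwcard := card_le_two_of_le_centralizer hcent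
    (inf_le_right : Subgroup.zpowers c ⊓ Subgroup.centralizer {t} ≤ _) (fun h => htK h.1)
  have hww : c * (t * c * t⁻¹) * (c * (t * c * t⁻¹)) = 1 := by
    have h1 : (⟨_, hw⟩ : (Subgroup.zpowers c ⊓ Subgroup.centralizer {t} : Subgroup X)) ^
        Nat.card (Subgroup.zpowers c ⊓ Subgroup.centralizer {t} : Subgroup X) = 1 := pow_card_eq_one'
    have h2 : 0 < Nat.card (Subgroup.zpowers c ⊓ Subgroup.centralizer {t} : Subgroup X) :=
      Nat.card_pos
    generalize Nat.card (Subgroup.zpowers c ⊓ Subgroup.centralizer {t} : Subgroup X) = q at *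
    interval_cases q
    · have := congrArg Subtype.val h1
      rw [pow_one] at this
      change c * (t * c * t⁻¹) = 1 at this
      rw [this, mul_one]
    · rw [pow_two] at h1
      exact congrArg Subtype.val h1
  rcases hinv _ hw.1 hww with h1 | h1
  · left
    refine ⟨m + 1, hn2, ?_⟩
    have : NeZero (2 ^ (m + 1)) := ⟨by positivity⟩
    exact nonempty_mulEquiv_dihedralGroup hn htK ht (eq_inv_of_mul_eq_one_right h1) hcard
  · right
    have h2 : t * c * t⁻¹ = c ^ ((-1 : ℤ) + 2 ^ (m + 1 - 1)) := by
      rw [zpow_add, zpow_neg_one, eq_inv_mul_iff_mul_eq, h1, Nat.add_sub_cancel]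
      exact_mod_cast rfl
    refine ⟨m + 1, ?_, nonempty_mulEquiv_semidihedral (by rw [← hn, pow_orderOf_eq_one]) hidx htK
      (by rw [pow_two, ht]) h2 hcard⟩
    -- For ⟨c⟩ of order 4 the exponent -1 + 2 is 1, so t would commute with c and be central.
    by_contra! hm
    obtain rfl : m = 1 := by omega
    have h3 : t * c * t⁻¹ = c := by rw [h2]; norm_num
    have h4 := Subgroup.eq_top_of_index_two_le (H := Subgroup.centralizer {t}) hidx
      (Subgroup.zpowers_le.2 (Subgroup.mem_centralizer_singleton_iff.2
        (mul_inv_eq_iff_eq_mul.1 h3).symm)) htK (Subgroup.mem_centralizer_singleton_iff.2 rfl)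
    exact hst (Subgroup.mem_centralizer_singleton_iff.1 (h4 ▸ Subgroup.mem_top s))

/-! ### Homocyclic subgroups of rank two and the final trichotomy -/

/-- Two elements `x`, `y` of an abelian `2`-group `Q` whose `2 ^ a`-th powers are distinct
involutions generating all involutions of `Q` form a basis of `Q`. -/
theorem zpow_dvd_of_mul_eq_one {X : Type*} [Group X] {x y : X} (hxy : Commute x y) {a : ℕ}
    (hx2 : x ^ 2 ^ (a + 1) = 1) (hy2 : y ^ 2 ^ (a + 1) = 1) (hx : x ^ 2 ^ a ≠ 1)
    (hy : y ^ 2 ^ a ≠ 1) (hne : x ^ 2 ^ a ≠ y ^ 2 ^ a) {i j : ℤ} (h : x ^ i * y ^ j = 1) :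
    (2 ^ (a + 1) : ℤ) ∣ i ∧ (2 ^ (a + 1) : ℤ) ∣ j := by
  have key : ∀ k ≤ a + 1, (2 ^ k : ℤ) ∣ i ∧ (2 ^ k : ℤ) ∣ j := by
    intro k
    induction k with
    | zero => simp
    | succ k ih =>
      intro hk
      obtain ⟨⟨i', rfl⟩, ⟨j', rfl⟩⟩ := ih (by omega)
      have hkk : (2 ^ k * 2 ^ (a - k) : ℤ) = 2 ^ a := by rw [← pow_add]; congr 1; omega
      have h1 : (x ^ 2 ^ a) ^ i' * (y ^ 2 ^ a) ^ j' = 1 := by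
        have h2 : (x ^ (2 ^ k * i' : ℤ) * y ^ (2 ^ k * j' : ℤ)) ^ (2 ^ (a - k) : ℤ) = 1 := by
          rw [h, one_zpow]
        rw [(hxy.zpow_zpow _ _).mul_zpow, ← zpow_mul, ← zpow_mul, mul_right_comm, hkk,
          mul_right_comm, hkk, zpow_mul, zpow_mul] at h2
        exact_mod_cast h2
      have hsq : ∀ {u : X}, u ^ 2 ^ (a + 1) = 1 → ∀ l : ℤ,
          (u ^ 2 ^ a) ^ (2 * l) = 1 ∧ (u ^ 2 ^ a) ^ (2 * l + 1) = u ^ 2 ^ a := fun {u} hu l => by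
        have h3 : (u ^ 2 ^ a) ^ (2 * l) = 1 := by
          rw [zpow_mul]
          have : (u ^ 2 ^ a) ^ (2 : ℤ) = 1 := by
            rw [zpow_ofNat, ← pow_mul, ← pow_succ, hu]
          rw [this, one_zpow]
        exact ⟨h3, by rw [zpow_add_one, h3, one_mul]⟩
      rcases Int.even_or_odd' i' with ⟨l, rfl | rfl⟩ <;>
        rcases Int.even_or_odd' j' with ⟨m, rfl | rfl⟩
      · exact ⟨⟨l, by ring⟩, ⟨m, by ring⟩⟩
      · rw [(hsq hx2 l).1, (hsq hy2 m).2, one_mul] at h1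
        exact absurd h1 hy
      · rw [(hsq hx2 l).2, (hsq hy2 m).1, mul_one] at h1
        exact absurd h1 hx
      · rw [(hsq hx2 l).2, (hsq hy2 m).2] at h1
        refine absurd (mul_right_cancel (b := y ^ 2 ^ a) ?_) hne
        rw [h1, ← pow_add, ← two_mul, ← pow_succ', hy2]
  exact key _ le_rfl

/-- Induction on the order of q: its involution is a 2^a-th power of some xⁱyʲ, and dividing q by
the matching smaller power of xⁱyʲ lowers the exponent. -/
theorem exists_eq_zpow_mul_zpow {X : Type*} [Group X] {Q : Subgroup X}
    (hQ : ∀ x ∈ Q, ∀ y ∈ Q, x * y = y * x) {x y : X} (hx : x ∈ Q) (hy : y ∈ Q) {a : ℕ}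
    (hinv : ∀ v ∈ Q, v * v = 1 → ∃ i j : ℕ, v = (x ^ i * y ^ j) ^ 2 ^ a)
    {q : X} (hq : q ∈ Q) (hqa : q ^ 2 ^ (a + 1) = 1) : ∃ i j : ℤ, q = x ^ i * y ^ j := by
  have key : ∀ k ≤ a + 1, ∀ q ∈ Q, q ^ 2 ^ k = 1 → ∃ i j : ℤ, q = x ^ i * y ^ j := by
    intro k
    induction k with
    | zero => exact fun _ q _ h => ⟨0, 0, by simpa using h⟩
    | succ k ih =>
      intro hk q hq hqk
      obtain ⟨i, j, hij⟩ := hinv (q ^ 2 ^ k) (pow_mem hq _)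
        (by rw [← pow_add, ← two_mul, ← pow_succ', hqk])
      set h := (x ^ i * y ^ j) ^ 2 ^ (a - k) with hdef
      have hh : h ∈ Q := pow_mem (mul_mem (pow_mem hx _) (pow_mem hy _)) _
      have hxyc : Commute x y := hQ x hx y hy
      have hpow : h ^ 2 ^ k = q ^ 2 ^ k := by
        rw [hij, hdef, ← pow_mul, ← pow_add]
        congr 2
        omega
      have hqh : Commute q h⁻¹ := hQ q hq _ (inv_mem hh)
      obtain ⟨i', j', e⟩ := ih (by omega) (q * h⁻¹) (mul_mem hq (inv_mem hh))
        (by rw [hqh.mul_pow, inv_pow, hpow, mul_inv_cancel])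
      refine ⟨i' + i * 2 ^ (a - k), j' + j * 2 ^ (a - k), ?_⟩
      rw [mul_inv_eq_iff_eq_mul] at e
      rw [e, hdef, (hxyc.pow_pow i j).mul_pow, zpow_add, zpow_add, mul_assoc, mul_assoc]
      congr 1
      rw [← mul_assoc (x ^ ((i : ℤ) * 2 ^ (a - k))), (hxyc.zpow_zpow _ j').eq, mul_assoc]
      congr 1
      rw [zpow_mul, zpow_mul]
      norm_cast
  exact key _ le_rfl q hq hqa

/-- Q is abelian by `InvolutionAction.commute`. If it is elementary, it is the centralizer of a
noncentral involution and has order 4. Otherwise, transitivity of α on involutions makes Q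
homocyclic, and τ exchanges the elements of a suitable basis. -/
theorem InvolutionAction.dihedral_or_semidihedral_or_wreathed {X : Type*} [Group X] [Finite X]
    (hX : IsPGroup 2 X) {Q : Subgroup X} {α σ : Q →* Q} (d : InvolutionAction α σ)
    (hQ : ∀ g : X, (∀ v ∈ Q, v * v = 1 → g * v = v * g) → g ∈ Q) {z : X} (hzQ : z ∈ Q)
    (hzz : z * z = 1) (hz1 : z ≠ 1) (hzc : ∀ g, g * z = z * g) {τ : X} (hτQ : τ ∉ Q)
    (hτ : ∀ v ∈ Q, v * v = 1 → τ * v * τ⁻¹ ∈ Q) :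
    IsDihedralTwoGroup X ∨ IsSemidihedral X ∨ IsWreathed X := by
  have : Fact (Nat.Prime 2) := ⟨Nat.prime_two⟩
  have hcomm : ∀ x ∈ Q, ∀ y ∈ Q, x * y = y * x := fun x hx y hy =>
    congrArg Subtype.val (d.commute ⟨x, hx⟩ ⟨y, hy⟩)
  have hconj2 : ∀ {g v : X}, v * v = 1 → g * v * g⁻¹ * (g * v * g⁻¹) = 1 := fun {g v} hv => by
    rw [show g * v * g⁻¹ * (g * v * g⁻¹) = g * (v * v) * g⁻¹ by group, hv]; group
  -- the involutions of `Q`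
  obtain ⟨w, hwQ, hww, hw1, hwz⟩ : ∃ w ∈ Q, w * w = 1 ∧ w ≠ 1 ∧ w ≠ z := by
    by_contra! h
    apply hτQ
    refine hQ τ fun v hv hvv => ?_
    by_cases hv1 : v = 1
    · rw [hv1, mul_one, one_mul]
    · rw [h v hv hvv hv1, hzc]
  have hzw : z * w = w * z := (hzc w).symm
  have hzw2 : z * w * (z * w) = 1 := by
    rw [mul_assoc, ← mul_assoc w, ← hzw, mul_assoc z w w, hww, mul_one, hzz]
  have hV : ∀ v ∈ Q, v * v = 1 → v = 1 ∨ v = z ∨ v = w ∨ v = z * w := by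
    intro v hv hvv
    by_contra! h
    obtain ⟨h1, h2, h3, h4⟩ := h
    have hzw1 : z * w ≠ 1 := fun h => hwz (mul_left_cancel (h.trans hzz.symm))
    have : Fintype {v : Q // v * v = 1} := Fintype.ofFinite _
    classical
    have hc := Finset.card_le_univ ({⟨1, one_mul 1⟩, ⟨⟨z, hzQ⟩, Subtype.ext hzz⟩,
      ⟨⟨w, hwQ⟩, Subtype.ext hww⟩, ⟨⟨z * w, mul_mem hzQ hwQ⟩, Subtype.ext hzw2⟩,
      ⟨⟨v, hv⟩, Subtype.ext hvv⟩} : Finset {v : Q // v * v = 1})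
    rw [← Nat.card_eq_fintype_card, d.card,
      Finset.card_insert_of_notMem (by
        simp [Subtype.ext_iff, hz1.symm, hw1.symm, hzw1.symm, h1.symm]),
      Finset.card_insert_of_notMem (by simp [Subtype.ext_iff, hwz.symm, hw1, h2.symm]),
      Finset.card_insert_of_notMem (by simp [Subtype.ext_iff, hz1, h3.symm]),
      Finset.card_insert_of_notMem (by simp [Subtype.ext_iff, h4.symm]),
      Finset.card_singleton] at hc
    omega
  have hQiff : ∀ g : X, g * w * g⁻¹ = w → g ∈ Q := by
    intro g hg
    have hg' := mul_inv_eq_iff_eq_mul.1 hg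
    refine hQ g fun v hv hvv => ?_
    rcases hV v hv hvv with rfl | rfl | rfl | rfl
    · simp
    · exact hzc g
    · exact hg'
    · rw [← mul_assoc, hzc g, mul_assoc, hg', mul_assoc]
  have hnorm : ∀ g : X, g * w * g⁻¹ ∈ Q → g * w * g⁻¹ = w ∨ g * w * g⁻¹ = z * w := by
    intro g hg
    rcases hV _ hg (hconj2 hww) with h | h | h | h
    · rw [mul_inv_eq_one, mul_eq_left] at h
      exact absurd h hw1
    · rw [mul_inv_eq_iff_eq_mul, ← hzc] at h
      exact absurd (mul_left_cancel h) hwz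
    · exact Or.inl h
    · exact Or.inr h
  have hτw : τ * w * τ⁻¹ = z * w := (hnorm τ (hτ w hwQ hww)).resolve_left fun h => hτQ (hQiff τ h)
  have hτnorm : ∀ g : X, g * w * g⁻¹ ∈ Q → g ∉ Q → τ⁻¹ * g ∈ Q := by
    intro g hg hgQ
    have h := (hnorm g hg).resolve_left fun h => hgQ (hQiff g h)
    refine hQiff _ ?_
    calc τ⁻¹ * g * w * (τ⁻¹ * g)⁻¹ = τ⁻¹ * (g * w * g⁻¹) * τ := by group
      _ = τ⁻¹ * (τ * w * τ⁻¹) * τ := by rw [h, hτw]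
      _ = w := by group
  have hττ : τ * τ ∈ Q := by
    refine hQiff _ ?_
    calc τ * τ * w * (τ * τ)⁻¹ = τ * (τ * w * τ⁻¹) * τ⁻¹ := by group
      _ = (τ * z) * w * τ⁻¹ := by rw [hτw]; group
      _ = z * (τ * w * τ⁻¹) := by rw [hzc]; group
      _ = (z * z) * w := by rw [hτw]; group
      _ = w := by rw [hzz, one_mul]
  have hτQQ : ∀ q ∈ Q, τ * q * τ⁻¹ ∈ Q := by
    intro q hq
    refine hQ _ fun v hv hvv => ?_
    have hv' : τ⁻¹ * v * τ ∈ Q := by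
      have h := hτ _ (mul_mem (mul_mem (inv_mem hττ) hv) hττ) (by
        have := hconj2 (g := (τ * τ)⁻¹) hvv
        rwa [inv_inv] at this)
      have e : τ * ((τ * τ)⁻¹ * v * (τ * τ)) * τ⁻¹ = τ⁻¹ * v * τ := by group
      rwa [e] at h
    calc τ * q * τ⁻¹ * v = τ * (q * (τ⁻¹ * v * τ)) * τ⁻¹ := by group
      _ = τ * ((τ⁻¹ * v * τ) * q) * τ⁻¹ := by rw [hcomm q hq _ hv']
      _ = _ := by group
  by_cases hQ2 : ∀ q ∈ Q, q * q = 1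
  · have hcent : Subgroup.centralizer {w} = Q := by
      ext g
      rw [Subgroup.mem_centralizer_singleton_iff]
      exact ⟨fun h => hQiff g (mul_inv_eq_iff_eq_mul.2 h), fun h => hcomm g h w hwQ⟩
    have hcard : Nat.card (Subgroup.centralizer {w}) = 4 := by
      rw [hcent, ← d.card]
      exact Nat.card_congr (Equiv.subtypeUnivEquiv (p := fun v : Q => v * v = 1)
        fun q => Subtype.ext (hQ2 q q.2)).symm
    have hwc : w ∉ Subgroup.center X := fun h =>
      hτQ (hQiff τ (mul_inv_eq_iff_eq_mul.2 (Subgroup.mem_center_iff.1 h τ)))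
    rcases dihedral_or_semidihedral hX w hww hwc hcard.le with h | h
    · exact Or.inl h
    · exact Or.inr (Or.inl h)
  right; right
  -- the exponent of `Q`
  obtain ⟨a, ha, hmax⟩ : ∃ a, (∀ q ∈ Q, q ^ 2 ^ (a + 1) = 1) ∧ ∃ q ∈ Q, q ^ 2 ^ a ≠ 1 := by
    classical
    have hex : ∃ n, ∀ q ∈ Q, q ^ 2 ^ n = 1 := by
      obtain ⟨n, hn⟩ := IsPGroup.iff_card.1 (hX.to_subgroup Q)
      refine ⟨n, fun q hq => ?_⟩
      rw [← hn]
      exact congrArg Subtype.val (pow_card_eq_one' (x := (⟨q, hq⟩ : Q)))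
    have h0 : Nat.find hex ≠ 0 := fun h => by
      have := Nat.find_spec hex
      rw [h] at this
      exact hz1 (by simpa using this z hzQ)
    obtain ⟨a, ha⟩ := Nat.exists_eq_succ_of_ne_zero h0
    refine ⟨a, by rw [← Nat.succ_eq_add_one, ← ha]; exact Nat.find_spec hex, ?_⟩
    have := Nat.find_min hex (m := a) (by omega)
    push Not at this
    exact this
  have hsqa : ∀ q ∈ Q, q ^ 2 ^ a * q ^ 2 ^ a = 1 := fun q hq => by
    rw [← pow_add, ← two_mul, ← pow_succ', ha q hq]
  obtain ⟨b, rfl⟩ : ∃ b, a = b + 1 := by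
    refine ⟨a - 1, (Nat.succ_pred_eq_of_ne_zero fun h => hQ2 fun q hq => ?_).symm⟩
    have := hsqa q hq
    rwa [h, pow_zero, pow_one] at this
  -- Some involution is a 2^(b+1)-th power by the choice of exponent. Since α is transitive on
  -- involutions, w is one too.
  obtain ⟨x, hxQ, hxw⟩ : ∃ x ∈ Q, x ^ 2 ^ (b + 1) = w := by
    obtain ⟨q, hq, hq1⟩ := hmax
    have hmem : (⟨q, hq⟩ : Q) ^ 2 ^ (b + 1) ∈ centralInvolutions Q :=
      (d.mem_iff _).2 (Subtype.ext (hsqa q hq))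
    rcases d.cases (v := ⟨w, hwQ⟩) ((d.mem_iff _).2 (Subtype.ext hww)) hmem
      (fun h => hq1 (congrArg Subtype.val h)) with h | h | h | h
    · exact absurd (congrArg Subtype.val h) hw1
    · exact ⟨q, hq, (congrArg Subtype.val h).symm⟩
    · rw [map_pow] at h
      exact ⟨_, (α ⟨q, hq⟩).2, (congrArg Subtype.val h).symm⟩
    · rw [map_pow, map_pow] at h
      exact ⟨_, (α (α ⟨q, hq⟩)).2, (congrArg Subtype.val h).symm⟩
  set y := τ * x * τ⁻¹ with hy
  have hyQ : y ∈ Q := hτQQ x hxQ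
  have hyw : y ^ 2 ^ (b + 1) = z * w := by rw [hy, conj_pow, hxw, hτw]
  have hxy : Commute x y := hcomm x hxQ y hyQ
  have hzw1 : z * w ≠ 1 := fun h => hwz (mul_left_cancel (h.trans hzz.symm))
  have hdvd : ∀ {i j : ℤ}, x ^ i * y ^ j = 1 →
      (2 ^ (b + 1 + 1) : ℤ) ∣ i ∧ (2 ^ (b + 1 + 1) : ℤ) ∣ j := fun h =>
    zpow_dvd_of_mul_eq_one hxy (ha x hxQ) (ha y hyQ) (by rwa [hxw]) (by rwa [hyw])
      (by rw [hxw, hyw]; exact fun h => hz1 (right_eq_mul.1 h)) h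
  have hgen : ∀ q ∈ Q, ∃ i j : ℤ, q = x ^ i * y ^ j := fun q hq => by
    refine exists_eq_zpow_mul_zpow hcomm hxQ hyQ (a := b + 1) (fun v hv hvv => ?_) hq (ha q hq)
    rcases hV v hv hvv with rfl | rfl | rfl | rfl
    · exact ⟨0, 0, by simp⟩
    · refine ⟨1, 1, ?_⟩
      rw [pow_one, pow_one, hxy.mul_pow, hxw, hyw, hzw, ← mul_assoc, hww, one_mul]
    · exact ⟨1, 0, by simp [hxw]⟩
    · exact ⟨0, 1, by simp [hyw]⟩
  have hτy : τ * y * τ⁻¹ = x := by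
    calc τ * y * τ⁻¹ = (τ * τ) * x * (τ * τ)⁻¹ := by rw [hy]; group
      _ = x := by rw [hcomm _ hττ x hxQ]; group
  have hτconj : ∀ i j : ℤ, τ * (x ^ i * y ^ j) * τ⁻¹ = y ^ i * x ^ j := fun i j => by
    calc τ * (x ^ i * y ^ j) * τ⁻¹ = (τ * x ^ i * τ⁻¹) * (τ * y ^ j * τ⁻¹) := by group
      _ = _ := by rw [← conj_zpow, ← conj_zpow, hτy, ← hy]
  -- a complement to `Q`
  obtain ⟨t, htQ, htt, htx⟩ : ∃ t, t ∉ Q ∧ t ^ 2 = 1 ∧ t * x * t⁻¹ = y := by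
    obtain ⟨i, j, hij⟩ := hgen _ hττ
    have h1 : x ^ i * y ^ j = y ^ i * x ^ j := by rw [← hτconj, ← hij]; group
    have h2 : x ^ (i - j) * y ^ (j - i) = 1 := by
      rw [zpow_sub, zpow_sub, mul_assoc, ← mul_assoc (x ^ j)⁻¹, (hxy.zpow_zpow j j).inv_left.eq,
        ← mul_assoc, ← mul_assoc, h1]
      group
    have h3 : y ^ j = y ^ i := by
      obtain ⟨l, hl⟩ := (hdvd h2).2
      rw [show j = i + 2 ^ (b + 1 + 1) * l by omega, zpow_add, zpow_mul]
      have : y ^ (2 ^ (b + 1 + 1) : ℤ) = 1 := by exact_mod_cast ha y hyQ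
      rw [this, one_zpow, mul_one]
    -- τ² is fixed by τ, so its coordinates agree and τ² = xⁱyⁱ. Then (τx⁻ⁱ)² = y⁻ⁱ τ² x⁻ⁱ = 1.
    refine ⟨τ * x ^ (-i), fun h => hτQ ?_, ?_, ?_⟩
    · exact (mul_mem_cancel_right (zpow_mem hxQ _)).1 h
    · have h4 := hτconj (-i) 0
      rw [zpow_zero, zpow_zero, mul_one, mul_one] at h4
      rw [pow_two]
      calc τ * x ^ (-i) * (τ * x ^ (-i)) = (τ * x ^ (-i) * τ⁻¹) * (τ * τ) * x ^ (-i) := by group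
        _ = y ^ (-i) * ((x ^ i * y ^ i) * x ^ (-i)) := by rw [h4, hij, h3]; group
        _ = y ^ (-i) * ((y ^ i * x ^ i) * x ^ (-i)) := by rw [(hxy.zpow_zpow i i).eq]
        _ = 1 := by group
    · rw [hy]
      group
  -- the normalizer of the involutions of `Q` is everything
  let N : Subgroup X := Subgroup.normalizer (Q : Set X)
  have hNmem : ∀ {g}, g ∈ N → g ∈ Q ∨ τ⁻¹ * g ∈ Q := fun {g} hg => by
    by_cases hgQ : g ∈ Q
    · exact Or.inl hgQ
    · exact Or.inr (hτnorm g ((Subgroup.mem_normalizer_iff.1 hg w).1 hwQ) hgQ)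
  have hNsq : ∀ {g}, g ∈ N → g * g ∈ Q := fun {g} hg => by
    rcases hNmem hg with h | h
    · exact mul_mem h h
    · have h1 := mul_mem (mul_mem (hτQQ _ h) hττ) h
      have e : τ * (τ⁻¹ * g) * τ⁻¹ * (τ * τ) * (τ⁻¹ * g) = g * g := by group
      rwa [e] at h1
  have hQN : Q ≤ N := Subgroup.le_normalizer
  have hNtop : N = ⊤ := by
    by_contra hne
    have := hX.isNilpotent
    have hlt := (Group.normalizerCondition_of_isNilpotent (G := X)) N (lt_top_iff_ne_top.2 hne)
    obtain ⟨g, hg, hgN⟩ := SetLike.exists_of_lt hlt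
    have hgc : ∀ n ∈ N, g * n * g⁻¹ ∈ N := fun n hn => (Subgroup.mem_normalizer_iff.1 hg n).1 hn
    -- g u g⁻¹ lies in N, and squares of elements of N lie in Q. The exponent 2^(b+1) is even
    -- because Q is not elementary.
    have hpow : ∀ u ∈ Q, g * u ^ 2 ^ (b + 1) * g⁻¹ ∈ Q := by
      intro u hu
      have h := pow_mem (hNsq (hgc u (hQN hu))) (2 ^ b)
      rw [← pow_two, ← pow_mul, ← pow_succ', conj_pow] at h
      exact h
    have hgw : g * w * g⁻¹ ∈ Q := by
      have := hpow x hxQ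
      rwa [hxw] at this
    apply hgN
    by_cases hgQ : g ∈ Q
    · exact hQN hgQ
    · have h1 := hτnorm g hgw hgQ
      have hτN : τ ∈ N := by
        rw [Subgroup.mem_normalizer_iff]
        intro h
        refine ⟨hτQQ h, fun hh => ?_⟩
        have h2 := mul_mem (mul_mem (inv_mem hττ) (hτQQ _ hh)) hττ
        have e : (τ * τ)⁻¹ * (τ * (τ * h * τ⁻¹) * τ⁻¹) * (τ * τ) = h := by group
        rwa [e] at h2
      have := mul_mem hτN (hQN h1)
      rwa [mul_inv_cancel_left] at this
  have hidx : Q.index = 2 := by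
    rw [Subgroup.index_eq_two_iff']
    refine ⟨τ⁻¹, fun g => ?_⟩
    rcases hNmem (hNtop ▸ Subgroup.mem_top g) with h | h
    · exact Or.inr ⟨h, fun h' => hτQ (inv_mem_iff.1 ((mul_mem_cancel_right h).1 h'))⟩
    · exact Or.inl ⟨h, fun h' => hτQ (inv_mem_iff.1 ((mul_mem_cancel_right h').1 h))⟩
  have hxpow := ha x hxQ
  have hypow := ha y hyQ
  have hcardQ : Nat.card Q = 2 ^ (b + 2) * 2 ^ (b + 2) := by
    have : NeZero (2 ^ (b + 2)) := ⟨by positivity⟩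
    let f : ZMod (2 ^ (b + 2)) × ZMod (2 ^ (b + 2)) → Q := fun p =>
      ⟨x ^ (p.1.cast : ℤ) * y ^ (p.2.cast : ℤ), mul_mem (zpow_mem hxQ _) (zpow_mem hyQ _)⟩
    have hf : Function.Bijective f := by
      constructor
      · rintro ⟨i, j⟩ ⟨i', j'⟩ h
        have h1 : x ^ (i.cast : ℤ) * y ^ (j.cast : ℤ) = x ^ (i'.cast : ℤ) * y ^ (j'.cast : ℤ) :=
          congrArg Subtype.val h
        have h2 : x ^ (i.cast - i'.cast : ℤ) * y ^ (j.cast - j'.cast : ℤ) = 1 := by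
          rw [sub_eq_neg_add, zpow_add, zpow_sub, mul_assoc, ← mul_assoc _ (y ^ _), h1]
          group
        obtain ⟨h3, h4⟩ := hdvd h2
        have hcast : ∀ {i i' : ZMod (2 ^ (b + 2))},
            (2 ^ (b + 1 + 1) : ℤ) ∣ (i.cast - i'.cast : ℤ) → i = i' := fun {i i'} h => by
          have h5 := (ZMod.intCast_eq_intCast_iff_dvd_sub (i'.cast : ℤ) (i.cast : ℤ)
            (2 ^ (b + 2))).2 (by exact_mod_cast h)
          simpa using h5.symm
        rw [hcast h3, hcast h4]
      · rintro ⟨q, hq⟩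
        obtain ⟨i, j, rfl⟩ := hgen q hq
        refine ⟨(i, j), Subtype.ext ?_⟩
        change x ^ (((i : ZMod (2 ^ (b + 2))).cast : ℤ)) *
          y ^ (((j : ZMod (2 ^ (b + 2))).cast : ℤ)) = _
        rw [zpow_eq_zpow_of_cast_eq hxpow (a := ((i : ZMod (2 ^ (b + 2))).cast : ℤ)) (b := i)
            (by simp),
          zpow_eq_zpow_of_cast_eq hypow (a := ((j : ZMod (2 ^ (b + 2))).cast : ℤ)) (b := j)
            (by simp)]
    rw [← Nat.card_eq_of_bijective f hf, Nat.card_prod, Nat.card_zmod]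
  refine ⟨b + 2, by omega, nonempty_mulEquiv_wreathed (K := Q) hxpow hypow htt hxy htx
    (fun H hx hy q hq => ?_) hidx htQ ?_⟩
  · obtain ⟨i, j, rfl⟩ := hgen q hq
    exact mul_mem (zpow_mem hx i) (zpow_mem hy j)
  · rw [← Q.card_mul_index, hidx, hcardQ, mul_comm]

/-! ### Involutions in a 2-group of rank two -/

theorem card_le_two_pow_elemRank {P : Type*} [Group P] [Finite P] (hP : IsPGroup 2 P)
    {E : Subgroup P} (hE : IsElemAbelian 2 E) : Nat.card E ≤ 2 ^ elemRank P := by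
  have : Fact (Nat.Prime 2) := ⟨Nat.prime_two⟩
  -- Since d < p^d ≤ |P|, the sets are bounded. On an unbounded set of naturals `sSup` would be 0
  -- and give no information.
  have hbound : ∀ p : ℕ, p.Prime →
      Nat.card P ∈ upperBounds {d : ℕ | ∃ E : Subgroup P, IsElemAbelian p E ∧ Nat.card E = p ^ d} := by
    rintro p hp d ⟨E, -, hE⟩
    exact ((Nat.lt_pow_self hp.one_lt).le.trans hE.ge).trans (Subgroup.card_le_card_group E)
  obtain ⟨d, hd⟩ := IsPGroup.iff_card.1 (hP.to_subgroup E)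
  rw [hd]
  refine Nat.pow_le_pow_right two_pos ?_
  have h1 : d ≤ pRank 2 P := le_csSup ⟨_, hbound 2 Nat.prime_two⟩ ⟨E, hE, hd⟩
  refine h1.trans (le_csSup ⟨Nat.card P, ?_⟩ ⟨2, Nat.prime_two, rfl⟩)
  rintro _ ⟨p, hp, rfl⟩
  exact csSup_le' (hbound p hp)

theorem eq_of_commuting_involutions {P : Type*} [Group P] [Finite P] (hP : IsPGroup 2 P)
    (hrank : elemRank P = 2) {a b c : P} (ha : a * a = 1) (hb : b * b = 1) (hc : c * c = 1)
    (hab : a * b = b * a) (hca : c * a = a * c) (hcb : c * b = b * c) (ha1 : a ≠ 1) (hb1 : b ≠ 1)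
    (hne : a ≠ b) : c = 1 ∨ c = a ∨ c = b ∨ c = a * b := by
  by_contra! h
  obtain ⟨h1, h2, h3, h4⟩ := h
  have hself : ({a, b, c} : Set P) ⊆ Subgroup.centralizer {a, b, c} := by
    rintro x (rfl | rfl | rfl) <;> rintro y (rfl | rfl | rfl) <;> simp_all
  have hcomm : ∀ x ∈ Subgroup.closure {a, b, c}, ∀ y ∈ Subgroup.closure {a, b, c},
      x * y = y * x := fun x hx y hy =>
    (Subgroup.mem_centralizer_iff.1 (Subgroup.closure_le_centralizer_centralizer _ hx) y
      ((Subgroup.closure_le _).2 hself hy)).symm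
  have hE : IsElemAbelian 2 (Subgroup.closure {a, b, c}) := by
    refine ⟨hcomm, fun x hx => ?_⟩
    induction hx using Subgroup.closure_induction with
    | mem x hx => rcases hx with rfl | rfl | rfl <;> rwa [pow_two]
    | one => exact one_pow 2
    | mul x y hx hy ihx ihy => rw [Commute.mul_pow (hcomm x hx y hy), ihx, ihy, one_mul]
    | inv x hx ih => rw [inv_pow, ih, inv_one]
  have hcard := card_le_two_pow_elemRank hP hE
  rw [hrank] at hcard
  classical
  have hsub : ((({1, a, b, a * b, c} : Finset P) : Set P)) ⊆ Subgroup.closure {a, b, c} := by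
    have hma : a ∈ Subgroup.closure {a, b, c} := Subgroup.subset_closure (by simp)
    have hmb : b ∈ Subgroup.closure {a, b, c} := Subgroup.subset_closure (by simp)
    have hmc : c ∈ Subgroup.closure {a, b, c} := Subgroup.subset_closure (by simp)
    intro x hx
    simp only [Finset.coe_insert, Finset.coe_singleton, Set.mem_insert_iff,
      Set.mem_singleton_iff] at hx
    rcases hx with rfl | rfl | rfl | rfl | rfl
    exacts [one_mem _, hma, hmb, mul_mem hma hmb, hmc]
  have hle := Set.ncard_le_ncard hsub (Set.toFinite _)
  have hab1 : a * b ≠ 1 := fun h => hne (mul_right_cancel (h.trans hb.symm))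
  rw [Set.ncard_coe_finset, Finset.card_insert_of_notMem (by
      simp only [Finset.mem_insert, Finset.mem_singleton, not_or]
      exact ⟨ha1.symm, hb1.symm, hab1.symm, h1.symm⟩),
    Finset.card_insert_of_notMem (by simp [hne, hb1, h2.symm]),
    Finset.card_insert_of_notMem (by simp [ha1, h3.symm]),
    Finset.card_insert_of_notMem (by simp [h4.symm]), Finset.card_singleton,
    ← Nat.card_coe_set_eq] at hle
  exact absurd (hle.trans hcard) (by norm_num)

/-- Take n in the normalizer of C(t) but outside C(t). The conjugate of t by n is an involution
commuting with t and different from t; it cannot be the central element z, so it is zt. -/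
theorem exists_conj_eq_mul_of_isPGroup {X : Type*} [Group X] [Finite X] (hX : IsPGroup 2 X)
    {z t : X} (hz : ∀ g, g * z = z * g) (ht : t * t = 1) (htc : t ∉ Subgroup.center X)
    (hV : ∀ c, c * c = 1 → c * t = t * c → c = 1 ∨ c = z ∨ c = t ∨ c = z * t) :
    ∃ n, n * t * n⁻¹ = z * t := by
  have : Fact (Nat.Prime 2) := ⟨Nat.prime_two⟩
  have := hX.isNilpotent
  have hne : Subgroup.centralizer {t} ≠ ⊤ := fun h => htc <| Subgroup.mem_center_iff.2 fun g =>
    Subgroup.mem_centralizer_singleton_iff.1 (h ▸ Subgroup.mem_top g)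
  obtain ⟨n, hn, hnt⟩ := SetLike.exists_of_lt
    (Group.normalizerCondition_of_isNilpotent (G := X) _ (lt_top_iff_ne_top.2 hne))
  rw [Subgroup.mem_centralizer_singleton_iff, ← mul_inv_eq_iff_eq_mul] at hnt
  have hmem := Subgroup.mem_centralizer_singleton_iff.1
    ((Subgroup.mem_normalizer_iff.1 hn t).1 (Subgroup.mem_centralizer_singleton_iff.2 rfl))
  refine ⟨n, ?_⟩
  rcases hV (n * t * n⁻¹) (by rw [conj_mul, ht]; group) hmem with h | h | h | h
  · rw [mul_inv_eq_one, mul_eq_left] at h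
    exact absurd (h ▸ one_mem _) htc
  · rw [mul_inv_eq_iff_eq_mul, ← hz] at h
    rw [mul_left_cancel h] at htc
    exact absurd (Subgroup.mem_center_iff.2 hz) htc
  · exact absurd h hnt
  · exact h

/-! ### Sylow arguments and fusion of involutions -/

theorem Sylow.exists_conj_mem_map {G : Type*} [Group G] [Finite G] {p : ℕ} [Fact p.Prime]
    {H : Subgroup G} (P : Sylow p H) {R : Subgroup G} (hR : IsPGroup p R) (hle : R ≤ H) :
    ∃ c ∈ H, ∀ r ∈ R, MulAut.conj c r ∈ (P : Subgroup H).map H.subtype := by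
  obtain ⟨P', hP'⟩ := (hR.comap_subtype (K := H)).exists_le_sylow
  obtain ⟨c, hc⟩ := MulAction.exists_smul_eq H P' P
  refine ⟨c, c.2, fun r hr => ⟨c * ⟨r, hle hr⟩ * c⁻¹, ?_, rfl⟩⟩
  rw [← hc]
  exact Subgroup.smul_mem_pointwise_smul _ (MulAut.conj c) _ (hP' (Subgroup.mem_subgroupOf.2 hr))

theorem Sylow.exists_conj_mem {G : Type*} [Group G] [Finite G] {p : ℕ} [Fact p.Prime]
    {H : Subgroup G} (S : Sylow p G) (hS : (S : Subgroup G) ≤ H) {R : Subgroup G}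
    (hR : IsPGroup p R) (hle : R ≤ H) : ∃ c ∈ H, ∀ r ∈ R, MulAut.conj c r ∈ S := by
  obtain ⟨c, hc, h⟩ := (S.subtype hS).exists_conj_mem_map hR hle
  refine ⟨c, hc, fun r hr => ?_⟩
  obtain ⟨x, hx, hxr⟩ := h r hr
  rw [← hxr]
  exact Subgroup.mem_subgroupOf.1 hx

theorem exists_pow_conj_eq {G : Type*} [Group G] [Finite G] {a z v : G}
    (hz : MulAut.conj a z = v) (hv : MulAut.conj a v = z * v) (hzv : z * v = v * z)
    (hvv : v * v = 1) :
    ∃ m k, (a ^ m) ^ 3 ^ k = 1 ∧ MulAut.conj (a ^ m) z = v ∧ MulAut.conj (a ^ m) v = z * v := by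
  obtain ⟨k, m, hm, hkm⟩ := Nat.exists_eq_pow_mul_and_not_dvd (orderOf_pos a).ne' 3 (by norm_num)
  have hcube : ∀ j, MulAut.conj (a ^ (3 * j)) z = z ∧ MulAut.conj (a ^ (3 * j)) v = v := by
    intro j
    have h1 : MulAut.conj (a ^ 3) z = z := by
      rw [pow_succ, pow_two, map_mul, map_mul, MulAut.mul_apply, MulAut.mul_apply, hz, hv, map_mul,
        hz, hv, hzv, ← mul_assoc, hvv, one_mul]
    have h2 : MulAut.conj (a ^ 3) v = v := by
      rw [← hz, ← MulAut.mul_apply, ← map_mul, ← pow_succ, pow_succ', map_mul, MulAut.mul_apply, h1]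
    induction j with
    | zero => simp
    | succ j ih =>
      rw [mul_add, mul_one, pow_add, map_mul, MulAut.mul_apply, MulAut.mul_apply, h1, h2]
      exact ih
  have hmm : m * m % 3 = 1 := by
    have : m % 3 = 1 ∨ m % 3 = 2 := by omega
    rcases this with h | h <;> simp [Nat.mul_mod, h]
  -- Taking m, the part of the order of a prime to 3, kills that part. Squaring it gives an exponent
  -- that is 1 mod 3, which preserves the 3-cycle rather than possibly inverting it.
  refine ⟨m * m, k, ?_, ?_⟩
  · rw [← pow_mul, show m * m * 3 ^ k = orderOf a * m by rw [hkm]; ring, pow_mul,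
      pow_orderOf_eq_one, one_pow]
  · obtain ⟨j, hj⟩ : ∃ j, m * m = 1 + 3 * j := ⟨m * m / 3, by omega⟩
    rw [hj, pow_add, pow_one, map_mul, MulAut.mul_apply, MulAut.mul_apply, (hcube j).1,
      (hcube j).2]
    exact ⟨hz, hv⟩

section Fusion

variable {G : Type*} [Group G]

theorem mul_eq_of_mem_omegaOne_centerOf {H : Subgroup G} {u : G}
    (hu : u ∈ omegaOne 2 (centerOf H)) : u ∈ H ∧ u * u = 1 ∧ ∀ g ∈ H, g * u = u * g := by
  induction hu using Subgroup.closure_induction with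
  | mem x hx =>
    obtain ⟨⟨y, hy, rfl⟩, hord⟩ := hx
    refine ⟨y.2, ?_, fun g hg => congrArg Subtype.val (Subgroup.mem_center_iff.1 hy ⟨g, hg⟩)⟩
    rw [← pow_two, ← hord, pow_orderOf_eq_one]
  | one => simp
  | mul x y _ _ ihx ihy =>
    obtain ⟨h1, h2, h3⟩ := ihx
    obtain ⟨h4, h5, h6⟩ := ihy
    refine ⟨mul_mem h1 h4, ?_, fun g hg => ?_⟩
    · rw [mul_assoc, ← mul_assoc y, ← h6 x h1, mul_assoc x y, h5, mul_one, h2]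
    · rw [← mul_assoc, h3 g hg, mul_assoc, h6 g hg, mul_assoc]
  | inv x _ ih =>
    obtain ⟨h1, h2, h3⟩ := ih
    rw [inv_eq_of_mul_eq_one_left h2]
    exact ⟨h1, h2, h3⟩

theorem exists_conj_of_not_isStronglyClosed {H : Subgroup G}
    (hnot : ¬ IsStronglyClosed (omegaOne 2 (centerOf H)) H) :
    ∃ z ∈ H, z * z = 1 ∧ z ≠ 1 ∧ (∀ g ∈ H, g * z = z * g) ∧
      ∃ g : G, MulAut.conj g z ∈ H ∧ ∃ h ∈ H, h * MulAut.conj g z ≠ MulAut.conj g z * h := by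
  by_contra! hcon
  refine hnot ⟨fun u hu => (mul_eq_of_mem_omegaOne_centerOf hu).1, fun g => ?_⟩
  rintro _ ⟨⟨u, hu, rfl⟩, hgu⟩
  obtain ⟨h1, h2, h3⟩ := mul_eq_of_mem_omegaOne_centerOf hu
  by_cases hu1 : u = 1
  · rw [hu1, map_one]
    exact one_mem _
  · refine Subgroup.subset_closure ⟨⟨⟨_, hgu⟩, ?_, rfl⟩, ?_⟩
    · exact Subgroup.mem_center_iff.2 fun h => Subtype.ext (hcon u h1 h2 hu1 h3 g hgu h h.2)
    · have : Fact (Nat.Prime 2) := ⟨Nat.prime_two⟩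
      refine orderOf_eq_prime ?_ fun h => hu1 ?_
      · rw [← map_pow, pow_two, h2, map_one]
      · exact (map_eq_one_iff _ (MulAut.conj g).injective).1 h

/-- A noncentral involution `v` of `S` and a `2`-automizer of `⟨z, v⟩` containing an element of
order three, normalizing the centralizer of `v` in `S`. -/
theorem exists_triality [Finite G] (S : Sylow 2 G) {z t g : G} (hzS : z ∈ S)
    (hzz : z * z = 1) (hzc : ∀ h ∈ S, h * z = z * h) (hgz : MulAut.conj g z = t) (htS : t ∈ S)
    (htc : ∃ h ∈ S, h * t ≠ t * h)
    (hswap : ∀ v ∈ S, v * v = 1 → (∃ h ∈ S, h * v ≠ v * h) →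
      ∃ n ∈ S, MulAut.conj n v = z * v)
    (hzs : ∀ s ∈ S, s * s = 1 → s ≠ 1 → s ≠ z → ∃ h ∈ S, h * s ≠ s * h) :
    ∃ v ∈ S, v * v = 1 ∧ v ≠ 1 ∧ v ≠ z ∧ ∃ b : G, ∃ k, b ^ 3 ^ k = 1 ∧
      MulAut.conj b z = v ∧ MulAut.conj b v = z * v ∧
      ∀ q ∈ S, q * v = v * q → MulAut.conj b q ∈ S := by
  have : Fact (Nat.Prime 2) := ⟨Nat.prime_two⟩
  have hconj : ∀ {x y : G}, y * x = x * y → MulAut.conj y x = x := fun {x y} h => by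
    rw [MulAut.conj_apply, h, mul_inv_cancel_right]
  have hcommconj : ∀ {x y : G} (c : G), x * y = y * x →
      MulAut.conj c x * MulAut.conj c y = MulAut.conj c y * MulAut.conj c x := fun c h => by
    rw [← map_mul, h, map_mul]
  have hinv : ∀ {x y c : G}, MulAut.conj c x = y → MulAut.conj c⁻¹ y = x := fun h => by
    rw [← h, map_inv, MulAut.inv_apply_self]
  have hSz : (S : Subgroup G) ≤ Subgroup.centralizer {z} := fun h hh =>
    Subgroup.mem_centralizer_singleton_iff.2 (hzc h hh)
  have htt : t * t = 1 := by rw [← hgz, ← map_mul, hzz, map_one]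
  -- an element fusing `t` to `z` and carrying the centralizer of `t` into `S`
  obtain ⟨k, hkt, hkS⟩ : ∃ k, MulAut.conj k t = z ∧
      ∀ q ∈ S, q * t = t * q → MulAut.conj k q ∈ S := by
    obtain ⟨c, hc, hcS⟩ := S.exists_conj_mem hSz
      (R := ((S : Subgroup G) ⊓ Subgroup.centralizer {t}).map (MulAut.conj g⁻¹).toMonoidHom)
      ((S.2.to_le inf_le_left).map _) (by
        rintro _ ⟨q, ⟨-, hq⟩, rfl⟩
        have := hcommconj g⁻¹ (Subgroup.mem_centralizer_singleton_iff.1 hq)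
        rw [hinv hgz] at this
        exact Subgroup.mem_centralizer_singleton_iff.2 this)
    refine ⟨c * g⁻¹, ?_, fun q hq hqt => ?_⟩
    · rw [map_mul, MulAut.mul_apply, hinv hgz]
      exact hconj (Subgroup.mem_centralizer_singleton_iff.1 hc)
    · rw [map_mul, MulAut.mul_apply]
      exact hcS _ ⟨q, ⟨hq, Subgroup.mem_centralizer_singleton_iff.2 hqt⟩, rfl⟩
  obtain ⟨n, hnS, hnt⟩ := hswap t htS htt htc
  set s := MulAut.conj k z with hs
  have hsS : s ∈ S := hkS z hzS (hzc t htS).symm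
  have hss : s * s = 1 := by rw [hs, ← map_mul, hzz, map_one]
  have hsz : s ≠ z := fun h => by
    have h1 : z = t := (MulAut.conj k).injective (h.trans hkt.symm)
    obtain ⟨h, hh, hne⟩ := htc
    exact hne (h1 ▸ hzc h hh)
  have hs1 : s ≠ 1 := fun h => by
    have h1 : z = 1 := (map_eq_one_iff _ (MulAut.conj k).injective).1 h
    exact hsz (h.trans h1.symm)
  -- k carries the pair t, z to z, s, so it turns the swap of t and zt by n into a transvection of
  -- ⟨z, s⟩ fixing s.
  have hmz : MulAut.conj (k * n * k⁻¹) z = s * z := by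
    rw [map_mul, map_mul, MulAut.mul_apply, MulAut.mul_apply, hinv hkt, hnt, map_mul, hkt]
  have hms : MulAut.conj (k * n * k⁻¹) s = s := by
    rw [map_mul, map_mul, MulAut.mul_apply, MulAut.mul_apply, hinv hs.symm, hconj (hzc n hnS)]
  -- replace `s` by a conjugate whose centralizer in `S` is large
  let H : Subgroup G := Subgroup.centralizer {z, s}
  obtain ⟨P, hP⟩ := (S.2.comap_subtype (K := H)).exists_le_sylow
  have hsP : s ∈ (P : Subgroup H).map H.subtype := by
    refine ⟨⟨s, ?_⟩, hP (Subgroup.mem_subgroupOf.2 hsS), rfl⟩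
    rintro _ (rfl | rfl)
    exacts [(hzc s hsS).symm, rfl]
  obtain ⟨c, hc, hcS⟩ := S.exists_conj_mem hSz (R := (P : Subgroup H).map H.subtype) (P.2.map _) (by
      rintro _ ⟨q, -, rfl⟩
      exact Subgroup.centralizer_le (by simp) q.2)
  set v := MulAut.conj c s with hv
  have hcz : MulAut.conj c z = z := hconj (Subgroup.mem_centralizer_singleton_iff.1 hc)
  have hvS : v ∈ S := hcS s hsP
  have hvv : v * v = 1 := by rw [hv, ← map_mul, hss, map_one]
  have hv1 : v ≠ 1 := fun h => hs1 ((map_eq_one_iff _ (MulAut.conj c).injective).1 h)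
  have hvz : v ≠ z := fun h => hsz ((MulAut.conj c).injective (h.trans hcz.symm))
  have hvc := hzs v hvS hvv hv1 hvz
  obtain ⟨l, hlS, hlv⟩ := hswap v hvS hvv hvc
  have hlz : MulAut.conj l z = z := hconj (hzc l hlS)
  have hzv : z * v = v * z := (hzc v hvS).symm
  obtain ⟨m, hmz', hmv⟩ : ∃ m, MulAut.conj m z = v * z ∧ MulAut.conj m v = v := by
    refine ⟨c * (k * n * k⁻¹) * c⁻¹, ?_, ?_⟩
    · rw [map_mul, map_mul, MulAut.mul_apply, MulAut.mul_apply, hinv hcz, hmz, map_mul, hcz]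
    · rw [map_mul, map_mul, MulAut.mul_apply, MulAut.mul_apply, hinv hv.symm, hms]
  -- m fixes v and sends z to vz, while l fixes z and sends v to zv. Their product is the cycle z,
  -- v, zv.
  have h0z : MulAut.conj (l * m) z = v := by
    rw [map_mul, MulAut.mul_apply, hmz', map_mul, hlv, hlz, hzv, mul_assoc, hzz, mul_one]
  have h0v : MulAut.conj (l * m) v = z * v := by rw [map_mul, MulAut.mul_apply, hmv, hlv]
  -- `P` conjugates into the centralizer of `v` in `S`, so the latter absorbs `2`-subgroups
  have habsorb : ∀ R : Subgroup G, IsPGroup 2 R → (∀ r ∈ R, r * z = z * r ∧ r * v = v * r) →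
      ∃ d : G, d * z = z * d ∧ d * v = v * d ∧ ∀ r ∈ R, MulAut.conj d r ∈ S := by
    intro R hR hRc
    obtain ⟨d, hd, hdP⟩ := P.exists_conj_mem_map (R := R.map (MulAut.conj c⁻¹).toMonoidHom)
      (hR.map _) (by
        rintro _ ⟨r, hr, rfl⟩
        obtain ⟨h1, h2⟩ := hRc r hr
        rintro _ (rfl | rfl)
        · have := hcommconj c⁻¹ h1
          rw [hinv hcz] at this
          exact this.symm
        · have := hcommconj c⁻¹ h2
          rw [hinv hv.symm] at this
          exact this.symm)
    have hdz : d * z = z * d := (hd z (by simp)).symm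
    have hds : d * s = s * d := (hd s (by simp)).symm
    refine ⟨MulAut.conj c d, ?_, ?_, fun r hr => ?_⟩
    · have := hcommconj c hdz
      rwa [hcz] at this
    · exact hcommconj c hds
    · have := hcS _ (hdP _ ⟨r, hr, rfl⟩)
      have e : MulAut.conj (MulAut.conj c d) r =
          MulAut.conj c (MulAut.conj d (MulAut.conj c⁻¹ r)) := by
        simp only [MulAut.conj_apply]; group
      rw [e]
      exact this
  -- The image of C_S(v) under l * m again centralizes z and v, so an element d centralizing both
  -- brings it back into S without disturbing the 3-cycle.
  obtain ⟨d, hdz, hdv, hdS⟩ := habsorb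
    (((S : Subgroup G) ⊓ Subgroup.centralizer {v}).map (MulAut.conj (l * m)).toMonoidHom)
    ((S.2.to_le inf_le_left).map _) (by
      rintro _ ⟨q, ⟨hqS, hq⟩, rfl⟩
      have h1 := hcommconj (l * m) (Subgroup.mem_centralizer_singleton_iff.1 hq)
      have h2 := hcommconj (l * m) (hzc q hqS)
      rw [h0v] at h1
      rw [h0z] at h2
      refine ⟨?_, h2⟩
      change MulAut.conj (l * m) q * z = z * MulAut.conj (l * m) q
      have h3 : z = z * v * v := by rw [mul_assoc, hvv, mul_one]
      rw [h3, ← mul_assoc, h1, mul_assoc, h2, ← mul_assoc])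
  have haz : MulAut.conj (d * (l * m)) z = v := by
    rw [map_mul, MulAut.mul_apply, h0z, hconj hdv]
  have hav : MulAut.conj (d * (l * m)) v = z * v := by
    rw [map_mul, MulAut.mul_apply, h0v, map_mul, hconj hdz, hconj hdv]
  obtain ⟨i, j, h3, hbz, hbv⟩ := exists_pow_conj_eq haz hav hzv hvv
  refine ⟨v, hvS, hvv, hv1, hvz, _, j, h3, hbz, hbv, ?_⟩
  have hstep : ∀ q ∈ S, q * v = v * q → MulAut.conj (d * (l * m)) q ∈ S ∧
      MulAut.conj (d * (l * m)) q * v = v * MulAut.conj (d * (l * m)) q := by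
    intro q hq hqv
    refine ⟨?_, ?_⟩
    · rw [map_mul, MulAut.mul_apply]
      exact hdS _ ⟨q, ⟨hq, Subgroup.mem_centralizer_singleton_iff.2 hqv⟩, rfl⟩
    · have := hcommconj (d * (l * m)) (hzc q hq)
      rwa [haz] at this
  have hpow : ∀ i, ∀ q ∈ S, q * v = v * q → MulAut.conj ((d * (l * m)) ^ i) q ∈ S := by
    intro i
    induction i with
    | zero => simp +contextual
    | succ i ih =>
      intro q hq hqv
      rw [pow_succ, map_mul, MulAut.mul_apply]
      exact ih _ (hstep q hq hqv).1 (hstep q hq hqv).2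
  exact hpow i

end Fusion

/-! ### The involution action on the centralizer, and conclusion -/

theorem Subgroup.exists_conj_hom {G : Type*} [Group G] {S : Subgroup G} {Q : Subgroup S} {b : G}
    (h : ∀ q ∈ Q, ∃ r ∈ Q, (r : G) = b * q * b⁻¹) :
    ∃ φ : Q →* Q, ∀ q, ((φ q : S) : G) = b * (q : S) * b⁻¹ := by
  choose f hfQ hf using h
  refine ⟨⟨⟨fun q => ⟨f q q.2, hfQ q q.2⟩, ?_⟩, fun q r => ?_⟩, fun q => hf q q.2⟩
  · refine Subtype.ext (Subtype.ext ?_)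
    simp [hf]
  · refine Subtype.ext (Subtype.ext ?_)
    simp [hf]

/-- Conjugation by b cycles z, v, zv. Conjugation by n fixes z and swaps v with zv, so n²
centralizes v and lies in Q, which makes the square of σ inner. -/
theorem InvolutionAction.of_conj {G : Type*} [Group G] {S : Subgroup G} (hS : IsPGroup 2 S)
    {z v n : S} (hzz : z * z = 1) (hz1 : z ≠ 1) (hvv : v * v = 1) (hv1 : v ≠ 1) (hvz : v ≠ z)
    (hzc : ∀ g, g * z = z * g)
    (hV : ∀ c, c * c = 1 → c * v = v * c → c = 1 ∨ c = z ∨ c = v ∨ c = z * v)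
    (hn : n * v * n⁻¹ = z * v) {b : G} {k : ℕ} (hbk : b ^ 3 ^ k = 1)
    (hbz : b * z * b⁻¹ = v) (hbv : b * v * b⁻¹ = z * v)
    {Q : Subgroup S} (hQv : Q = Subgroup.centralizer {v}) {α σ : Q →* Q}
    (hα : ∀ q, ((α q : S) : G) = b * (q : S) * b⁻¹) (hσ : ∀ q, (σ q : S) = n * q * n⁻¹) :
    InvolutionAction α σ := by
  have hmem : ∀ {q : S}, q ∈ Q ↔ q * v = v * q := by
    intro q
    rw [hQv, Subgroup.mem_centralizer_singleton_iff]
  have hQ : ∀ q : Q, (q : S) * v = v * q := fun q => hmem.1 q.2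
  have hzv : z * v = v * z := (hzc v).symm
  obtain ⟨Z, hZ⟩ : ∃ Z : Q, (Z : S) = z :=
    ⟨⟨z, hmem.2 hzv⟩, rfl⟩
  obtain ⟨V, hVv⟩ : ∃ V : Q, (V : S) = v := ⟨⟨v, hmem.2 rfl⟩, rfl⟩
  have hZZ : Z * Z = 1 := Subtype.ext (by simpa [hZ] using hzz)
  have hVV : V * V = 1 := Subtype.ext (by simpa [hVv] using hvv)
  have hZV : Z * V = V * Z := Subtype.ext (by simpa [hVv, hZ] using hzv)
  have hZV2 : Z * V * (Z * V) = 1 := by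
    rw [mul_assoc, ← mul_assoc V, ← hZV, mul_assoc Z V V, hVV, mul_one, hZZ]
  have hcases : ∀ u : Q, u * u = 1 ↔ u = 1 ∨ u = Z ∨ u = V ∨ u = Z * V := by
    intro u
    constructor
    · intro hu
      have h := hV u (congrArg Subtype.val hu) (hQ u)
      rcases h with h | h | h | h
      · exact Or.inl (Subtype.ext h)
      · exact Or.inr (Or.inl (Subtype.ext (h.trans hZ.symm)))
      · exact Or.inr (Or.inr (Or.inl (Subtype.ext (h.trans hVv.symm))))
      · exact Or.inr (Or.inr (Or.inr (Subtype.ext (h.trans (by rw [← hZ, ← hVv]; rfl)))))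
    · rintro (rfl | rfl | rfl | rfl)
      exacts [one_mul 1, hZZ, hVV, hZV2]
  have hαZ : α Z = V := Subtype.ext (Subtype.ext (by rw [hα, hZ, hVv, hbz]))
  have hαV : α V = Z * V := Subtype.ext (Subtype.ext (by
    rw [hα, hVv, hbv, ← hVv, ← hZ]; rfl))
  have hαZV : α (Z * V) = Z := by rw [map_mul, hαZ, hαV, hZV, ← mul_assoc, hVV, one_mul]
  have hσV : σ V = Z * V := Subtype.ext (by rw [hσ, hVv, hn, ← hVv, ← hZ]; rfl)
  have hZ1 : Z ≠ 1 := fun h => hz1 (by rw [← hZ, h]; rfl)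
  have hV1 : V ≠ 1 := fun h => hv1 (by rw [← hVv, h]; rfl)
  have hVZ : V ≠ Z := fun h => hvz (by rw [← hVv, h, hZ])
  refine ⟨hS.to_subgroup Q, fun u hu g => ?_, ?_, fun u hu => ?_, ⟨k, fun x => ?_⟩,
    ⟨V, hVV, fun h => hZ1 ?_⟩, ⟨⟨n * n, ?_⟩, fun x => Subtype.ext ?_⟩⟩
  · have hZg : Z * g = g * Z := Subtype.ext (by simpa [hZ] using (hzc g).symm)
    have hVg : V * g = g * V := Subtype.ext (by simpa [hVv] using (hQ g).symm)
    rcases (hcases u).1 hu with rfl | rfl | rfl | rfl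
    · simp
    · exact hZg
    · exact hVg
    · rw [mul_assoc, hVg, ← mul_assoc, hZg, mul_assoc]
  · classical
    rw [Nat.subtype_card ({1, Z, V, Z * V} : Finset Q) (by simp [hcases]),
      Finset.card_insert_of_notMem, Finset.card_insert_of_notMem, Finset.card_insert_of_notMem,
      Finset.card_singleton]
    · simpa using hZ1
    · simp [hVZ.symm, hV1]
    · simp only [Finset.mem_insert, Finset.mem_singleton, not_or]
      exact ⟨hZ1.symm, hV1.symm, fun h => hVZ (mul_right_cancel (hVV.trans h))⟩
  · rcases (hcases u).1 hu with rfl | rfl | rfl | rfl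
    · simp
    · rw [hαZ, hαV, hZV2]
    · rw [hαV, hαZV, hZV, ← mul_assoc, hVV, one_mul, hZZ]
    · rw [hαZV, hαZ, mul_assoc, hZV2]
  · have hit : ∀ i, (((α^[i] x : Q) : S) : G) = b ^ i * (x : S) * (b ^ i)⁻¹ := by
      intro i
      induction i with
      | zero => simp
      | succ i ih =>
        rw [Function.iterate_succ_apply', hα, ih, pow_succ']
        group
    refine Subtype.ext (Subtype.ext ?_)
    rw [hit, hbk]
    simp
  · rw [hσV] at h
    exact mul_eq_right.1 h
  · rw [hmem, ← mul_inv_eq_iff_eq_mul]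
    calc n * n * v * (n * n)⁻¹ = n * (n * v * n⁻¹) * n⁻¹ := by group
      _ = (n * z) * v * n⁻¹ := by rw [hn]; group
      _ = z * (n * v * n⁻¹) := by rw [hzc]; group
      _ = (z * z) * v := by rw [hn]; group
      _ = v := by rw [hzz, one_mul]
  · rw [hσ, hσ]
    change _ = (n * n) * (x : S) * (n * n)⁻¹
    group

theorem mainTheorem12 {G : Type*} [Group G] [Finite G] (S : Sylow 2 G)
    (hrank : elemRank S = 2)
    (hnot : ¬ IsStronglyClosed (omegaOne 2 (centerOf (S : Subgroup G))) (S : Subgroup G)) :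
    IsDihedralTwoGroup S ∨ IsSemidihedral S ∨ IsWreathed S := by
  have hS : IsPGroup 2 S := S.2
  obtain ⟨z, hzS, hzz, hz1, hzc, g, htS, htc⟩ := exists_conj_of_not_isStronglyClosed hnot
  have hzc' : ∀ g : S, g * ⟨z, hzS⟩ = ⟨z, hzS⟩ * g := fun g => Subtype.ext (hzc g g.2)
  have hzz' : (⟨z, hzS⟩ : S) * ⟨z, hzS⟩ = 1 := Subtype.ext hzz
  have hz1' : (⟨z, hzS⟩ : S) ≠ 1 := fun h => hz1 (congrArg Subtype.val h)
  have hrk : ∀ v c : S, v * v = 1 → v ≠ 1 → v ≠ ⟨z, hzS⟩ → c * c = 1 → c * v = v * c →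
      c = 1 ∨ c = ⟨z, hzS⟩ ∨ c = v ∨ c = ⟨z, hzS⟩ * v := fun v c hv hv1 hvz hc hcv =>
    eq_of_commuting_involutions hS hrank hzz' hv hc (hzc' v).symm (hzc' c) hcv hz1' hv1 hvz.symm
  have hne : ∀ v : S, (∃ h ∈ S, h * (v : G) ≠ v * h) → v ≠ 1 ∧ v ≠ ⟨z, hzS⟩ ∧
      v ∉ Subgroup.center S := by
    rintro v ⟨h, hh, hv⟩
    refine ⟨?_, ?_, fun hc => ?_⟩
    · rintro rfl
      simp at hv
    · rintro rfl
      exact hv (hzc h hh)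
    · exact hv (congrArg Subtype.val (Subgroup.mem_center_iff.1 hc ⟨h, hh⟩))
  have hswap : ∀ v : S, v * v = 1 → (∃ h ∈ S, h * (v : G) ≠ v * h) →
      ∃ n : S, n * v * n⁻¹ = ⟨z, hzS⟩ * v := fun v hv hvc =>
    exists_conj_eq_mul_of_isPGroup hS hzc' hv (hne v hvc).2.2 fun c =>
      hrk v c hv (hne v hvc).1 (hne v hvc).2.1
  have htt : MulAut.conj g z * MulAut.conj g z = 1 := by rw [← map_mul, hzz, map_one]
  -- A second central involution s would, with z, generate every involution of S. The noncentral
  -- conjugate of z would then be central.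
  have hzs : ∀ s ∈ S, s * s = 1 → s ≠ 1 → s ≠ z → ∃ h ∈ S, h * s ≠ s * h := by
    intro s hs hss hs1 hsz
    by_contra! hcon
    obtain ⟨h, hh, hne⟩ := htc
    refine hne ?_
    have h1 := hrk ⟨s, hs⟩ ⟨_, htS⟩ (Subtype.ext hss) (fun h => hs1 (congrArg Subtype.val h))
      (fun h => hsz (congrArg Subtype.val h)) (Subtype.ext htt) (Subtype.ext (hcon _ htS))
    have hc1 := Subgroup.one_mem (Subgroup.center S)
    have hcz := Subgroup.mem_center_iff.2 hzc'
    have hcs : (⟨s, hs⟩ : S) ∈ Subgroup.center S :=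
      Subgroup.mem_center_iff.2 fun h => Subtype.ext (hcon h h.2)
    have hct : (⟨_, htS⟩ : S) ∈ Subgroup.center S := by
      rcases h1 with h1 | h1 | h1 | h1 <;> rw [h1]
      exacts [hc1, hcz, hcs, mul_mem hcz hcs]
    exact congrArg Subtype.val (Subgroup.mem_center_iff.1 hct ⟨h, hh⟩)
  obtain ⟨v, hvS, hvv, hv1, hvz, b, k, hbk, hbz, hbv, hbS⟩ := exists_triality S hzS hzz hzc rfl
    htS htc (fun v hv hvv hvc => by
      obtain ⟨n, hn⟩ := hswap ⟨v, hv⟩ (Subtype.ext hvv) hvc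
      exact ⟨n, n.2, congrArg Subtype.val hn⟩) hzs
  have hvv' : (⟨v, hvS⟩ : S) * ⟨v, hvS⟩ = 1 := Subtype.ext hvv
  have hv1' : (⟨v, hvS⟩ : S) ≠ 1 := fun h => hv1 (congrArg Subtype.val h)
  have hvz' : (⟨v, hvS⟩ : S) ≠ ⟨z, hzS⟩ := fun h => hvz (congrArg Subtype.val h)
  obtain ⟨n, hn⟩ := hswap ⟨v, hvS⟩ hvv' (hzs v hvS hvv hv1 hvz)
  let Q : Subgroup S := Subgroup.centralizer {⟨v, hvS⟩}
  have hQ : ∀ {q : S}, q ∈ Q ↔ q * ⟨v, hvS⟩ = ⟨v, hvS⟩ * q := Subgroup.mem_centralizer_singleton_iff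
  have hnQ : ∀ q ∈ Q, n * q * n⁻¹ ∈ Q := by
    intro q hq
    have e : (⟨v, hvS⟩ : S) = ⟨z, hzS⟩ * (n * ⟨v, hvS⟩ * n⁻¹) := by
      rw [hn, ← mul_assoc, hzz', one_mul]
    have h : n * q * n⁻¹ * (n * ⟨v, hvS⟩ * n⁻¹) = n * ⟨v, hvS⟩ * n⁻¹ * (n * q * n⁻¹) := by
      rw [conj_mul, conj_mul, hQ.1 hq]
    rw [hQ, e, ← mul_assoc, hzc', mul_assoc, h]
    exact (mul_assoc _ _ _).symm
  obtain ⟨α, hα⟩ := Subgroup.exists_conj_hom (Q := Q) (b := b) fun q hq =>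
    ⟨⟨_, hbS q q.2 (congrArg Subtype.val (hQ.1 hq))⟩, hQ.2 (Subtype.ext (by
      have h := congrArg (MulAut.conj b) (hzc q q.2)
      rwa [map_mul, map_mul, hbz] at h)), rfl⟩
  obtain ⟨σ, hσ⟩ := Subgroup.exists_conj_hom (Q := Q) (b := (n : G)) fun q hq =>
    ⟨_, hnQ q hq, rfl⟩
  have d : InvolutionAction α σ := InvolutionAction.of_conj hS hzz' hz1' hvv' hv1' hvz' hzc'
    (fun c => hrk _ c hvv' hv1' hvz') hn hbk hbz hbv rfl hα fun q => Subtype.ext (hσ q)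
  have hvQ : (⟨v, hvS⟩ : S) ∈ Q := hQ.2 rfl
  refine d.dihedral_or_semidihedral_or_wreathed hS (fun g hg => hQ.2 (hg _ hvQ hvv'))
    (hQ.2 (hzc' _).symm) hzz' hz1' hzc' (τ := n) (fun h => hz1' ?_) fun q hq _ => hnQ q hq
  rw [mul_inv_eq_iff_eq_mul.2 (hQ.1 h)] at hn
  exact right_eq_mul.1 hn
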